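/- Let $H$ be a fixed finite simple graph without loops. In the problem Max Partial $H$-Coloring, an instance consists of a finite simple graph $G$ and a revenue function $\mathsf{rev}\colon V(G)\times V(H)\to\mathbb{R}$. A solution is a partial $H$-coloring of $G$, that is, a partial function $\phi\colon V(G)\rightharpoonup V(H)$ that is a homomorphism from $G[\mathrm{dom}\,\phi]$ to $H$. The task is to output a solution whose revenue $\sum_{u\in\mathrm{dom}\,\phi}\mathsf{rev}(u,\phi(u))$ is maximum among all solutions. Let $n$ denote the number of vertices of $G$. A graph is $\mathcal{F}$-free if it has no induced subgraph isomorphic to a graph in $\mathcal{F}$. Let $P_m$ be the path on $m$ vertices, let $S_t$ be the graph obtained from the star $K_{1,t}$ by subdividing every edge once, and let $L_t$ be the graph obtained from $S_t$ by making the $t$ vertices at distance two from the centre pairwise adjacent (so $L_1=P_3$). Running times are counted on a random access machine with integer cells and real cells, indirect addressing, and unit-cost addition, subtraction and comparison, to which $G$ is given by its adjacency matrix and $\mathsf{rev}$ by the matrix of its values. Then for any fixed $s,t\in\mathbb{N}$ and any fixed $H$ as above, Max Partial $H$-Coloring can be solved on $\{P_6,L_s,S_t\}$-free graphs in time $n^{\mathcal{O}(\sqrt{n})}$,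 where the implied constant depends only on $s$, $t$ and $H$. In particular, Max Partial $H$-Coloring can be solved on $P_5$-free graphs in time $n^{\mathcal{O}(\sqrt{n})}$, where the implied constant depends only on $H$. -/

import Mathlib

/-! ## Graphs -/

/-- The vertices of the graphs `S_t` and `L_t`: the centre of the star, the `t` vertices
subdividing its edges, and its `t` leaves. -/
inductive SpiderVertex (t : ℕ) : Type
  | center : SpiderVertex t
  | mid (i : Fin t) : SpiderVertex t
  | leaf (i : Fin t) : SpiderVertex t

/-- The edges of the star `K_{1,t}` with every edge subdivided once. -/
inductive SpiderEdge (t : ℕ) : SpiderVertex t → SpiderVertex t → Prop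
  | inner (i : Fin t) : SpiderEdge t .center (.mid i)
  | outer (i : Fin t) : SpiderEdge t (.mid i) (.leaf i)

/-- `S_t`: the star `K_{1,t}` with every edge subdivided once. -/
def graphS (t : ℕ) : SimpleGraph (SpiderVertex t) :=
  SimpleGraph.fromRel (SpiderEdge t)

/-- `L_t`: the graph `S_t` with its `t` outer vertices made pairwise adjacent
(so that `L_1` is the path on three vertices). -/
def graphL (t : ℕ) : SimpleGraph (SpiderVertex t) :=
  graphS t ⊔ SimpleGraph.fromRel (fun a b => ∃ i j : Fin t, a = .leaf i ∧ b = .leaf j)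

/-- `G` is `F`-free: `G` has no induced subgraph isomorphic to `F`. -/
def InducedFree {U V : Type} (F : SimpleGraph U) (G : SimpleGraph V) : Prop :=
  ¬ F.IsIndContained G

/-! ## The problem -/

/-- A partial function `φ` from the vertices of `G` to the vertices of `H` (`none` means
"outside the domain") is a partial `H`-coloring of `G`: it is a homomorphism to `H` from the
subgraph of `G` that its domain induces. -/
def IsPartialColoring {V W : Type} (G : SimpleGraph V) (H : SimpleGraph W)
    (φ : V → Option W) : Prop :=
  ∀ ⦃u v : V⦄ ⦃a b : W⦄, G.Adj u v → φ u = some a → φ v = some b → H.Adj a b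

/-- The revenue of `φ`: the sum of `rev u (φ u)` over the domain of `φ`. -/
noncomputable def revenue {V W : Type} [Fintype V] (rev : V → W → ℝ) (φ : V → Option W) : ℝ :=
  ∑ u, (φ u).elim 0 (rev u)

/-- `φ` is an optimum solution to the instance `(G, rev)` of Max Partial `H`-Coloring. -/
def IsOptimum {V W : Type} [Fintype V] (G : SimpleGraph V) (H : SimpleGraph W)
    (rev : V → W → ℝ) (φ : V → Option W) : Prop :=
  IsPartialColoring G H φ ∧
    ∀ ψ : V → Option W, IsPartialColoring G H ψ → revenue rev ψ ≤ revenue rev φ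

/-! ## The machine model

A random access machine with integer memory and real memory, programmed by structured programs.
The memory consists of arrays of natural numbers and arrays of real numbers; a program names
finitely many of them, and the index at which an array is read or written may be computed
(indirect addressing). The arithmetic is addition, subtraction and comparison. There is no
multiplication, the only real constants are `0` and `1`, and no real number can be turned into a
natural number except by comparisons. Every elementary operation costs one step. -/

namespace RAM

/-- The memory: `nat a i` is cell `i` of the `a`-th array of natural numbers, and `real a i` is
cell `i` of the `a`-th array of real numbers. -/
structure Store where
  nat : ℕ → ℕ → ℕ
  real : ℕ → ℕ → ℝ

/-- Expressions for natural numbers; `get a i` reads cell `i` of array `a`, and `sub` is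
truncated subtraction. -/
inductive NExp : Type
  | const (c : ℕ) : NExp
  | get (a : ℕ) (i : NExp) : NExp
  | add (e f : NExp) : NExp
  | sub (e f : NExp) : NExp

/-- Expressions for real numbers; `get a i` reads cell `i` of array `a`. -/
inductive RExp : Type
  | zero : RExp
  | one : RExp
  | get (a : ℕ) (i : NExp) : RExp
  | add (e f : RExp) : RExp
  | sub (e f : RExp) : RExp

/-- Tests. -/
inductive Cond : Type
  | eq (e f : NExp) : Cond
  | lt (e f : NExp) : Cond
  | rlt (e f : RExp) : Cond
  | not (c : Cond) : Cond
  | and (c d : Cond) : Cond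

/-- Programs. -/
inductive Prog : Type
  | skip : Prog
  | setNat (a : ℕ) (i e : NExp) : Prog
  | setReal (a : ℕ) (i : NExp) (e : RExp) : Prog
  | seq (p q : Prog) : Prog
  | ite (c : Cond) (p q : Prog) : Prog
  | loop (c : Cond) (p : Prog) : Prog

/-- The value of an expression. -/
def NExp.eval (m : Store) : NExp → ℕ
  | .const c => c
  | .get a i => m.nat a (i.eval m)
  | .add e f => e.eval m + f.eval m
  | .sub e f => e.eval m - f.eval m

/-- The number of steps for evaluating an expression: the number of its operations. -/
def NExp.cost : NExp → ℕ
  | .const _ => 1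
  | .get _ i => i.cost + 1
  | .add e f => e.cost + f.cost + 1
  | .sub e f => e.cost + f.cost + 1

/-- The value of an expression. -/
noncomputable def RExp.eval (m : Store) : RExp → ℝ
  | .zero => 0
  | .one => 1
  | .get a i => m.real a (i.eval m)
  | .add e f => e.eval m + f.eval m
  | .sub e f => e.eval m - f.eval m

/-- The number of steps for evaluating an expression. -/
def RExp.cost : RExp → ℕ
  | .zero => 1
  | .one => 1
  | .get _ i => i.cost + 1
  | .add e f => e.cost + f.cost + 1
  | .sub e f => e.cost + f.cost + 1

/-- The test `c` succeeds. -/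
def Cond.Holds (m : Store) : Cond → Prop
  | .eq e f => e.eval m = f.eval m
  | .lt e f => e.eval m < f.eval m
  | .rlt e f => e.eval m < f.eval m
  | .not c => ¬ c.Holds m
  | .and c d => c.Holds m ∧ d.Holds m

/-- The number of steps for performing a test. -/
def Cond.cost : Cond → ℕ
  | .eq e f => e.cost + f.cost + 1
  | .lt e f => e.cost + f.cost + 1
  | .rlt e f => e.cost + f.cost + 1
  | .not c => c.cost + 1
  | .and c d => c.cost + d.cost + 1

/-- Write `x` into cell `i` of the `a`-th array of natural numbers. -/
def Store.writeNat (m : Store) (a i x : ℕ) : Store :=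
  { m with nat := Function.update m.nat a (Function.update (m.nat a) i x) }

/-- Write `x` into cell `i` of the `a`-th array of real numbers. -/
noncomputable def Store.writeReal (m : Store) (a i : ℕ) (x : ℝ) : Store :=
  { m with real := Function.update m.real a (Function.update (m.real a) i x) }

/-- `Exec p m t m'`: the program `p`, started with memory `m`, halts after exactly `t` steps with
memory `m'`. -/
inductive Exec : Prog → Store → ℕ → Store → Prop
  | skip (m : Store) : Exec .skip m 1 m
  | setNat (a : ℕ) (i e : NExp) (m : Store) :
      Exec (.setNat a i e) m (i.cost + e.cost + 1) (m.writeNat a (i.eval m) (e.eval m))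
  | setReal (a : ℕ) (i : NExp) (e : RExp) (m : Store) :
      Exec (.setReal a i e) m (i.cost + e.cost + 1) (m.writeReal a (i.eval m) (e.eval m))
  | seq {p q : Prog} {m m₁ m₂ : Store} {t₁ t₂ : ℕ} :
      Exec p m t₁ m₁ → Exec q m₁ t₂ m₂ → Exec (.seq p q) m (t₁ + t₂) m₂
  | iteTrue {c : Cond} {p q : Prog} {m m₁ : Store} {t : ℕ} :
      c.Holds m → Exec p m t m₁ → Exec (.ite c p q) m (c.cost + t + 1) m₁
  | iteFalse {c : Cond} {p q : Prog} {m m₁ : Store} {t : ℕ} :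
      ¬ c.Holds m → Exec q m t m₁ → Exec (.ite c p q) m (c.cost + t + 1) m₁
  | loopDone {c : Cond} {p : Prog} {m : Store} :
      ¬ c.Holds m → Exec (.loop c p) m (c.cost + 1) m
  | loopStep {c : Cond} {p : Prog} {m m₁ m₂ : Store} {t₁ t₂ : ℕ} :
      c.Holds m → Exec p m t₁ m₁ → Exec (.loop c p) m₁ t₂ m₂ →
      Exec (.loop c p) m (c.cost + t₁ + t₂ + 1) m₂

end RAM

/-! ## Algorithms for Max Partial `H`-Coloring -/

open scoped Classical in
/-- The memory at the start of the computation on the instance `(G, rev)`, where `G` has the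
vertices `0, …, n - 1` and `H` has the vertices `0, …, k - 1`. Cell `0` of the natural array `0`
holds `n`; the natural array `1` holds the adjacency matrix of `G` row by row (the entry for
`(u, v)` is in cell `v + n * u`); the real array `0` holds the matrix of revenues row by row
(the entry for `(u, a)` is in cell `a + k * u`). All other cells hold `0`. -/
noncomputable def inputStore {n k : ℕ} (G : SimpleGraph (Fin n)) (rev : Fin n → Fin k → ℝ) :
    RAM.Store where
  nat a i :=
    if a = 0 ∧ i = 0 then n
    else if h : a = 1 ∧ i < n * n then
      if G.Adj (finProdFinEquiv.symm ⟨i, h.2⟩).1 (finProdFinEquiv.symm ⟨i, h.2⟩).2 then 1 else 0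
    else 0
  real a i :=
    if h : a = 0 ∧ i < n * k then
      rev (finProdFinEquiv.symm ⟨i, h.2⟩).1 (finProdFinEquiv.symm ⟨i, h.2⟩).2
    else 0

/-- The memory `m` holds the partial function `φ` as the output: cell `u` of the natural array `2`
is `0` if `u` is outside the domain of `φ`, and `a + 1` if `φ` maps `u` to `a`. -/
def HoldsOutput {n k : ℕ} (m : RAM.Store) (φ : Fin n → Option (Fin k)) : Prop :=
  ∀ u : Fin n, m.nat 2 u = (φ u).elim 0 (fun a => (a : ℕ) + 1)

/-- Max Partial `H`-Coloring can be solved in time `T(n)` on the graphs in the class `𝒢`, where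
`n` is the number of vertices of the input graph: one program, on every instance `(G, rev)` with
`G` in `𝒢`, halts after at most `T(n)` steps and outputs an optimum solution. -/
def SolvableInTime {k : ℕ} (H : SimpleGraph (Fin k)) (𝒢 : ∀ n : ℕ, SimpleGraph (Fin n) → Prop)
    (T : ℕ → ℕ) : Prop :=
  ∃ p : RAM.Prog, ∀ (n : ℕ) (G : SimpleGraph (Fin n)) (rev : Fin n → Fin k → ℝ), 𝒢 n G →
    ∃ (t : ℕ) (m : RAM.Store) (φ : Fin n → Option (Fin k)),
      RAM.Exec p (inputStore G rev) t m ∧ t ≤ T n ∧ HoldsOutput m φ ∧ IsOptimum G H rev φ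

/-- `T(n) = n ^ O(√n)`. (The base is at least `2`: `1 ^ x` does not bound anything.) -/
def IsPowSqrt (T : ℕ → ℕ) : Prop :=
  ∃ C : ℝ, ∀ n : ℕ, 2 ≤ n → (T n : ℝ) ≤ (n : ℝ) ^ (C * √(n : ℝ))

/-! ## Conflicts between vertex-colour pairs -/

namespace ColoringSearch

/-! A partial H-coloring is a set of items, an item being a vertex `u` together with a colour `a`,
numbered `a + k * u`. Two items conflict if they share a vertex, or if their vertices are adjacent
in G while their colours are not adjacent in H. Partial colorings are exactly the independent sets
of this conflict graph, so the task is to find an independent set of maximum weight. As H has no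
loops, items of equal colour at adjacent vertices always conflict.

An unknown independent set I is found by exhaustive guessing along a tree whose nodes carry item
sets. There are three moves. (1) If I contains an item with more than r conflicts in the current
set, this item is guessed and everything in conflict with it is deleted, which removes more than r
items. (2) If I has no such item, all items with more than r conflicts are deleted. Afterwards at
most r pairwise linked items have the same colour, so cliques have at most `k * r` items
(`cliqueLE_purge`). (3) For an item u, the neighbourhood N(u) is separated from the rest. Let D be a
smallest subset of I ∩ N(u) that has the same conflicts outside N(u) as all of I ∩ N(u). Each member
of D has a private conflict, so if D were large, the pigeonhole principle on colours and Ramsey's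
theorem would produce an induced `L_s` or `S_t`. Hence |D| ≤ R with R depending only on s, t and k
(`exists_markers`). Once D is guessed, the items outside N(u) in conflict with D are deleted, and so
are the items of N(u) that conflict with some other item outside. I survives, and no conflict
crosses between the two sides, so the connected pieces on each side are independent subproblems
(`solvable_split`).

The third move is applied along a Gyárfás path. In a connected set of clique number c, pieces inside
the neighbourhood of a split centre have clique number at most c - 1. A piece that avoids the
neighbourhoods of three successive centres x₀, w, v lies in a component all of which is linked to
one further item z, since otherwise there would be an induced path on six vertices. So three levels
lower the clique number by one (`solvable_of_cliqueLE`). With r about √n there are at most `k * r`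
moves of the first kind, one of the second and `3 * k * r` of the third (`solvable_range`). The
depth is thus O(√n), each node has polynomially many children, and the tree has n^O(√n) nodes.

The remainder is a verified implementation. The machine need not know which move is right: one guess
bundles all three, and the value `n * k`, which is no item, switches a component off. A forward
sweep stores the item sets of all nodes under all guesses, and a backward sweep combines the
solutions of the children. Every guess yields an independent set (`guess_sound`), and for an optimum
I the right guess is among those tried (`weight_le_value`).

The statement on `P_5` is the case s = 3, t = 2, because `P_5` is an induced subgraph of `P_6`,
`L_3` and `S_2`. -/

/-- Finite Ramsey theorem for two colours. -/
theorem exists_ramsey (s t : ℕ) : ∃ m : ℕ, ∀ (E : ℕ → ℕ → Prop), (∀ x y, E x y → E y x) →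
    ∀ A : Finset ℕ, m ≤ A.card →
      (∃ C ⊆ A, C.card = s ∧ ∀ x ∈ C, ∀ y ∈ C, x ≠ y → E x y) ∨
      (∃ C ⊆ A, C.card = t ∧ ∀ x ∈ C, ∀ y ∈ C, x ≠ y → ¬ E x y) := by
  classical
  induction s generalizing t with
  | zero => exact ⟨0, fun E _ A _ => Or.inl ⟨∅, by simp, by simp, by simp⟩⟩
  | succ s ihs =>
    induction t with
    | zero => exact ⟨0, fun E _ A _ => Or.inr ⟨∅, by simp, by simp, by simp⟩⟩
    | succ t iht =>
      obtain ⟨m₁, h₁⟩ := ihs (t + 1)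
      obtain ⟨m₂, h₂⟩ := iht
      -- Besides x at least `m₁ + m₂` elements remain, so at least `m₁` of them are related to x or
      -- at least `m₂` are not.
      refine ⟨m₁ + m₂ + 1, fun E hE A hA => ?_⟩
      obtain ⟨x, hx⟩ : A.Nonempty := Finset.card_pos.1 (by omega)
      have hcard := Finset.card_filter_add_card_filter_not (s := A.erase x) (E x)
      rw [Finset.card_erase_of_mem hx] at hcard
      by_cases hc : m₁ ≤ ((A.erase x).filter (E x)).card
      · rcases h₁ E hE _ hc with ⟨C, hCA, hC, hCE⟩ | ⟨C, hCA, hC, hCE⟩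
        · have hmem : ∀ y ∈ C, y ≠ x ∧ y ∈ A ∧ E x y := fun y hy => by
            have := hCA hy
            simp only [Finset.mem_filter, Finset.mem_erase] at this
            tauto
          have hxC : x ∉ C := fun h => (hmem x h).1 rfl
          refine Or.inl ⟨insert x C, ?_, by rw [Finset.card_insert_of_notMem hxC, hC], ?_⟩
          · intro y hy
            rcases Finset.mem_insert.1 hy with rfl | hy
            exacts [hx, (hmem y hy).2.1]
          · intro y hy z hz hyz
            rcases Finset.mem_insert.1 hy with rfl | hy <;> rcases Finset.mem_insert.1 hz with rfl | hz
            · exact absurd rfl hyz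
            · exact (hmem z hz).2.2
            · exact hE _ _ (hmem y (by assumption)).2.2
            · exact hCE y hy z hz hyz
        · exact Or.inr ⟨C, fun y hy => Finset.mem_of_mem_erase (Finset.filter_subset _ _ (hCA hy)),
            hC, hCE⟩
      · have hc' : m₂ ≤ ((A.erase x).filter (fun y => ¬ E x y)).card := by omega
        rcases h₂ E hE _ hc' with ⟨C, hCA, hC, hCE⟩ | ⟨C, hCA, hC, hCE⟩
        · exact Or.inl ⟨C, fun y hy => Finset.mem_of_mem_erase (Finset.filter_subset _ _ (hCA hy)),
            hC, hCE⟩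
        · have hmem : ∀ y ∈ C, y ≠ x ∧ y ∈ A ∧ ¬ E x y := fun y hy => by
            have := hCA hy
            simp only [Finset.mem_filter, Finset.mem_erase] at this
            tauto
          have hxC : x ∉ C := fun h => (hmem x h).1 rfl
          refine Or.inr ⟨insert x C, ?_, by rw [Finset.card_insert_of_notMem hxC, hC], ?_⟩
          · intro y hy
            rcases Finset.mem_insert.1 hy with rfl | hy
            exacts [hx, (hmem y hy).2.1]
          · intro y hy z hz hyz
            rcases Finset.mem_insert.1 hy with rfl | hy <;> rcases Finset.mem_insert.1 hz with rfl | hz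
            · exact absurd rfl hyz
            · exact (hmem z hz).2.2
            · exact fun h => (hmem y (by assumption)).2.2 (hE _ _ h)
            · exact hCE y hy z hz hyz

/-- Adjacency in a graph on `0, …, n - 1`, as a relation on natural numbers. -/
def NatAdj {n : ℕ} (G : SimpleGraph (Fin n)) (u v : ℕ) : Prop :=
  ∃ (hu : u < n) (hv : v < n), G.Adj ⟨u, hu⟩ ⟨v, hv⟩

theorem NatAdj.symm {n : ℕ} {G : SimpleGraph (Fin n)} {u v : ℕ} (h : NatAdj G u v) :
    NatAdj G v u := ⟨h.2.1, h.1, h.2.2.symm⟩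

theorem not_natAdj_self {n : ℕ} (G : SimpleGraph (Fin n)) (u : ℕ) : ¬ NatAdj G u u :=
  fun ⟨_, _, h⟩ => G.loopless.irrefl _ h

variable {n k : ℕ} (G : SimpleGraph (Fin n)) (H : SimpleGraph (Fin k))

/-- The number `x = a + k * u` stands for the item "vertex `u` gets colour `a`". Two items are
linked if their vertices are adjacent. -/
def Linked (k : ℕ) {n : ℕ} (G : SimpleGraph (Fin n)) (x y : ℕ) : Prop := NatAdj G (x / k) (y / k)

/-- Two items conflict if no partial colouring uses both (in particular, an item conflicts
with itself). -/
def Conflict (x y : ℕ) : Prop := x / k = y / k ∨ (Linked k G x y ∧ ¬ NatAdj H (x % k) (y % k))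

/-- Linked or at the same vertex. -/
def Near (k : ℕ) {n : ℕ} (G : SimpleGraph (Fin n)) (x y : ℕ) : Prop := x / k = y / k ∨ Linked k G x y

variable {G H}

theorem Linked.symm {x y : ℕ} (h : Linked k G x y) : Linked k G y x := NatAdj.symm h

theorem not_linked_self (x : ℕ) : ¬ Linked k G x x := not_natAdj_self G _

theorem Conflict.symm {x y : ℕ} (h : Conflict G H x y) : Conflict G H y x := by
  rcases h with h | ⟨h, h'⟩
  · exact Or.inl h.symm
  · exact Or.inr ⟨h.symm, fun h'' => h' h''.symm⟩

theorem Near.symm {x y : ℕ} (h : Near k G x y) : Near k G y x := by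
  rcases h with h | h
  exacts [Or.inl h.symm, Or.inr h.symm]

theorem Conflict.near {x y : ℕ} (h : Conflict G H x y) : Near k G x y := by
  rcases h with h | h
  exacts [Or.inl h, Or.inr h.1]

theorem linked_congr_left {x x' : ℕ} (y : ℕ) (h : x / k = x' / k) :
    Linked k G x y ↔ Linked k G x' y := by simp [Linked, h]

theorem linked_congr_right {y y' : ℕ} (x : ℕ) (h : y / k = y' / k) :
    Linked k G x y ↔ Linked k G x y' := by simp [Linked, h]

/-! ### Recognising induced paths and spiders. -/

/-- A map from a graph without twins that respects adjacency and non-adjacency is an induced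
embedding. -/
theorem isIndContained_of_forall {U V : Type} {F : SimpleGraph U} {G : SimpleGraph V} (f : U → V)
    (hf : ∀ a b, G.Adj (f a) (f b) ↔ F.Adj a b)
    (hF : ∀ a b, f a = f b → a ≠ b → ∃ c, ¬ (F.Adj a c ↔ F.Adj b c)) : F.IsIndContained G := by
  refine ⟨⟨⟨f, fun a b hab => ?_⟩, hf _ _⟩⟩
  by_contra hne
  obtain ⟨c, hc⟩ := hF a b hab hne
  exact hc (by rw [← hf, ← hf, hab])

/-- In a graph without an induced path on six vertices, there are no six items whose vertices
form such a path. -/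
theorem no_items_path (hP : InducedFree (SimpleGraph.pathGraph 6) G)
    {x₀ x₁ x₂ x₃ x₄ x₅ : ℕ} (h₀₁ : Linked k G x₀ x₁) (h₁₂ : Linked k G x₁ x₂)
    (h₂₃ : Linked k G x₂ x₃) (h₃₄ : Linked k G x₃ x₄) (h₄₅ : Linked k G x₄ x₅)
    (h₀₂ : ¬ Linked k G x₀ x₂) (h₀₃ : ¬ Linked k G x₀ x₃) (h₀₄ : ¬ Linked k G x₀ x₄)
    (h₀₅ : ¬ Linked k G x₀ x₅) (h₁₃ : ¬ Linked k G x₁ x₃) (h₁₄ : ¬ Linked k G x₁ x₄)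
    (h₁₅ : ¬ Linked k G x₁ x₅) (h₂₄ : ¬ Linked k G x₂ x₄) (h₂₅ : ¬ Linked k G x₂ x₅)
    (h₃₅ : ¬ Linked k G x₃ x₅) : False := by
  apply hP
  have l₀ := h₀₁.1
  have l₁ := h₁₂.1
  have l₂ := h₂₃.1
  have l₃ := h₃₄.1
  have l₄ := h₄₅.1
  have l₅ := h₄₅.2.1
  have key : ∀ (a b : ℕ) (ha : a / k < n) (hb : b / k < n),
      G.Adj ⟨a / k, ha⟩ ⟨b / k, hb⟩ ↔ Linked k G a b :=
    fun a b ha hb => ⟨fun h => ⟨ha, hb, h⟩, fun h => h.2.2⟩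
  refine isIndContained_of_forall (F := SimpleGraph.pathGraph 6)
    ![⟨x₀ / k, l₀⟩, ⟨x₁ / k, l₁⟩, ⟨x₂ / k, l₂⟩, ⟨x₃ / k, l₃⟩, ⟨x₄ / k, l₄⟩, ⟨x₅ / k, l₅⟩] ?_ ?_
  · have hs : ∀ a b, Linked k G a b ↔ Linked k G b a := fun a b => ⟨Linked.symm, Linked.symm⟩
    intro a b
    fin_cases a <;> fin_cases b <;>
      simp [SimpleGraph.pathGraph_adj, *]
  · have hrow : ∀ a b : Fin 6, a ≠ b → ∃ c : Fin 6,
        ¬ ((a.val + 1 = c.val ∨ c.val + 1 = a.val) ↔ (b.val + 1 = c.val ∨ c.val + 1 = b.val)) := by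
      decide
    intro a b _ hab
    simpa only [SimpleGraph.pathGraph_adj] using hrow a b hab

theorem graphS_adj {t : ℕ} {a b : SpiderVertex t} : (graphS t).Adj a b ↔
    SpiderEdge t a b ∨ SpiderEdge t b a := by
  rw [graphS, SimpleGraph.fromRel_adj]
  constructor
  · exact fun h => h.2
  · intro h
    refine ⟨?_, h⟩
    rintro rfl
    rcases h with h | h <;> cases h

theorem graphL_adj {t : ℕ} {a b : SpiderVertex t} : (graphL t).Adj a b ↔
    SpiderEdge t a b ∨ SpiderEdge t b a ∨ ∃ i j, i ≠ j ∧ a = .leaf i ∧ b = .leaf j := by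
  rw [graphL, SimpleGraph.sup_adj, graphS_adj, SimpleGraph.fromRel_adj, or_assoc]
  refine or_congr_right (or_congr_right ⟨?_, ?_⟩)
  · rintro ⟨hne, ⟨i, j, rfl, rfl⟩ | ⟨i, j, rfl, rfl⟩⟩
    · exact ⟨i, j, by rintro rfl; exact hne rfl, rfl, rfl⟩
    · exact ⟨j, i, by rintro rfl; exact hne rfl, rfl, rfl⟩
  · rintro ⟨i, j, hne, rfl, rfl⟩
    exact ⟨fun h => hne (by cases h; rfl), Or.inl ⟨i, j, rfl, rfl⟩⟩

/-- The map of a spider into a graph. -/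
def spiderMap {V : Type} {t : ℕ} (c : V) (m l : Fin t → V) : SpiderVertex t → V
  | .center => c
  | .mid i => m i
  | .leaf i => l i

/-- The private adjacencies tell the middle vertices apart and likewise the leaves, and adjacency to
the centre tells middle vertices from leaves. Only centre and leaves are not separated by adjacency
here, hence `hne`. -/
theorem spiderMap_injective {V : Type} {G : SimpleGraph V} {t : ℕ} {c : V} {m l : Fin t → V}
    (hcm : ∀ i, G.Adj c (m i)) (hcl : ∀ i, ¬ G.Adj c (l i)) (hne : ∀ i, c ≠ l i)
    (hml : ∀ i j, G.Adj (m i) (l j) ↔ i = j) : Function.Injective (spiderMap c m l) := by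
  have hmm : Function.Injective m := fun i j h => by
    have := (hml i i).2 rfl
    rw [h, hml] at this
    exact this.symm
  have hll : Function.Injective l := fun i j h => by
    have := (hml i i).2 rfl
    rw [h, hml] at this
    exact this
  have hlm : ∀ i j, m i ≠ l j := fun i j h => hcl j (h ▸ hcm i)
  rintro (_ | i | i) (_ | j | j) h
  · rfl
  · exact absurd h (hcm j).ne
  · exact absurd h (hne j)
  · exact absurd h.symm (hcm i).ne
  · exact congrArg _ (hmm h)
  · exact absurd h (hlm i j)
  · exact absurd h.symm (hne i)
  · exact absurd h.symm (hlm j i)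
  · exact congrArg _ (hll h)

theorem graphS_isIndContained {V : Type} {G : SimpleGraph V} {t : ℕ} {c : V} {m l : Fin t → V}
    (hcm : ∀ i, G.Adj c (m i)) (hcl : ∀ i, ¬ G.Adj c (l i)) (hne : ∀ i, c ≠ l i)
    (hml : ∀ i j, G.Adj (m i) (l j) ↔ i = j) (hmm : ∀ i j, ¬ G.Adj (m i) (m j))
    (hll : ∀ i j, ¬ G.Adj (l i) (l j)) : (graphS t).IsIndContained G := by
  refine ⟨⟨⟨spiderMap c m l, spiderMap_injective hcm hcl hne hml⟩, ?_⟩⟩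
  intro a b
  change G.Adj (spiderMap c m l a) (spiderMap c m l b) ↔ _
  rw [graphS_adj]
  rcases a with _ | i | i <;> rcases b with _ | j | j <;> simp only [spiderMap]
  · exact ⟨fun h => absurd rfl h.ne, by rintro (h | h) <;> cases h⟩
  · exact ⟨fun _ => Or.inl (.inner j), fun _ => hcm j⟩
  · exact ⟨fun h => absurd h (hcl j), by rintro (h | h) <;> cases h⟩
  · exact ⟨fun _ => Or.inr (.inner i), fun _ => (hcm i).symm⟩
  · exact ⟨fun h => absurd h (hmm i j), by rintro (h | h) <;> cases h⟩
  · rw [hml]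
    exact ⟨by rintro rfl; exact Or.inl (.outer i), by rintro (h | h) <;> cases h; rfl⟩
  · exact ⟨fun h => absurd h.symm (hcl i), by rintro (h | h) <;> cases h⟩
  · rw [G.adj_comm, hml]
    exact ⟨by rintro rfl; exact Or.inr (.outer j), by rintro (h | h) <;> cases h; rfl⟩
  · exact ⟨fun h => absurd h (hll i j), by rintro (h | h) <;> cases h⟩

theorem graphL_isIndContained {V : Type} {G : SimpleGraph V} {t : ℕ} {c : V} {m l : Fin t → V}
    (hcm : ∀ i, G.Adj c (m i)) (hcl : ∀ i, ¬ G.Adj c (l i)) (hne : ∀ i, c ≠ l i)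
    (hml : ∀ i j, G.Adj (m i) (l j) ↔ i = j) (hmm : ∀ i j, ¬ G.Adj (m i) (m j))
    (hll : ∀ i j, i ≠ j → G.Adj (l i) (l j)) : (graphL t).IsIndContained G := by
  refine ⟨⟨⟨spiderMap c m l, spiderMap_injective hcm hcl hne hml⟩, ?_⟩⟩
  intro a b
  change G.Adj (spiderMap c m l a) (spiderMap c m l b) ↔ _
  rw [graphL_adj]
  rcases a with _ | i | i <;> rcases b with _ | j | j <;> simp only [spiderMap]
  · exact ⟨fun h => absurd rfl h.ne, by rintro (h | h | ⟨_, _, _, h, h'⟩) <;> cases h⟩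
  · exact ⟨fun _ => Or.inl (.inner j), fun _ => hcm j⟩
  · exact ⟨fun h => absurd h (hcl j), by rintro (h | h | ⟨_, _, _, h, h'⟩) <;> cases h⟩
  · exact ⟨fun _ => Or.inr (Or.inl (.inner i)), fun _ => (hcm i).symm⟩
  · exact ⟨fun h => absurd h (hmm i j), by rintro (h | h | ⟨_, _, _, h, h'⟩) <;> cases h⟩
  · rw [hml]
    exact ⟨by rintro rfl; exact Or.inl (.outer i),
      by rintro (h | h | ⟨_, _, _, h, h'⟩) <;> cases h; rfl⟩
  · exact ⟨fun h => absurd h.symm (hcl i), by rintro (h | h | ⟨_, _, _, h, h'⟩) <;> (cases h; try cases h')⟩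
  · rw [G.adj_comm, hml]
    constructor
    · rintro rfl
      exact Or.inr (Or.inl (.outer j))
    · rintro (h | h | ⟨_, _, _, h, h'⟩)
      · cases h
      · cases h
        rfl
      · cases h'
  · constructor
    · exact fun h => Or.inr (Or.inr ⟨i, j, by rintro rfl; exact h.ne rfl, rfl, rfl⟩)
    · rintro (h | h | ⟨i', j', hij, h, h'⟩)
      · cases h
      · cases h
      · cases h; cases h'; exact hll _ _ hij

theorem InducedFree.of_isIndContained {U U' V : Type} {F : SimpleGraph U} {F' : SimpleGraph U'}
    {G : SimpleGraph V} (h : InducedFree F G) (hF : F.IsIndContained F') : InducedFree F' G :=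
  fun h' => h (hF.trans h')

theorem pathGraph_five_isIndContained_pathGraph_six :
    (SimpleGraph.pathGraph 5).IsIndContained (SimpleGraph.pathGraph 6) := by
  refine ⟨⟨Fin.castSuccEmb, ?_⟩⟩
  intro a b
  simp [SimpleGraph.pathGraph_adj]

theorem spiderEdge_iff {t : ℕ} {a b : SpiderVertex t} : SpiderEdge t a b ↔
    (∃ i, a = .center ∧ b = .mid i) ∨ ∃ i, a = .mid i ∧ b = .leaf i := by
  constructor
  · rintro (i | i)
    exacts [Or.inl ⟨i, rfl, rfl⟩, Or.inr ⟨i, rfl, rfl⟩]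
  · rintro (⟨i, rfl, rfl⟩ | ⟨i, rfl, rfl⟩)
    exacts [.inner i, .outer i]

/-- The path has no twins, so any adjacency-preserving and adjacency-reflecting map out of it is
automatically injective. -/
theorem exists_not_pathGraph_five_adj_iff {a b : Fin 5} (hab : a ≠ b) : ∃ c,
    ¬ ((SimpleGraph.pathGraph 5).Adj a c ↔ (SimpleGraph.pathGraph 5).Adj b c) := by
  have hrow : ∀ a b : Fin 5, a ≠ b → ∃ c : Fin 5,
      ¬ ((a.val + 1 = c.val ∨ c.val + 1 = a.val) ↔ (b.val + 1 = c.val ∨ c.val + 1 = b.val)) := by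
    decide
  simpa only [SimpleGraph.pathGraph_adj] using hrow a b hab

theorem pathGraph_five_isIndContained_graphS :
    (SimpleGraph.pathGraph 5).IsIndContained (graphS 2) := by
  refine isIndContained_of_forall ![.leaf 0, .mid 0, .center, .mid 1, .leaf 1] ?_
    fun a b _ hab => exists_not_pathGraph_five_adj_iff hab
  intro a b
  rw [graphS_adj, spiderEdge_iff, spiderEdge_iff]
  fin_cases a <;> fin_cases b <;> simp [SimpleGraph.pathGraph_adj]

/-- A third leg is needed because `L_2` is a cycle of length five. The path enters the clique of
leaves through one leg and ends at the leaf of another. -/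
theorem pathGraph_five_isIndContained_graphL :
    (SimpleGraph.pathGraph 5).IsIndContained (graphL 3) := by
  refine isIndContained_of_forall ![.mid 0, .center, .mid 1, .leaf 1, .leaf 2] ?_
    fun a b _ hab => exists_not_pathGraph_five_adj_iff hab
  intro a b
  rw [graphL_adj, spiderEdge_iff, spiderEdge_iff]
  fin_cases a <;> fin_cases b <;> simp [SimpleGraph.pathGraph_adj]

end ColoringSearch

/-! ## The search tree -/

namespace ColoringSearch

variable {n k : ℕ} (R : ℕ) (G : SimpleGraph (Fin n)) (H : SimpleGraph (Fin k))

/-- A set of items that pairwise do not conflict. -/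
def Independent (I : Set ℕ) : Prop := ∀ x ∈ I, ∀ y ∈ I, Conflict G H x y → x = y

/-- What is left of `W` after the item `x` has been used. -/
def paint (W : Set ℕ) (x : ℕ) : Set ℕ := {y | y ∈ W ∧ ¬ (x ∈ W ∧ Conflict G H x y)}

open scoped Classical in
/-- The items of `W` that conflict with at most `h` items of `W`. -/
noncomputable def purge (W : Set ℕ) (h : ℕ) : Set ℕ :=
  {y | y ∈ W ∧ ((Finset.range (n * k)).filter fun z => z ∈ W ∧ Conflict G H y z).card ≤ h}

/-- The items that conflict with one of the markers. -/
def Marked (dg : ℕ → ℕ) (y : ℕ) : Prop := ∃ j < R, Conflict G H (dg (3 + j)) y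

/-- Removal of items from `W` such that no conflicts remain between the items linked to `u` and
the other ones: the latter must not be marked, and the former must conflict only with marked ones. -/
def split (W : Set ℕ) (u : ℕ) (M : ℕ → Prop) : Set ℕ :=
  {y | y ∈ W ∧ ((Linked k G u y ∧ ∀ z ∈ W, ¬ Linked k G u z → Conflict G H y z → M z) ∨
    (¬ Linked k G u y ∧ ¬ M y))}

/-- The items that remain after the guess `dg`: the item `dg 0` is used, `dg 1` is the threshold of
the purge, `dg 2` is the centre of the split, and `dg 3, dg 4, …` are the markers. -/
noncomputable def core (W : Set ℕ) (dg : ℕ → ℕ) : Set ℕ :=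
  split G H (purge G H (paint G H W (dg 0)) (dg 1)) (dg 2) (Marked R G H dg)

/-- Two items that lie on the same side of the split at `u` and are near each other. -/
def Joined (k : ℕ) {n : ℕ} (G : SimpleGraph (Fin n)) (u x y : ℕ) : Prop :=
  Near k G x y ∧ (Linked k G u x ↔ Linked k G u y)

/-- Any two items of `Y` are connected by a walk in `Y`. -/
def Connected (k : ℕ) {n : ℕ} (G : SimpleGraph (Fin n)) (Y : Set ℕ) : Prop :=
  ∀ y ∈ Y, ∀ z ∈ Y, Relation.ReflTransGen (fun a b => a ∈ Y ∧ b ∈ Y ∧ Near k G a b) y z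

/-- `u` is linked to all items of `Y` or to none. -/
def OneSided (k : ℕ) {n : ℕ} (G : SimpleGraph (Fin n)) (u : ℕ) (Y : Set ℕ) : Prop :=
  (∀ y ∈ Y, Linked k G u y) ∨ ∀ y ∈ Y, ¬ Linked k G u y

/-- A search of depth `e` finds an optimum independent subset of `Y`. -/
def Solvable : ℕ → Set ℕ → Prop
  | 0, Y => Y = ∅
  | e + 1, Y => ∀ I ⊆ Y, Independent G H I → ∃ dg : ℕ → ℕ, (∀ j, dg j ≤ n * k) ∧
      (dg 0 = n * k ∨ dg 0 ∈ I) ∧ (∀ y ∈ I, y ≠ dg 0 → y ∈ core R G H Y dg) ∧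
      ∀ Y' ⊆ core R G H Y dg, Connected k G Y' → OneSided k G (dg 2) Y' → Solvable e Y'

variable {R G H}

theorem core_subset_purge {W : Set ℕ} {dg : ℕ → ℕ} :
    core R G H W dg ⊆ purge G H (paint G H W (dg 0)) (dg 1) := fun _ h => h.1

theorem core_subset_paint {W : Set ℕ} {dg : ℕ → ℕ} :
    core R G H W dg ⊆ paint G H W (dg 0) := fun _ h => h.1.1

theorem core_subset {W : Set ℕ} {dg : ℕ → ℕ} : core R G H W dg ⊆ W := fun _ h => h.1.1.1

theorem not_natAdj_of_le {u v : ℕ} (h : n ≤ u) : ¬ NatAdj G u v := fun ⟨hu, _⟩ => by omega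

theorem not_linked_of_le {x y : ℕ} (hk : 0 < k) (h : n * k ≤ x) : ¬ Linked k G x y :=
  not_natAdj_of_le ((Nat.le_div_iff_mul_le hk).2 h)

/-- This makes `n * k` usable as a dummy: as used item, split centre or marker it has no effect. -/
theorem not_conflict_of_le {x y : ℕ} (hk : 0 < k) (h : n * k ≤ x) (hy : y < n * k) :
    ¬ Conflict G H x y := by
  rintro (h' | ⟨h', _⟩)
  · have := (Nat.le_div_iff_mul_le hk).2 h
    have := Nat.div_lt_of_lt_mul (mul_comm n k ▸ hy)
    omega
  · exact not_linked_of_le hk h h'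

theorem pos_of_mem_range {Y : Set ℕ} (hY : ∀ y ∈ Y, y < n * k) {y : ℕ} (hy : y ∈ Y) : 0 < k :=
  Nat.pos_of_ne_zero fun h => by have := hY y hy; simp [h] at this

theorem mem_purge_of_le {W : Set ℕ} {h y : ℕ} (hh : n * k ≤ h) (hy : y ∈ W) :
    y ∈ purge G H W h := by
  classical
  refine ⟨hy, le_trans (Finset.card_le_card (Finset.filter_subset _ _)) (by simpa using hh)⟩

/-- Surplus levels are harmless: the guess made of dummies leaves the empty set empty. -/
theorem solvable_empty (e : ℕ) : Solvable R G H e ∅ := by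
  induction e with
  | zero => rfl
  | succ e ih =>
    intro I hI _
    refine ⟨fun _ => n * k, fun _ => le_rfl, Or.inl rfl, fun y hy => absurd (hI hy) (by simp), ?_⟩
    intro Y' hY' _ _
    rw [Set.subset_empty_iff.1 (hY'.trans core_subset)]
    exact ih

theorem Solvable.succ {e : ℕ} {Y : Set ℕ} (h : Solvable R G H e Y) : Solvable R G H (e + 1) Y := by
  induction e generalizing Y with
  | zero => exact (show Y = ∅ from h) ▸ solvable_empty 1
  | succ e ih =>
    intro I hI hi
    obtain ⟨dg, h₁, h₂, h₃, h₄⟩ := h I hI hi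
    exact ⟨dg, h₁, h₂, h₃, fun Y' a b c => ih (h₄ Y' a b c)⟩

theorem Solvable.mono {e e' : ℕ} {Y : Set ℕ} (h : Solvable R G H e Y) (he : e ≤ e') :
    Solvable R G H e' Y := by
  induction he with
  | refl => exact h
  | step _ ih => exact ih.succ

/-- The core of a guess that only uses `x` and purges at `h`. -/
theorem mem_core_of_mem_purge {W : Set ℕ} (hW : ∀ y ∈ W, y < n * k) {dg : ℕ → ℕ}
    (hdg : ∀ j, 2 ≤ j → dg j = n * k) {y : ℕ} (hy : y ∈ purge G H (paint G H W (dg 0)) (dg 1)) :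
    y ∈ core R G H W dg := by
  have hk : 0 < k := pos_of_mem_range hW hy.1.1
  refine ⟨hy, Or.inr ⟨?_, ?_⟩⟩
  · rw [hdg 2 le_rfl]
    exact not_linked_of_le hk le_rfl
  · rintro ⟨j, _, hj⟩
    rw [hdg _ (by omega)] at hj
    exact not_conflict_of_le hk le_rfl (hW y hy.1.1) hj

/-- Items at one vertex conflict pairwise, so I has at most one item, and one guess leaves nothing
over. -/
theorem solvable_of_sameVertex {e : ℕ} {Y : Set ℕ} (hY : ∀ y ∈ Y, y < n * k)
    (hs : ∀ y ∈ Y, ∀ z ∈ Y, y / k = z / k) (he : 1 ≤ e) : Solvable R G H e Y := by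
  classical
  refine Solvable.mono ?_ he
  intro I hI hi
  rcases I.eq_empty_or_nonempty with rfl | ⟨x, hx⟩
  -- Every item conflicts with itself, so the threshold 0 purges everything.
  · refine ⟨fun j => if j = 1 then 0 else n * k, fun j => by dsimp only; split_ifs <;> omega,
      Or.inl rfl, by simp, fun Y' hY' _ _ => ?_⟩
    refine Set.subset_empty_iff.1 fun y hy => ?_
    have h := core_subset_purge (hY' hy)
    have hyY := h.1.1
    have h0 := h.2
    simp only [↓reduceIte, nonpos_iff_eq_zero, Finset.card_eq_zero] at h0
    exact Finset.filter_eq_empty_iff.1 h0 (Finset.mem_range.2 (hY y hyY)) ⟨h.1, Or.inl rfl⟩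
  · refine ⟨fun j => if j = 0 then x else n * k, fun j => ?_, Or.inr (by simpa using hx), ?_, ?_⟩
    · dsimp only
      split_ifs
      · exact (hY x (hI hx)).le
      · exact le_rfl
    · intro y hy hne
      exact absurd (hi y hy x hx (Or.inl (hs y (hI hy) x (hI hx)))) (by simpa using hne)
    · intro Y' hY' _ _
      refine Set.subset_empty_iff.1 fun y hy => ?_
      have h := core_subset_paint (hY' hy)
      exact h.2 ⟨by simpa using hI hx, Or.inl (hs x (hI hx) y h.1)⟩

/-- The guess for the first move: use `x`, with all other components set to the dummy. The rest of I
survives because I is independent. -/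
theorem solvable_paint {e : ℕ} {Y : Set ℕ} (hY : ∀ y ∈ Y, y < n * k) {I : Set ℕ} (hI : I ⊆ Y)
    (hi : Independent G H I) {x : ℕ} (hx : x ∈ I)
    (hsub : ∀ Y' ⊆ paint G H Y x, Solvable R G H e Y') :
    ∃ dg : ℕ → ℕ, (∀ j, dg j ≤ n * k) ∧
      (dg 0 = n * k ∨ dg 0 ∈ I) ∧ (∀ y ∈ I, y ≠ dg 0 → y ∈ core R G H Y dg) ∧
      ∀ Y' ⊆ core R G H Y dg, Connected k G Y' → OneSided k G (dg 2) Y' → Solvable R G H e Y' := by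
  refine ⟨fun j => if j = 0 then x else n * k, fun j => ?_, Or.inr (by simpa using hx), ?_, ?_⟩
  · dsimp only
    split_ifs
    · exact (hY x (hI hx)).le
    · exact le_rfl
  · intro y hy hne
    refine mem_core_of_mem_purge hY (fun j hj => if_neg (by omega)) (mem_purge_of_le (by simp) ?_)
    exact ⟨hI hy, fun h => hne (hi _ hx _ hy (by simpa using h.2)).symm⟩
  · intro Y' hY' _ _
    exact hsub Y' fun y hy => by simpa using core_subset_paint (hY' hy)

/-- The guess for the second move: only the threshold differs from the dummy. -/
theorem solvable_purge {e : ℕ} {Y : Set ℕ} (hY : ∀ y ∈ Y, y < n * k) {I : Set ℕ}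
    {r : ℕ} (hr : I ⊆ purge G H Y r)
    (hsub : ∀ Y' ⊆ purge G H Y r, Connected k G Y' → Solvable R G H e Y') :
    ∃ dg : ℕ → ℕ, (∀ j, dg j ≤ n * k) ∧
      (dg 0 = n * k ∨ dg 0 ∈ I) ∧ (∀ y ∈ I, y ≠ dg 0 → y ∈ core R G H Y dg) ∧
      ∀ Y' ⊆ core R G H Y dg, Connected k G Y' → OneSided k G (dg 2) Y' → Solvable R G H e Y' := by
  have hp : paint G H Y (n * k) = Y := by
    ext y
    exact ⟨fun h => h.1, fun h => ⟨h, fun h' => lt_irrefl _ (hY _ h'.1)⟩⟩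
  -- Entries of a guess are at most `n * k`; capping the threshold there changes nothing, as no item
  -- has more than `n * k` conflicts.
  have hpr : purge G H Y (min r (n * k)) = purge G H Y r := by
    classical
    ext y
    refine ⟨fun h => ⟨h.1, h.2.trans (min_le_left _ _)⟩, fun h => ⟨h.1, le_min h.2 ?_⟩⟩
    exact le_trans (Finset.card_le_card (Finset.filter_subset _ _)) (by simp)
  refine ⟨fun j => if j = 1 then min r (n * k) else n * k, fun j => ?_, Or.inl rfl, ?_, ?_⟩
  · dsimp only
    split_ifs
    · exact min_le_right _ _
    · exact le_rfl
  · intro y hy _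
    refine mem_core_of_mem_purge hY (fun j hj => if_neg (by omega)) ?_
    simpa [hp, hpr] using hr hy
  · intro Y' hY' hc _
    refine hsub Y' (fun y hy => ?_) hc
    simpa [hp, hpr] using core_subset_purge (hY' hy)

end ColoringSearch

/-! ### Few markers suffice, and a split preserves the independent set. -/

namespace ColoringSearch

variable {n k : ℕ} {R : ℕ} {G : SimpleGraph (Fin n)} {H : SimpleGraph (Fin k)}

/-- An induced spider, with or without a clique on its leaves, from an independent set of items
with private conflicts. -/
theorem spider_of_private_conflicts {s t m : ℕ}
    (hm : ∀ (E : ℕ → ℕ → Prop), (∀ x y, E x y → E y x) →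
      ∀ A : Finset ℕ, m ≤ A.card →
        (∃ C ⊆ A, C.card = s ∧ ∀ x ∈ C, ∀ y ∈ C, x ≠ y → E x y) ∨
        (∃ C ⊆ A, C.card = t ∧ ∀ x ∈ C, ∀ y ∈ C, x ≠ y → ¬ E x y))
    {D : Finset ℕ} (hD : m ≤ D.card) (hD2 : 1 < D.card) {u : ℕ} (hu : ∀ y ∈ D, Linked k G u y)
    {z : ℕ → ℕ} (hz : ∀ y ∈ D, ¬ Linked k G u (z y)) (hyz : ∀ y ∈ D, Linked k G y (z y))
    (hyz' : ∀ y ∈ D, ∀ y' ∈ D, y ≠ y' → ¬ Linked k G y' (z y))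
    (hyy : ∀ y ∈ D, ∀ y' ∈ D, ¬ Linked k G y y') :
    (graphL s).IsIndContained G ∨ (graphS t).IsIndContained G := by
  obtain ⟨y₀, hy₀, y₁, hy₁, h01⟩ := Finset.one_lt_card.1 hD2
  have hun : u / k < n := (hu y₀ hy₀).1
  have key : ∀ (a b : ℕ) (ha : a / k < n) (hb : b / k < n),
      G.Adj ⟨a / k, ha⟩ ⟨b / k, hb⟩ ↔ Linked k G a b :=
    fun a b ha hb => ⟨fun h => ⟨ha, hb, h⟩, fun h => h.2.2⟩
  -- A leaf at the vertex of `u` would be linked to every other item of D, against privacy. This is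
  -- where a second item of D is needed.
  have hne : ∀ y ∈ D, u / k ≠ z y / k := by
    intro y hy h
    obtain ⟨y', hy', hne⟩ : ∃ y' ∈ D, y ≠ y' := by
      by_cases h : y = y₀
      · exact ⟨y₁, hy₁, h ▸ h01⟩
      · exact ⟨y₀, hy₀, h⟩
    exact hyz' y hy y' hy' hne ((linked_congr_right y' h).1 (hu y' hy').symm)
  rcases hm (fun a b => Linked k G (z a) (z b)) (fun _ _ h => h.symm) D hD with
    ⟨C, hCD, hC, hCE⟩ | ⟨C, hCD, hC, hCE⟩
  · left
    let e := (Finset.equivFinOfCardEq hC).symm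
    have he : ∀ i, (e i : ℕ) ∈ D := fun i => hCD (e i).2
    have hinj : ∀ i j, (e i : ℕ) = e j → i = j := fun i j h => e.injective (Subtype.ext h)
    refine graphL_isIndContained (c := ⟨u / k, hun⟩) (m := fun i => ⟨e i / k, (hu _ (he i)).2.1⟩)
      (l := fun i => ⟨z (e i) / k, (hyz _ (he i)).2.1⟩) ?_ ?_ ?_ ?_ ?_ ?_
    · exact fun i => (key _ _ _ _).2 (hu _ (he i))
    · exact fun i => mt (key _ _ _ _).1 (hz _ (he i))
    · exact fun i h => hne _ (he i) (congrArg Fin.val h)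
    · intro i j
      rw [key]
      refine ⟨fun h => ?_, ?_⟩
      · by_contra hij
        exact hyz' _ (he j) _ (he i) (fun h => hij (hinj _ _ h).symm) h
      · rintro rfl
        exact hyz _ (he _)
    · exact fun i j => mt (key _ _ _ _).1 (hyy _ (he i) _ (he j))
    · exact fun i j hij => (key _ _ _ _).2 (hCE _ (e i).2 _ (e j).2 fun h => hij (hinj _ _ h))
  · right
    let e := (Finset.equivFinOfCardEq hC).symm
    have he : ∀ i, (e i : ℕ) ∈ D := fun i => hCD (e i).2
    have hinj : ∀ i j, (e i : ℕ) = e j → i = j := fun i j h => e.injective (Subtype.ext h)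
    refine graphS_isIndContained (c := ⟨u / k, hun⟩) (m := fun i => ⟨e i / k, (hu _ (he i)).2.1⟩)
      (l := fun i => ⟨z (e i) / k, (hyz _ (he i)).2.1⟩) ?_ ?_ ?_ ?_ ?_ ?_
    · exact fun i => (key _ _ _ _).2 (hu _ (he i))
    · exact fun i => mt (key _ _ _ _).1 (hz _ (he i))
    · exact fun i h => hne _ (he i) (congrArg Fin.val h)
    · intro i j
      rw [key]
      refine ⟨fun h => ?_, ?_⟩
      · by_contra hij
        exact hyz' _ (he j) _ (he i) (fun h => hij (hinj _ _ h).symm) h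
      · rintro rfl
        exact hyz _ (he _)
    · exact fun i j => mt (key _ _ _ _).1 (hyy _ (he i) _ (he j))
    · intro i j h
      rw [key] at h
      by_cases hij : i = j
      · exact not_linked_self _ (hij ▸ h)
      · exact hCE _ (e i).2 _ (e j).2 (fun h => hij (hinj _ _ h)) h

/-- Boundedly many items of an independent set `I` have the same conflicts outside of the
neighbourhood of `u` as all the items of `I` in this neighbourhood. -/
theorem exists_markers (s t k : ℕ) : ∃ R : ℕ, ∀ {n : ℕ} (G : SimpleGraph (Fin n))
    (H : SimpleGraph (Fin k)), InducedFree (graphL s) G → InducedFree (graphS t) G →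
    ∀ (I : Set ℕ), (∀ y ∈ I, y < n * k) → Independent G H I → ∀ u : ℕ,
      ∃ D : Finset ℕ, D.card ≤ R ∧ (∀ y ∈ D, y ∈ I ∧ Linked k G u y) ∧
        ∀ z, ¬ Linked k G u z → ∀ y ∈ I, Linked k G u y → Conflict G H y z →
          ∃ y' ∈ D, Conflict G H y' z := by
  classical
  obtain ⟨m, hm⟩ := exists_ramsey s t
  -- There are `k * k` pairs of colours, and a class with more than `m + 1` members is large enough
  -- for Ramsey and also has the two members that the spider lemma asks for.
  refine ⟨k * k * (m + 1), fun {n} G H hL hS I hI hi u => ?_⟩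
  let P : Finset ℕ → Prop := fun D => (∀ y ∈ D, y ∈ I ∧ Linked k G u y) ∧
    ∀ z, ¬ Linked k G u z → ∀ y ∈ I, Linked k G u y → Conflict G H y z →
      ∃ y' ∈ D, Conflict G H y' z
  -- All of I ∩ N(u) is a candidate, so a candidate of minimum size exists. By minimality no element
  -- of it can be dropped, and this gives each element a private conflict.
  have hex : ∃ c, ∃ D : Finset ℕ, P D ∧ D.card = c := by
    refine ⟨_, (Finset.range (n * k)).filter fun y => y ∈ I ∧ Linked k G u y, ⟨?_, ?_⟩, rfl⟩
    · exact fun y hy => (Finset.mem_filter.1 hy).2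
    · exact fun z _ y hy hu hyz =>
        ⟨y, Finset.mem_filter.2 ⟨Finset.mem_range.2 (hI y hy), hy, hu⟩, hyz⟩
  obtain ⟨D, hD, hDc⟩ := Nat.find_spec hex
  refine ⟨D, ?_, hD.1, hD.2⟩
  by_contra hcard
  have hpriv : ∀ y ∈ D, ∃ z, ¬ Linked k G u z ∧ Conflict G H y z ∧
      ∀ y' ∈ D, y ≠ y' → ¬ Conflict G H y' z := by
    intro y hy
    have hnot : ¬ P (D.erase y) := fun h =>
      Nat.find_min hex (m := (D.erase y).card)
        (by rw [← hDc]; exact Finset.card_erase_lt_of_mem hy) ⟨_, h, rfl⟩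
    have h1 : ∀ y' ∈ D.erase y, y' ∈ I ∧ Linked k G u y' :=
      fun y' hy' => hD.1 y' (Finset.mem_of_mem_erase hy')
    have h2 : ¬ ∀ z, ¬ Linked k G u z → ∀ x ∈ I, Linked k G u x → Conflict G H x z →
      ∃ y' ∈ D.erase y, Conflict G H y' z := fun h => hnot ⟨h1, h⟩
    push Not at h2
    obtain ⟨z, hz, x, hx, hux, hxz, hno⟩ := h2
    obtain ⟨y', hy', hyz'⟩ := hD.2 z hz x hx hux hxz
    have hyy' : y' = y := by
      by_contra hne
      exact hno y' (Finset.mem_erase.2 ⟨hne, hy'⟩) hyz'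
    exact ⟨z, hz, hyy' ▸ hyz', fun w hw hne => hno w (Finset.mem_erase.2 ⟨hne.symm, hw⟩)⟩
  choose! z hz hyz hyz' using hpriv
  have hk : ∀ y ∈ D, 0 < k := fun y hy => pos_of_mem_range hI (hD.1 y hy).1
  obtain ⟨⟨a, b⟩, -, hab⟩ := Finset.exists_lt_card_fiber_of_mul_lt_card_of_maps_to
    (s := D) (t := Finset.range k ×ˢ Finset.range k) (f := fun y => (y % k, z y % k)) (n := m + 1)
    (fun y hy => by
      simp only [Finset.mem_product, Finset.mem_range]
      exact ⟨Nat.mod_lt _ (hk y hy), Nat.mod_lt _ (hk y hy)⟩)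
    (by simpa using hcard)
  -- All items here have colour a and their partners have colour b, with a and b not adjacent in H.
  -- So a link to a partner would already be a conflict, and links inside the class are excluded by
  -- independence since a is not adjacent to itself.
  set D' := D.filter fun y => (y % k, z y % k) = (a, b) with hD'
  have hmem : ∀ y ∈ D', y ∈ D ∧ y % k = a ∧ z y % k = b := fun y hy => by
    simpa [hD'] using hy
  have hLink : ∀ y ∈ D', Linked k G y (z y) ∧ ¬ NatAdj H a b := fun y hy => by
    obtain ⟨hyD, ha, hb⟩ := hmem y hy
    rcases hyz y hyD with h | ⟨h, h'⟩
    · exact absurd ((linked_congr_right u h).1 (hD.1 y hyD).2) (hz y hyD)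
    · exact ⟨h, by rwa [ha, hb] at h'⟩
  suffices h : (graphL s).IsIndContained G ∨ (graphS t).IsIndContained G from h.elim hL hS
  refine spider_of_private_conflicts (G := G) (k := k) hm (D := D') (by omega) (by omega)
    (u := u) (fun y hy => (hD.1 y (hmem y hy).1).2) (z := z) (fun y hy => hz y (hmem y hy).1)
    (fun y hy => (hLink y hy).1) ?_ ?_
  · intro y hy y' hy' hne h
    refine hyz' y (hmem y hy).1 y' (hmem y' hy').1 hne (Or.inr ⟨h, ?_⟩)
    rw [(hmem y' hy').2.1, (hmem y hy).2.2]
    exact (hLink y hy).2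
  · intro y hy y' hy' h
    have hne : y ≠ y' := by
      rintro rfl
      exact not_linked_self _ h
    refine hne (hi y (hD.1 y (hmem y hy).1).1 y' (hD.1 y' (hmem y' hy').1).1 (Or.inr ⟨h, ?_⟩))
    rw [(hmem y hy).2.1, (hmem y' hy').2.1]
    exact not_natAdj_self H a

/-- The set of items has the property that every independent set needs only `R` markers. -/
def HasMarkers (R : ℕ) (G : SimpleGraph (Fin n)) (H : SimpleGraph (Fin k)) : Prop :=
  ∀ (I : Set ℕ), (∀ y ∈ I, y < n * k) → Independent G H I → ∀ u : ℕ,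
    ∃ D : Finset ℕ, D.card ≤ R ∧ (∀ y ∈ D, y ∈ I ∧ Linked k G u y) ∧
      ∀ z, ¬ Linked k G u z → ∀ y ∈ I, Linked k G u y → Conflict G H y z →
        ∃ y' ∈ D, Conflict G H y' z

/-- The guess for the third move. The centre `u` need not belong to `Y`: the path argument also
splits at items that have already been deleted. -/
theorem solvable_split (hR : HasMarkers R G H) {e : ℕ} {Y : Set ℕ} (hY : ∀ y ∈ Y, y < n * k)
    {u : ℕ} (hu : u ≤ n * k)
    (hin : ∀ Y' ⊆ Y, Connected k G Y' → (∀ y ∈ Y', Linked k G u y) → Solvable R G H e Y')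
    (hout : ∀ Y' ⊆ Y, Connected k G Y' → (∀ y ∈ Y', ¬ Linked k G u y) → Solvable R G H e Y') :
    Solvable R G H (e + 1) Y := by
  intro I hI hi
  obtain ⟨D, hDR, hDI, hD⟩ := hR I (fun y hy => hY y (hI hy)) hi u
  let l := D.toList
  -- The markers are listed from position 3 on; unused positions hold the dummy, which marks no
  -- item.
  let dg : ℕ → ℕ := fun j => if j = 2 then u else if 3 ≤ j then l.getD (j - 3) (n * k) else n * k
  have hlD : ∀ j, j < l.length → l.getD j (n * k) ∈ D := fun j hj => by
    rw [List.getD_eq_getElem _ _ hj]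
    exact Finset.mem_toList.1 (List.getElem_mem hj)
  have hl : ∀ j, l.length ≤ j → l.getD j (n * k) = n * k := fun j hj =>
    List.getD_eq_default _ _ hj
  have hmark : ∀ z, z < n * k → (Marked R G H dg z ↔ ∃ y ∈ D, Conflict G H y z) := by
    intro z hzn
    have hk : 0 < k := pos_of_mem_range (Y := {z}) (by simpa using hzn) rfl
    have h3 : ∀ j, dg (3 + j) = l.getD j (n * k) := fun j => by
      simp only [dg]
      rw [if_neg (by omega), if_pos (by omega), Nat.add_sub_cancel_left]
    constructor
    · rintro ⟨j, hj, hc⟩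
      rw [h3] at hc
      by_cases hjl : j < l.length
      · exact ⟨_, hlD j hjl, hc⟩
      · rw [hl j (not_lt.1 hjl)] at hc
        exact absurd hc (not_conflict_of_le hk le_rfl hzn)
    · rintro ⟨y, hy, hc⟩
      obtain ⟨j, hj, rfl⟩ := List.getElem_of_mem (Finset.mem_toList.2 hy)
      refine ⟨j, lt_of_lt_of_le hj (by simpa [l] using hDR), ?_⟩
      rw [h3, List.getD_eq_getElem _ _ hj]
      exact hc
  refine ⟨dg, ?_, Or.inl rfl, ?_, ?_⟩
  · intro j
    dsimp only [dg]
    split_ifs with h2 h3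
    · exact hu
    · by_cases hjl : j - 3 < l.length
      · exact (hY _ (hI (hDI _ (hlD _ hjl)).1)).le
      · exact (hl _ (not_lt.1 hjl)).le
    · exact le_rfl
  · intro y hy _
    have hyn := hY y (hI hy)
    refine ⟨mem_purge_of_le le_rfl ⟨hI hy, fun h => lt_irrefl _ (hY _ h.1)⟩, ?_⟩
    change (Linked k G u y ∧ _) ∨ (¬ Linked k G u y ∧ _)
    -- An item of I in N(u) survives because all its conflicts outside are marked, by the choice of
    -- D. One outside N(u) survives because D ⊆ I and I is independent, so that it is not marked.
    by_cases huy : Linked k G u y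
    · refine Or.inl ⟨huy, fun z hz huz hc => ?_⟩
      exact (hmark z (hY z hz.1.1)).2 (hD z huz y hy huy hc)
    · refine Or.inr ⟨huy, fun hm => ?_⟩
      obtain ⟨y', hy', hc⟩ := (hmark y hyn).1 hm
      have := hi _ (hDI y' hy').1 _ hy hc
      exact huy (this ▸ (hDI y' hy').2)
  · intro Y' hY' hc hos
    rcases hos with h | h
    · exact hin Y' (hY'.trans core_subset) hc h
    · exact hout Y' (hY'.trans core_subset) hc h

/-! ### The Gyárfás path and the depth of the search. -/

/-- All sets of pairwise linked items of `Y` have at most `c` elements. -/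
def CliqueLE (k : ℕ) {n : ℕ} (G : SimpleGraph (Fin n)) (Y : Set ℕ) (c : ℕ) : Prop :=
  ∀ Q : Finset ℕ, (∀ y ∈ Q, y ∈ Y) → (∀ y ∈ Q, ∀ z ∈ Q, y ≠ z → Linked k G y z) → Q.card ≤ c

theorem CliqueLE.of_linked {Y Y' : Set ℕ} {c : ℕ} (h : CliqueLE k G Y (c + 1)) (hY : Y' ⊆ Y)
    {u : ℕ} (hu : u ∈ Y) (hl : ∀ y ∈ Y', Linked k G u y) : CliqueLE k G Y' c := by
  classical
  intro Q hQ hQl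
  have huQ : u ∉ Q := fun hm => not_linked_self u (hl u (hQ u hm))
  have := h (insert u Q) ?_ ?_
  · rwa [Finset.card_insert_of_notMem huQ, Nat.add_le_add_iff_right] at this
  · intro y hy
    rcases Finset.mem_insert.1 hy with rfl | hy
    exacts [hu, hY (hQ y hy)]
  · intro y hy z hz hne
    rcases Finset.mem_insert.1 hy with rfl | hy' <;> rcases Finset.mem_insert.1 hz with rfl | hz'
    · exact absurd rfl hne
    · exact hl z (hQ z hz')
    · exact (hl y (hQ y hy')).symm
    · exact hQl y hy' z hz' hne

/-- The component of `y₀` in `Y`. -/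
def component (k : ℕ) {n : ℕ} (G : SimpleGraph (Fin n)) (Y : Set ℕ) (y₀ : ℕ) : Set ℕ :=
  {z | Relation.ReflTransGen (fun a b => a ∈ Y ∧ b ∈ Y ∧ Near k G a b) y₀ z}

theorem component_subset {Y : Set ℕ} {y₀ : ℕ} (h₀ : y₀ ∈ Y) : component k G Y y₀ ⊆ Y := by
  intro z hz
  rcases Relation.ReflTransGen.cases_tail hz with rfl | ⟨_, _, h⟩
  exacts [h₀, h.2.1]

theorem mem_component_of_near {Y : Set ℕ} {y₀ y z : ℕ} (hy : y ∈ component k G Y y₀) (hyY : y ∈ Y)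
    (hz : z ∈ Y) (h : Near k G y z) : z ∈ component k G Y y₀ :=
  Relation.ReflTransGen.tail hy ⟨hyY, hz, h⟩

theorem connected_component {Y : Set ℕ} {y₀ : ℕ} :
    Connected k G (component k G Y y₀) := by
  have hreach : ∀ z ∈ component k G Y y₀, Relation.ReflTransGen
      (fun a b => a ∈ component k G Y y₀ ∧ b ∈ component k G Y y₀ ∧ Near k G a b) y₀ z := by
    intro z hz
    induction hz with
    | refl => exact .refl
    | tail h h' ih => exact ih.tail ⟨h, h.tail h', h'.2.2⟩
  intro y hy z hz
  refine Relation.ReflTransGen.trans ?_ (hreach z hz)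
  have hsymm : Std.Symm fun a b =>
      a ∈ component k G Y y₀ ∧ b ∈ component k G Y y₀ ∧ Near k G a b :=
    ⟨fun a b h => ⟨h.2.1, h.1, h.2.2.symm⟩⟩
  exact Relation.ReflTransGen.stdSymm.symm _ _ (hreach y hy)

theorem Connected.subset_component {Y Y' : Set ℕ} (h : Connected k G Y') (hY : Y' ⊆ Y) {y₀ : ℕ}
    (h₀ : y₀ ∈ Y') : Y' ⊆ component k G Y y₀ := fun z hz =>
  Relation.ReflTransGen.mono (r := fun a b => a ∈ Y' ∧ b ∈ Y' ∧ Near k G a b)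
    (fun _ _ h => ⟨hY h.1, hY h.2.1, h.2.2⟩) _ _ (h y₀ h₀ z hz)

/-- A walk from `x` to `y` must enter `S` at some step. -/
theorem Connected.exists_near {Y S : Set ℕ} (h : Connected k G Y) {x y : ℕ} (hx : x ∈ Y)
    (hy : y ∈ Y) (hxS : x ∉ S) (hyS : y ∈ S) :
    ∃ z ∈ Y, z ∉ S ∧ ∃ s ∈ Y, s ∈ S ∧ Near k G z s := by
  by_contra hno
  push Not at hno
  have : ∀ z, Relation.ReflTransGen (fun a b => a ∈ Y ∧ b ∈ Y ∧ Near k G a b) x z → z ∉ S := by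
    intro z hz
    induction hz with
    | refl => exact hxS
    | tail _ h' ih => exact fun hc => hno _ h'.1 ih _ h'.2.1 hc h'.2.2
  exact this y (h x hx y hy) hyS

/-- A component of the non-neighbours of `u` in a connected set is linked to a neighbour of `u`. -/
theorem Connected.exists_linked_component {Y : Set ℕ} (h : Connected k G Y) {u y₀ x : ℕ}
    (hy₀ : y₀ ∈ Y) (hu₀ : ¬ Linked k G u y₀) (hx : x ∈ Y)
    (hxS : x ∉ component k G {z | z ∈ Y ∧ ¬ Linked k G u z} y₀) :
    ∃ z ∈ Y, Linked k G u z ∧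
      ∃ s ∈ component k G {z | z ∈ Y ∧ ¬ Linked k G u z} y₀, Linked k G z s := by
  obtain ⟨z, hz, hzS, s, -, hsS, hzs⟩ := h.exists_near hx hy₀ hxS .refl
  have hs := component_subset (Y := {z | z ∈ Y ∧ ¬ Linked k G u z}) ⟨hy₀, hu₀⟩ hsS
  have huz : Linked k G u z := by
    by_contra huz
    exact hzS (mem_component_of_near hsS hs ⟨hz, huz⟩ hzs.symm)
  refine ⟨z, hz, huz, s, hsS, ?_⟩
  rcases hzs with h | h
  · exact absurd ((linked_congr_right u h).1 huz) hs.2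
  · exact h

/-- Three splits along a Gyárfás path lower the clique number by one: each split sends a piece
either into the neighbourhood of an item of `Y`, where cliques are smaller, or one step further
along the path, and there is no room for an induced path on six vertices. -/
theorem solvable_of_cliqueLE (hP : InducedFree (SimpleGraph.pathGraph 6) G)
    (hR : HasMarkers R G H) (c : ℕ) : ∀ (Y : Set ℕ), (∀ y ∈ Y, y < n * k) → Connected k G Y →
      CliqueLE k G Y c → ∀ e, 3 * c ≤ e → Solvable R G H e Y := by
  induction c with
  | zero =>
    intro Y _ _ hc e _
    have : Y = ∅ := Set.eq_empty_of_forall_notMem fun y hy => by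
      simpa using hc {y} (by simpa using hy) (by simp)
    exact this ▸ solvable_empty e
  | succ c ih =>
    intro Y hY hcon hc e he
    rcases Y.eq_empty_or_nonempty with rfl | ⟨x₀, hx₀⟩
    · exact solvable_empty e
    -- One level for each of the splits at `x₀`, `w` and `v`.
    obtain ⟨e, rfl⟩ : ∃ e', e = e' + 1 + 1 + 1 := ⟨e - 3, by omega⟩
    refine solvable_split hR hY (hY x₀ hx₀).le ?_ ?_
    · intro Y' hY' hcon' hl
      exact ih Y' (fun y hy => hY y (hY' hy)) hcon' (hc.of_linked hY' hx₀ hl) _ (by omega)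
    intro Y₁ hY₁ hcon₁ hl₁
    rcases Y₁.eq_empty_or_nonempty with rfl | ⟨y₁, hy₁⟩
    · exact solvable_empty _
    have hbase₁ : y₁ ∈ {z | z ∈ Y ∧ ¬ Linked k G x₀ z} := ⟨hY₁ hy₁, hl₁ y₁ hy₁⟩
    -- The path is built in components of the undeleted set `Y`. The actual piece `Y₁` is only a
    -- subset of the component: the items through which the path continues may have been removed
    -- from it.
    set S₁ := component k G {z | z ∈ Y ∧ ¬ Linked k G x₀ z} y₁ with hS₁
    have hYS₁ : Y₁ ⊆ S₁ := hcon₁.subset_component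
      (Y := {z | z ∈ Y ∧ ¬ Linked k G x₀ z}) (fun y hy => ⟨hY₁ hy, hl₁ y hy⟩) hy₁
    have hS₁Y : ∀ y ∈ S₁, y ∈ Y ∧ ¬ Linked k G x₀ y := fun y hy => component_subset hbase₁ hy
    have hS₁c : Connected k G S₁ := connected_component
    by_cases hxS : x₀ ∈ S₁
    · -- the piece lies at the vertex of `x₀`
      have hsame : ∀ y ∈ S₁, x₀ / k = y / k := by
        intro y hy
        have := hS₁c x₀ hxS y hy
        induction this with
        | refl => rfl
        | tail _ h' ih' =>
          have ih' := ih' h'.1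
          rcases h'.2.2 with h | h
          · exact ih'.trans h
          · exact absurd ((linked_congr_left _ ih').2 h) (hS₁Y _ h'.2.1).2
      refine solvable_of_sameVertex (fun y hy => hY y (hY₁ hy)) ?_ (by omega)
      exact fun y hy z hz => (hsame y (hYS₁ hy)).symm.trans (hsame z (hYS₁ hz))
    obtain ⟨w, hw, hxw, s₁, hs₁, hws⟩ := hcon.exists_linked_component hbase₁.1 hbase₁.2 hx₀ hxS
    refine solvable_split hR (fun y hy => hY y (hY₁ hy)) (hY w hw).le ?_ ?_
    · intro Y' hY' hcon' hl
      exact ih Y' (fun y hy => hY y (hY₁ (hY' hy))) hcon'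
        (hc.of_linked (hY'.trans hY₁) hw hl) _ (by omega)
    intro Y₂ hY₂ hcon₂ hl₂
    rcases Y₂.eq_empty_or_nonempty with rfl | ⟨y₂, hy₂⟩
    · exact solvable_empty _
    have hbase₂ : y₂ ∈ {z | z ∈ S₁ ∧ ¬ Linked k G w z} := ⟨hYS₁ (hY₂ hy₂), hl₂ y₂ hy₂⟩
    set S₂ := component k G {z | z ∈ S₁ ∧ ¬ Linked k G w z} y₂ with hS₂
    have hYS₂ : Y₂ ⊆ S₂ := hcon₂.subset_component
      (Y := {z | z ∈ S₁ ∧ ¬ Linked k G w z}) (fun y hy => ⟨hYS₁ (hY₂ hy), hl₂ y hy⟩) hy₂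
    have hS₂S : ∀ y ∈ S₂, y ∈ S₁ ∧ ¬ Linked k G w y := fun y hy => component_subset hbase₂ hy
    have hS₂c : Connected k G S₂ := connected_component
    obtain ⟨v, hv, hwv, s₂, hs₂, hvs⟩ := hS₁c.exists_linked_component hbase₂.1 hbase₂.2 hs₁
      (fun h => (hS₂S s₁ h).2 hws)
    refine solvable_split hR (fun y hy => hY y (hY₁ (hY₂ hy))) (hY v (hS₁Y v hv).1).le ?_ ?_
    · intro Y' hY' hcon' hl
      exact ih Y' (fun y hy => hY y (hY₁ (hY₂ (hY' hy)))) hcon'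
        (hc.of_linked (hY'.trans (hY₂.trans hY₁)) (hS₁Y v hv).1 hl) _ (by omega)
    intro Y₃ hY₃ hcon₃ hl₃
    rcases Y₃.eq_empty_or_nonempty with rfl | ⟨y₃, hy₃⟩
    · exact solvable_empty _
    have hbase₃ : y₃ ∈ {z | z ∈ S₂ ∧ ¬ Linked k G v z} := ⟨hYS₂ (hY₃ hy₃), hl₃ y₃ hy₃⟩
    set S₃ := component k G {z | z ∈ S₂ ∧ ¬ Linked k G v z} y₃ with hS₃
    have hYS₃ : Y₃ ⊆ S₃ := hcon₃.subset_component
      (Y := {z | z ∈ S₂ ∧ ¬ Linked k G v z}) (fun y hy => ⟨hYS₂ (hY₃ hy), hl₃ y hy⟩) hy₃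
    have hS₃S : ∀ y ∈ S₃, y ∈ S₂ ∧ ¬ Linked k G v y := fun y hy => component_subset hbase₃ hy
    have hS₃c : Connected k G S₃ := connected_component
    obtain ⟨z, hz, hvz, s₃, hs₃, hzs⟩ := hS₂c.exists_linked_component hbase₃.1 hbase₃.2 hs₂
      (fun h => (hS₃S s₂ h).2 hvs)
    -- Otherwise connectedness of `S₃` gives linked items q, q' of which only q is linked to `z`,
    -- and `x₀`, `w`, `v`, `z`, q, q' form an induced path on six vertices.
    have hall : ∀ y ∈ S₃, Linked k G z y := by
      by_contra hno
      push Not at hno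
      obtain ⟨y, hy, hzy⟩ := hno
      obtain ⟨q', hq', hzq', q, hq, hzq, hqq⟩ :=
        hS₃c.exists_near (S := {a | Linked k G z a}) hy hs₃ hzy hzs
      have hqq' : Linked k G q q' := by
        rcases hqq with h | h
        · exact absurd ((linked_congr_right z h).2 hzq) hzq'
        · exact h.symm
      have a₂ := hS₁Y
      have hz₂ := hS₂S z hz
      have hq₃ := hS₃S q hq
      have hq₃' := hS₃S q' hq'
      have hq₂ := hS₂S q hq₃.1
      have hq₂' := hS₂S q' hq₃'.1
      exact no_items_path hP hxw hwv hvz hzq hqq' (hS₁Y v hv).2 (hS₁Y z hz₂.1).2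
        (hS₁Y q hq₂.1).2 (hS₁Y q' hq₂'.1).2 hz₂.2 hq₂.2 hq₂'.2 hq₃.2 hq₃'.2 hzq'
    refine ih Y₃ (fun y hy => hY y (hY₁ (hY₂ (hY₃ hy)))) hcon₃
      (hc.of_linked (hY₃.trans (hY₂.trans hY₁)) (hS₁Y z (hS₂S z hz).1).1
        fun y hy => hall y (hYS₃ hy)) _ (by omega)

/-- Linked items of equal colour conflict, since H is loopless, and each item conflicts with itself.
So a clique contains at most `r` items of each of the `k` colours. -/
theorem cliqueLE_purge {Y : Set ℕ} (hY : ∀ y ∈ Y, y < n * k) (r : ℕ) :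
    CliqueLE k G (purge G H Y r) (k * r) := by
  classical
  intro Q hQ hQl
  by_contra hcard
  obtain ⟨a, -, ha⟩ := Finset.exists_lt_card_fiber_of_mul_lt_card_of_maps_to
    (s := Q) (t := Finset.range k) (f := fun y => y % k) (n := r)
    (fun y hy => Finset.mem_range.2 (Nat.mod_lt _ (pos_of_mem_range hY (hQ y hy).1)))
    (by simpa using hcard)
  obtain ⟨y, hy⟩ : (Q.filter fun y => y % k = a).Nonempty := Finset.card_pos.1 (by omega)
  rw [Finset.mem_filter] at hy
  refine absurd (hQ y hy.1).2 (not_le.2 (lt_of_lt_of_le ha (Finset.card_le_card ?_)))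
  intro z hz
  rw [Finset.mem_filter] at hz
  have hzY := (hQ z hz.1).1
  refine Finset.mem_filter.2 ⟨Finset.mem_range.2 (hY z hzY), hzY, ?_⟩
  by_cases h : y = z
  · exact Or.inl (h ▸ rfl)
  · refine Or.inr ⟨hQl y hy.1 z hz.1 h, ?_⟩
    rw [hy.2, hz.2]
    exact not_natAdj_self H a

/-- Each guess of an item with more than `r` conflicts consumes one unit of `j`. Once I contains no
such item, a single purge bounds the cliques, and the path argument finishes in `3 * (k * r)`
levels. -/
theorem solvable_of_card_le (hP : InducedFree (SimpleGraph.pathGraph 6) G)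
    (hR : HasMarkers R G H) (r : ℕ) (j : ℕ) : ∀ (Y : Finset ℕ), (∀ y ∈ Y, y < n * k) →
      Y.card ≤ j * r → Solvable R G H (j + 1 + 3 * (k * r)) (Y : Set ℕ) := by
  classical
  induction j with
  | zero =>
    intro Y _ hc
    have : Y = ∅ := by simpa using hc
    rw [this, Finset.coe_empty]
    exact solvable_empty _
  | succ j ih =>
    intro Y hY hc
    rw [show j + 1 + 1 + 3 * (k * r) = (j + 1 + 3 * (k * r)) + 1 by ring]
    intro I hI hi
    by_cases hr : I ⊆ purge G H Y r
    · refine solvable_purge hY hr fun Y' hY' hcon => ?_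
      refine solvable_of_cliqueLE hP hR (k * r) Y' (fun y hy => hY y (hY' hy).1) hcon ?_ _
        (by omega)
      exact fun Q hQ => cliqueLE_purge (H := H) hY r Q fun y hy => hY' (hQ y hy)
    · obtain ⟨x, hx, hxp⟩ := Set.not_subset.1 hr
      refine solvable_paint hY hI hi hx fun Y' hY' => ?_
      have hfin : Y'.Finite := Y.finite_toSet.subset fun y hy => (hY' hy).1
      rw [← hfin.coe_toFinset]
      refine ih _ (fun y hy => hY y (hY' (by simpa using hy)).1) ?_
      have hxp' : r < ((Finset.range (n * k)).filter
          fun z => z ∈ (Y : Set ℕ) ∧ Conflict G H x z).card := by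
        by_contra hle
        exact hxp ⟨hI hx, by simpa using hle⟩
      have hsub : hfin.toFinset ⊆ Y \ ((Finset.range (n * k)).filter
          fun z => z ∈ (Y : Set ℕ) ∧ Conflict G H x z) := by
        intro y hy
        have hy' := hY' ((Set.Finite.mem_toFinset _).1 hy)
        refine Finset.mem_sdiff.2 ⟨hy'.1, fun h => hy'.2 ⟨hI hx, ?_⟩⟩
        exact (Finset.mem_filter.1 h).2.2
      have h1 := Finset.card_le_card hsub
      rw [Finset.card_sdiff_of_subset fun z hz => (Finset.mem_filter.1 hz).2.1] at h1
      rw [add_mul, one_mul] at hc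
      omega

/-- The search of depth `4 * k * r + 1` solves the whole instance if `r ≥ √n`. -/
theorem solvable_range (hP : InducedFree (SimpleGraph.pathGraph 6) G)
    (hR : HasMarkers R G H) {r : ℕ} (hr : n ≤ r * r) :
    Solvable R G H (4 * k * r + 1) {y | y < n * k} := by
  -- There are `n * k ≤ (k * r) * r` items, so at most `k * r` heavy items are ever guessed.
  have h := solvable_of_card_le hP hR r (k * r) (Finset.range (n * k)) (by simp)
    (by rw [Finset.card_range]; nlinarith [Nat.mul_le_mul_right k hr])
  rw [show k * r + 1 + 3 * (k * r) = 4 * k * r + 1 by ring] at h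
  simpa [Set.Iio_def] using h

end ColoringSearch

/-! ## Programs with bounded loops -/

namespace RAM

/-- The scalar stored in cell `0` of the array `a`. -/
abbrev NExp.var (a : ℕ) : NExp := .get a (.const 0)

/-- Programs all of whose loops are counting loops: `loop x v p` runs `p` for the values
`0, 1, …` of the scalar `x` that are below the scalar `v`. -/
inductive LoopProg : Type
  | skip : LoopProg
  | setNat (a : ℕ) (i e : NExp) : LoopProg
  | setReal (a : ℕ) (i : NExp) (e : RExp) : LoopProg
  | seq (p q : LoopProg) : LoopProg
  | ite (c : Cond) (p q : LoopProg) : LoopProg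
  | loop (x v : ℕ) (p : LoopProg) : LoopProg

namespace LoopProg

/-- Translation to programs. -/
def toProg : LoopProg → Prog
  | .skip => .skip
  | .setNat a i e => .setNat a i e
  | .setReal a i e => .setReal a i e
  | .seq p q => .seq p.toProg q.toProg
  | .ite c p q => .ite c p.toProg q.toProg
  | .loop x v p => .seq (.setNat x (.const 0) (.const 0))
      (.loop (.lt (.var x) (.var v))
        (.seq p.toProg (.setNat x (.const 0) (.add (.var x) (.const 1)))))

/-- The effect of `i` rounds of a counting loop. -/
def iterate (f : Store → Store) (x : ℕ) : ℕ → Store → Store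
  | 0, m => m.writeNat x 0 0
  | i + 1, m => (f (iterate f x i m)).writeNat x 0 (i + 1)

open scoped Classical in
/-- The effect of a program. -/
noncomputable def run : LoopProg → Store → Store
  | .skip, m => m
  | .setNat a i e, m => m.writeNat a (i.eval m) (e.eval m)
  | .setReal a i e, m => m.writeReal a (i.eval m) (e.eval m)
  | .seq p q, m => q.run (p.run m)
  | .ite c p q, m => if c.Holds m then p.run m else q.run m
  | .loop x v p, m => iterate p.run x (m.nat v 0) m

/-- The arrays of natural numbers that a program may change. -/
def writes : LoopProg → List ℕ
  | .skip => []
  | .setNat a _ _ => [a]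
  | .setReal _ _ _ => []
  | .seq p q => p.writes ++ q.writes
  | .ite _ p q => p.writes ++ q.writes
  | .loop x _ p => x :: p.writes

/-- The arrays of real numbers that a program may change. -/
def writesReal : LoopProg → List ℕ
  | .skip => []
  | .setNat _ _ _ => []
  | .setReal a _ _ => [a]
  | .seq p q => p.writesReal ++ q.writesReal
  | .ite _ p q => p.writesReal ++ q.writesReal
  | .loop _ _ p => p.writesReal

/-- The scalars that bound the loops of a program. -/
def bounds : LoopProg → List ℕ
  | .skip => []
  | .setNat _ _ _ => []
  | .setReal _ _ _ => []
  | .seq p q => p.bounds ++ q.bounds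
  | .ite _ p q => p.bounds ++ q.bounds
  | .loop _ v p => v :: p.bounds

/-- No loop variable is changed inside its loop. -/
def WellFormed : LoopProg → Prop
  | .skip => True
  | .setNat _ _ _ => True
  | .setReal _ _ _ => True
  | .seq p q => p.WellFormed ∧ q.WellFormed
  | .ite _ p q => p.WellFormed ∧ q.WellFormed
  | .loop x _ p => x ∉ p.writes ∧ p.WellFormed

/-- A bound for the number of steps if all loops have at most `L` rounds. -/
def cost (L : ℕ) : LoopProg → ℕ
  | .skip => 1
  | .setNat _ i e => i.cost + e.cost + 1
  | .setReal _ i e => i.cost + e.cost + 1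
  | .seq p q => p.cost L + q.cost L
  | .ite c p q => c.cost + (p.cost L + q.cost L) + 1
  | .loop _ _ p => L * (p.cost L + 12) + 9

end LoopProg

@[simp] theorem Store.writeNat_nat_self (m : Store) (a i x : ℕ) :
    (m.writeNat a i x).nat a = Function.update (m.nat a) i x := by
  simp [Store.writeNat]

@[simp] theorem Store.writeNat_nat_of_ne (m : Store) {a b : ℕ} (i x : ℕ) (h : b ≠ a) :
    (m.writeNat a i x).nat b = m.nat b := by
  simp [Store.writeNat, h]

@[simp] theorem Store.writeNat_real (m : Store) (a i x : ℕ) :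
    (m.writeNat a i x).real = m.real := rfl

@[simp] theorem Store.writeReal_nat (m : Store) (a i : ℕ) (x : ℝ) :
    (m.writeReal a i x).nat = m.nat := rfl

@[simp] theorem Store.writeReal_real_self (m : Store) (a i : ℕ) (x : ℝ) :
    (m.writeReal a i x).real a = Function.update (m.real a) i x := by
  simp [Store.writeReal]

@[simp] theorem Store.writeReal_real_of_ne (m : Store) {a b : ℕ} (i : ℕ) (x : ℝ) (h : b ≠ a) :
    (m.writeReal a i x).real b = m.real b := by
  simp [Store.writeReal, h]

/-- The stores agree outside of the arrays listed in `ws` and `rs`. -/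
def Agree (ws rs : List ℕ) (m m' : Store) : Prop :=
  (∀ a, a ∉ ws → m'.nat a = m.nat a) ∧ ∀ a, a ∉ rs → m'.real a = m.real a

theorem Agree.refl (ws rs : List ℕ) (m : Store) : Agree ws rs m m :=
  ⟨fun _ _ => rfl, fun _ _ => rfl⟩

theorem Agree.trans {ws rs : List ℕ} {m m' m'' : Store} (h : Agree ws rs m m')
    (h' : Agree ws rs m' m'') : Agree ws rs m m'' :=
  ⟨fun a ha => (h'.1 a ha).trans (h.1 a ha), fun a ha => (h'.2 a ha).trans (h.2 a ha)⟩

theorem Agree.mono {ws ws' rs rs' : List ℕ} {m m' : Store} (h : Agree ws rs m m')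
    (hw : ws ⊆ ws') (hr : rs ⊆ rs') : Agree ws' rs' m m' :=
  ⟨fun a ha => h.1 a fun h' => ha (hw h'), fun a ha => h.2 a fun h' => ha (hr h')⟩

theorem agree_writeNat (m : Store) (a i x : ℕ) : Agree [a] [] m (m.writeNat a i x) :=
  ⟨fun _ hb => m.writeNat_nat_of_ne i x (by simpa using hb), fun _ _ => rfl⟩

theorem agree_writeReal (m : Store) (a i : ℕ) (x : ℝ) : Agree [] [a] m (m.writeReal a i x) :=
  ⟨fun _ _ => rfl, fun _ hb => m.writeReal_real_of_ne i x (by simpa using hb)⟩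

namespace LoopProg

theorem agree_iterate {f : Store → Store} {ws rs : List ℕ} (hf : ∀ m, Agree ws rs m (f m))
    (x i : ℕ) (m : Store) : Agree (x :: ws) rs m (iterate f x i m) := by
  induction i with
  | zero => exact (agree_writeNat m x 0 0).mono (by simp) (by simp)
  | succ i ih =>
    refine ih.trans (((hf _).mono (by simp) (by simp)).trans ?_)
    exact (agree_writeNat _ x 0 (i + 1)).mono (by simp) (by simp)

theorem agree_run (p : LoopProg) (m : Store) : Agree p.writes p.writesReal m (p.run m) := by
  induction p generalizing m with
  | skip => exact .refl _ _ _
  | setNat a i e => exact agree_writeNat _ _ _ _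
  | setReal a i e => exact agree_writeReal _ _ _ _
  | seq p q ihp ihq =>
    exact ((ihp m).mono (by simp [writes]) (by simp [writesReal])).trans
      ((ihq _).mono (by simp [writes]) (by simp [writesReal]))
  | ite c p q ihp ihq =>
    rw [run]
    split_ifs
    · exact (ihp m).mono (by simp [writes]) (by simp [writesReal])
    · exact (ihq m).mono (by simp [writes]) (by simp [writesReal])
  | loop x v p ih => exact agree_iterate ih x _ m

theorem run_nat (p : LoopProg) (m : Store) {a : ℕ} (ha : a ∉ p.writes) :
    (p.run m).nat a = m.nat a := (p.agree_run m).1 a ha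

theorem iterate_var (f : Store → Store) (x i : ℕ) (m : Store) : (iterate f x i m).nat x 0 = i := by
  cases i <;> simp [iterate]

/-- The invariant rule for counting loops. -/
theorem run_loop_induction {x v : ℕ} {p : LoopProg} {m : Store} (I : ℕ → Store → Prop)
    (h0 : I 0 (m.writeNat x 0 0))
    (hs : ∀ i < m.nat v 0, ∀ m', Agree (x :: p.writes) p.writesReal m m' → m'.nat x 0 = i →
      I i m' → I (i + 1) ((p.run m').writeNat x 0 (i + 1))) :
    I (m.nat v 0) ((loop x v p).run m) := by
  have : ∀ i ≤ m.nat v 0, I i (iterate p.run x i m) := by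
    intro i
    induction i with
    | zero => exact fun _ => h0
    | succ i ih =>
      intro hi
      exact hs i (by omega) _ (agree_iterate (fun m => agree_run p m) x i m)
        (iterate_var _ _ _ _) (ih (by omega))
  exact this _ le_rfl

/-- Well-formed programs run as described by `run`, in the time given by `cost`. -/
theorem exec_toProg {L : ℕ} {ws : List ℕ} (p : LoopProg) (hp : p.WellFormed) (hw : p.writes ⊆ ws)
    (hb : ∀ v ∈ p.bounds, v ∉ ws) (m : Store) (hL : ∀ v ∈ p.bounds, m.nat v 0 ≤ L) :
    ∃ t ≤ p.cost L, Exec p.toProg m t (p.run m) := by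
  induction p generalizing m with
  | skip => exact ⟨_, le_rfl, .skip m⟩
  | setNat a i e => exact ⟨_, le_rfl, .setNat a i e m⟩
  | setReal a i e => exact ⟨_, le_rfl, .setReal a i e m⟩
  | seq p q ihp ihq =>
    simp only [writes, List.append_subset] at hw
    simp only [bounds, List.mem_append] at hb hL
    obtain ⟨t₁, ht₁, h₁⟩ := ihp hp.1 hw.1 (fun v hv => hb v (Or.inl hv)) m
      (fun v hv => hL v (Or.inl hv))
    obtain ⟨t₂, ht₂, h₂⟩ := ihq hp.2 hw.2 (fun v hv => hb v (Or.inr hv)) (p.run m)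
      (fun v hv => by
        rw [p.run_nat m fun h => hb v (Or.inr hv) (hw.1 h)]
        exact hL v (Or.inr hv))
    exact ⟨t₁ + t₂, add_le_add ht₁ ht₂, .seq h₁ h₂⟩
  | ite c p q ihp ihq =>
    simp only [writes, List.append_subset] at hw
    simp only [bounds, List.mem_append] at hb hL
    by_cases hc : c.Holds m
    · obtain ⟨t₁, ht₁, h₁⟩ := ihp hp.1 hw.1 (fun v hv => hb v (Or.inl hv)) m
        (fun v hv => hL v (Or.inl hv))
      refine ⟨c.cost + t₁ + 1, by simp only [cost]; omega, ?_⟩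
      rw [run, if_pos hc]
      exact .iteTrue hc h₁
    · obtain ⟨t₁, ht₁, h₁⟩ := ihq hp.2 hw.2 (fun v hv => hb v (Or.inr hv)) m
        (fun v hv => hL v (Or.inr hv))
      refine ⟨c.cost + t₁ + 1, by simp only [cost]; omega, ?_⟩
      rw [run, if_neg hc]
      exact .iteFalse hc h₁
  | loop x v p ih =>
    simp only [writes, List.cons_subset] at hw
    simp only [bounds, List.mem_cons, forall_eq_or_imp] at hb hL
    have hag : ∀ i, Agree ws p.writesReal m (iterate p.run x i m) := fun i =>
      (agree_iterate (fun m => agree_run p m) x i m).mono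
        (List.cons_subset.2 hw) (fun _ h => h)
    -- Induction on the number `j` of rounds still to come. A round costs 12 besides its body: 5 for
    -- the test, 6 for the increment and 1 for the step; the failing last test costs 6.
    have main : ∀ j ≤ m.nat v 0, ∃ t ≤ j * (p.cost L + 12) + 6,
        Exec (.loop (.lt (.var x) (.var v))
          (.seq p.toProg (.setNat x (.const 0) (.add (.var x) (.const 1)))))
          (iterate p.run x (m.nat v 0 - j) m) t (iterate p.run x (m.nat v 0) m) := by
      intro j
      induction j with
      | zero =>
        intro _
        refine ⟨6, by omega, ?_⟩
        rw [Nat.sub_zero]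
        refine Exec.loopDone ?_
        simp only [Cond.Holds, NExp.eval, iterate_var, not_lt]
        rw [(hag _).1 v hb.1]
      | succ j ihj =>
        intro hj
        obtain ⟨t₂, ht₂, h₂⟩ := ihj (by omega)
        set i := m.nat v 0 - (j + 1) with hi
        have hi' : m.nat v 0 - j = i + 1 := by omega
        rw [hi'] at h₂
        obtain ⟨t₁, ht₁, h₁⟩ := ih hp.2 hw.2 hb.2 (iterate p.run x i m) (fun w hv => by
          rw [(hag i).1 w (hb.2 w hv)]
          exact hL.2 w hv)
        refine ⟨5 + (t₁ + 6) + t₂ + 1, by rw [Nat.succ_mul]; omega, ?_⟩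
        refine Exec.loopStep (c := .lt (.var x) (.var v)) ?_ (.seq h₁ ?_) h₂
        · simp only [Cond.Holds, NExp.eval, iterate_var]
          rw [(hag _).1 v hb.1]
          omega
        · have := Exec.setNat x (.const 0) (.add (.var x) (.const 1)) (p.run (iterate p.run x i m))
          simp only [NExp.eval, NExp.var, p.run_nat _ hp.1, iterate_var] at this
          exact this
    obtain ⟨t, ht, h⟩ := main _ le_rfl
    rw [Nat.sub_self] at h
    refine ⟨3 + t, ?_, .seq (.setNat x (.const 0) (.const 0) m) h⟩
    have : m.nat v 0 * (p.cost L + 12) ≤ L * (p.cost L + 12) := Nat.mul_le_mul_right _ hL.1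
    simp only [cost]
    omega

/-- The cost is bounded by a polynomial in the bound for the number of rounds. -/
theorem exists_cost_le (p : LoopProg) : ∃ c j : ℕ, ∀ L, p.cost L ≤ c * (L + 1) ^ j := by
  have const : ∀ d : ℕ, ∃ c j : ℕ, ∀ L, d ≤ c * (L + 1) ^ j := fun d => ⟨d, 0, by simp⟩
  have sum : ∀ (c c' j j' L : ℕ),
      c * (L + 1) ^ j + c' * (L + 1) ^ j' ≤ (c + c') * (L + 1) ^ (j + j') := by
    intro c c' j j' L
    rw [add_mul]
    exact add_le_add (Nat.mul_le_mul_left _ (Nat.pow_le_pow_right (by omega) (by omega)))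
      (Nat.mul_le_mul_left _ (Nat.pow_le_pow_right (by omega) (by omega)))
  induction p with
  | skip => exact const _
  | setNat a i e => exact const _
  | setReal a i e => exact const _
  | seq p q ihp ihq =>
    obtain ⟨c, j, h⟩ := ihp
    obtain ⟨c', j', h'⟩ := ihq
    exact ⟨c + c', j + j', fun L => (add_le_add (h L) (h' L)).trans (sum _ _ _ _ _)⟩
  | ite b p q ihp ihq =>
    obtain ⟨c, j, h⟩ := ihp
    obtain ⟨c', j', h'⟩ := ihq
    refine ⟨c + c' + (b.cost + 1), j + j', fun L => ?_⟩
    have h1 := (add_le_add (h L) (h' L)).trans (sum _ _ _ _ _)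
    have h2 : b.cost + 1 ≤ (b.cost + 1) * (L + 1) ^ (j + j') :=
      Nat.le_mul_of_pos_right _ (by positivity)
    rw [add_mul _ (b.cost + 1)]
    simp only [cost]
    omega
  | loop x v p ih =>
    obtain ⟨c, j, h⟩ := ih
    refine ⟨c + 21, j + 1, fun L => ?_⟩
    have h1 : 1 ≤ (L + 1) ^ j := Nat.one_le_pow _ _ (by omega)
    have h2 := Nat.mul_le_mul_left L (h L)
    simp only [cost]
    rw [pow_succ]
    nlinarith

/-! ### Counting and filling loops. -/

/-- Counting the rounds in which a test succeeds. -/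
def count (cnt z v : ℕ) (c : Cond) : LoopProg :=
  .seq (.setNat cnt (.const 0) (.const 0))
    (.loop z v (.ite c (.setNat cnt (.const 0) (.add (.var cnt) (.const 1))) .skip))

open scoped Classical in
-- It is enough to understand the test on stores that differ from `m` in the counter and the loop
-- variable, because nothing else is written.
theorem run_count {cnt z v : ℕ} {c : Cond} {m : Store} (hz : z ≠ cnt) (hv : v ≠ cnt)
    (P : ℕ → Prop)
    (hc : ∀ m', Agree [cnt, z] [] m m' → m'.nat z 0 < m.nat v 0 → (c.Holds m' ↔ P (m'.nat z 0))) :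
    ((count cnt z v c).run m).nat cnt 0 = ((Finset.range (m.nat v 0)).filter P).card := by
  have hv' : (m.writeNat cnt 0 0).nat v = m.nat v := by simp [hv]
  have := run_loop_induction (x := z) (v := v)
    (p := .ite c (.setNat cnt (.const 0) (.add (.var cnt) (.const 1))) .skip)
    (m := m.writeNat cnt 0 0)
    (fun i m' => m'.nat cnt 0 = ((Finset.range i).filter P).card)
    (by simp [Store.writeNat_nat_of_ne _ _ _ hz.symm]) ?_
  · rw [hv'] at this
    exact this
  · intro i hi m' hag hx ih
    have hag' : Agree [cnt, z] [] m m' :=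
      ((agree_writeNat m cnt 0 0).mono (by simp) (by simp)).trans
        (hag.mono (by simp [writes]) (by simp [writesReal]))
    have hci := hc m' hag' (by rw [hx, ← hv']; exact hi)
    rw [hx] at hci
    rw [Store.writeNat_nat_of_ne _ _ _ hz.symm, Finset.range_add_one, Finset.filter_insert, run]
    by_cases hP : P i
    · rw [if_pos (hci.2 hP), if_pos hP, Finset.card_insert_of_notMem (by simp)]
      simp [run, NExp.eval, ih]
    · rw [if_neg (fun h => hP (hci.1 h)), if_neg hP]
      exact ih

/-- A loop that fills consecutive cells of an array. -/
theorem run_fill {y v arr base : ℕ} {p : LoopProg} {m : Store} (hy : arr ≠ y) (P : ℕ → Prop)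
    (hp : ∀ m', Agree (y :: p.writes) p.writesReal m m' → m'.nat y 0 < m.nat v 0 →
      (∀ c, (∀ j < m.nat v 0, c ≠ base + j) → m'.nat arr c = m.nat arr c) →
      (∀ c, c ≠ base + m'.nat y 0 → (p.run m').nat arr c = m'.nat arr c) ∧
      ((p.run m').nat arr (base + m'.nat y 0) = 1 ↔ P (m'.nat y 0))) :
    (∀ j < m.nat v 0, ((loop y v p).run m).nat arr (base + j) = 1 ↔ P j) ∧
      ∀ c, (∀ j < m.nat v 0, c ≠ base + j) → ((loop y v p).run m).nat arr c = m.nat arr c := by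
  refine run_loop_induction (x := y) (v := v) (p := p) (m := m)
    (fun i m' => (∀ j < i, m'.nat arr (base + j) = 1 ↔ P j) ∧
      ∀ c, (∀ j < m.nat v 0, c ≠ base + j) → m'.nat arr c = m.nat arr c) ?_ ?_
  · exact ⟨fun j hj => absurd hj (by omega), fun c _ => by
      rw [Store.writeNat_nat_of_ne _ _ _ hy]⟩
  · intro i hi m' hag hx ih
    obtain ⟨h1, h2⟩ := hp m' hag (hx ▸ hi) ih.2
    rw [hx] at h1 h2
    rw [Store.writeNat_nat_of_ne _ _ _ hy]
    refine ⟨fun j hj => ?_, fun c hc => (h1 c (hc i hi)).trans (ih.2 c hc)⟩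
    rcases Nat.lt_succ_iff_lt_or_eq.1 hj with hj | rfl
    · rw [h1 _ (by omega)]
      exact ih.1 j hj
    · exact h2

/-- Setting a cell to the truth value of a test. -/
def setTest (arr : ℕ) (i : NExp) (c : Cond) : LoopProg :=
  .ite c (.setNat arr i (.const 1)) (.setNat arr i (.const 0))

theorem run_setTest {arr : ℕ} {i : NExp} {c : Cond} {m : Store} :
    (∀ j, j ≠ i.eval m → ((setTest arr i c).run m).nat arr j = m.nat arr j) ∧
      (((setTest arr i c).run m).nat arr (i.eval m) = 1 ↔ c.Holds m) := by
  rw [setTest, run]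
  split_ifs with h
  · exact ⟨fun j hj => by simp [run, hj], by simp [run, h, NExp.eval]⟩
  · exact ⟨fun j hj => by simp [run, hj], by simp [run, h, NExp.eval]⟩

end LoopProg

/-- Disjunction. -/
def Cond.or (c d : Cond) : Cond := .not (.and (.not c) (.not d))

@[simp] theorem Cond.holds_or {m : Store} {c d : Cond} :
    (c.or d).Holds m ↔ c.Holds m ∨ d.Holds m := by
  simp only [Cond.or, Cond.Holds]
  tauto

/-- The disjunction of a list of tests. -/
def Cond.any : List Cond → Cond
  | [] => .lt (.const 0) (.const 0)
  | c :: l => c.or (Cond.any l)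

@[simp] theorem Cond.holds_any {m : Store} {l : List Cond} :
    (Cond.any l).Holds m ↔ ∃ c ∈ l, c.Holds m := by
  induction l with
  | nil => simp [Cond.any, Cond.Holds, NExp.eval]
  | cons c l ih => simp [Cond.any, ih]

/-- Multiplication by a constant. -/
def NExp.smul : ℕ → NExp → NExp
  | 0, _ => .const 0
  | k + 1, e => .add (NExp.smul k e) e

@[simp] theorem NExp.eval_smul (m : Store) (k : ℕ) (e : NExp) :
    (NExp.smul k e).eval m = k * e.eval m := by
  induction k with
  | zero => simp [NExp.smul, NExp.eval]
  | succ k ih => simp [NExp.smul, NExp.eval, ih, add_mul]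

namespace LoopProg

/-! ### Nested loops as a counter in base `b`. -/

/-- Nested loops: the scalars `a, …, a + q - 1` run through all values below the scalar `v`. -/
def nest (a v : ℕ) : ℕ → LoopProg → LoopProg
  | 0, p => p
  | q + 1, p => .loop (a + q) v (nest a v q p)

theorem mem_writes_nest {a v q b : ℕ} {p : LoopProg} :
    b ∈ (nest a v q p).writes ↔ b ∈ p.writes ∨ (a ≤ b ∧ b < a + q) := by
  induction q with
  | zero => simp only [nest]; constructor <;> [exact Or.inl; rintro (h | h)] <;> [exact h; omega]
  | succ q ih =>
    simp only [nest, writes, List.mem_cons, ih]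
    constructor
    · rintro (rfl | h | h)
      · right; omega
      · exact Or.inl h
      · right; omega
    · rintro (h | h)
      · exact Or.inr (Or.inl h)
      · by_cases hb : b = a + q
        · exact Or.inl hb
        · right; right; omega

@[simp] theorem writesReal_nest {a v q : ℕ} {p : LoopProg} :
    (nest a v q p).writesReal = p.writesReal := by
  induction q with
  | zero => rfl
  | succ q ih => simpa [nest, writesReal] using ih

theorem mem_bounds_nest {a v q b : ℕ} {p : LoopProg} (h : b ∈ (nest a v q p).bounds) :
    b = v ∨ b ∈ p.bounds := by
  induction q with
  | zero => exact Or.inr h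
  | succ q ih =>
    simp only [nest, bounds, List.mem_cons] at h
    rcases h with rfl | h
    exacts [Or.inl rfl, ih h]

theorem wellFormed_nest {a v q : ℕ} {p : LoopProg} (hp : p.WellFormed)
    (ha : ∀ j < q, a + j ∉ p.writes) : (nest a v q p).WellFormed := by
  induction q with
  | zero => exact hp
  | succ q ih =>
    refine ⟨fun h => ?_, ih fun j hj => ha j (by omega)⟩
    rcases mem_writes_nest.1 h with h | h
    · exact ha q (by omega) h
    · omega

/-- The `j`-th digit of `c` in base `b`. -/
def digit (b c j : ℕ) : ℕ := c / b ^ j % b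

/-- The invariant rule for nested loops. -/
theorem run_nest_induction {a v : ℕ} {p : LoopProg} (I : ℕ → Store → Prop) (ws rs : List ℕ)
    (q b : ℕ) (hws : ∀ x ∈ p.writes, x ∈ ws) (hrs : ∀ x ∈ p.writesReal, x ∈ rs)
    (haw : ∀ j < q, a + j ∈ ws) (hap : ∀ j < q, a + j ∉ p.writes) (hv : v ∉ ws)
    (hbpos : 0 < b)
    (hI : ∀ c m j x, j < q → I c m → I c (m.writeNat (a + j) 0 x))
    (m₀ : Store) (hb : m₀.nat v 0 = b)
    (hs : ∀ c < b ^ q, ∀ m, Agree ws rs m₀ m → (∀ j < q, m.nat (a + j) 0 = digit b c j) → I c m →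
      I (c + 1) (p.run m))
    (h0 : I 0 m₀) : I (b ^ q) ((nest a v q p).run m₀) := by
  -- The inner `q'` loops advance the counter from a multiple `c` of `b ^ q'` through `b ^ q'`
  -- values, while the outer loop variables keep holding the higher digits of `c`.
  have key : ∀ q' ≤ q, ∀ c, c + b ^ q' ≤ b ^ q → b ^ q' ∣ c → ∀ m, Agree ws rs m₀ m →
      (∀ j, q' ≤ j → j < q → m.nat (a + j) 0 = digit b c j) → I c m →
      I (c + b ^ q') ((nest a v q' p).run m) := by
    intro q'
    induction q' with
    | zero =>
      intro _ c hc _ m hag hd hi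
      exact hs c (by simpa using hc) m hag (fun j hj => hd j (by omega) hj) hi
    | succ q' ih =>
      intro hq' c hc hdvd m hag hd hi
      have hmv : m.nat v 0 = b := by rw [hag.1 v hv, hb]
      have hsub : ∀ x ∈ (nest a v q' p).writes, x ∈ ws := by
        intro x hx
        rcases mem_writes_nest.1 hx with hx | hx
        · exact hws x hx
        · obtain ⟨j, rfl⟩ := Nat.exists_eq_add_of_le hx.1
          exact haw j (by omega)
      have hloop := run_loop_induction (x := a + q') (v := v) (p := nest a v q' p) (m := m)
        (fun i m' => I (c + i * b ^ q') m' ∧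
          ∀ j, q' + 1 ≤ j → j < q → m'.nat (a + j) 0 = digit b c j) ?_ ?_
      · have := hloop.1
        rw [hmv] at this
        rwa [pow_succ, mul_comm (b ^ q')]
      · refine ⟨by simpa using hI c m q' 0 (by omega) hi, fun j hj hjq => ?_⟩
        rw [Store.writeNat_nat_of_ne _ _ _ (by omega)]
        exact hd j hj hjq
      · intro i hi' m' hag' hx hinv
        rw [hmv] at hi'
        have hag₀ : Agree ws rs m₀ m' := hag.trans (hag'.mono
          (List.cons_subset.2 ⟨haw q' (by omega), fun x hx => hsub x hx⟩)
          (fun x hx => hrs x (by simpa using hx)))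
        obtain ⟨d, rfl⟩ := hdvd
        have hle : b ^ (q' + 1) * d + i * b ^ q' + b ^ q' ≤ b ^ q := by
          have : (i + 1) * b ^ q' ≤ b * b ^ q' := Nat.mul_le_mul_right _ hi'
          rw [pow_succ, mul_comm (b ^ q') b] at hc
          rw [pow_succ, mul_comm (b ^ q') b]
          nlinarith
        have hdig : ∀ j, q' ≤ j → j < q → m'.nat (a + j) 0 =
            digit b (b ^ (q' + 1) * d + i * b ^ q') j := by
          intro j hj hjq
          have hfac : b ^ (q' + 1) * d + i * b ^ q' = b ^ q' * (i + b * d) := by ring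
          rw [digit, hfac]
          rcases Nat.eq_or_lt_of_le hj with rfl | hlt
          · rw [hx, Nat.mul_div_cancel_left _ (by positivity), Nat.add_mul_mod_self_left,
              Nat.mod_eq_of_lt hi']
          · rw [hinv.2 j hlt hjq, digit]
            obtain ⟨l, rfl⟩ := Nat.exists_eq_add_of_lt hlt
            rw [show b ^ (q' + l + 1) = b ^ q' * (b * b ^ l) by ring,
              show b ^ (q' + 1) * d = b ^ q' * (b * d) by ring,
              Nat.mul_div_mul_left _ _ (by positivity), Nat.mul_div_mul_left _ _ (by positivity),
              ← Nat.div_div_eq_div_mul, ← Nat.div_div_eq_div_mul,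
              Nat.mul_div_cancel_left _ (pow_pos hbpos q'),
              Nat.add_mul_div_left _ _ hbpos, Nat.div_eq_of_lt hi', zero_add]
        have hres := ih (by omega) _ hle
          (Dvd.dvd.add ⟨b * d, by ring⟩ (Dvd.intro_left _ rfl)) m' hag₀ hdig hinv.1
        refine ⟨?_, fun j hj hjq => ?_⟩
        · have := hI _ _ q' (i + 1) (by omega) hres
          rwa [show b ^ (q' + 1) * d + i * b ^ q' + b ^ q' =
            b ^ (q' + 1) * d + (i + 1) * b ^ q' by ring] at this
        · rw [Store.writeNat_nat_of_ne _ _ _ (by omega), run_nat]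
          · exact hinv.2 j hj hjq
          · intro hmem
            rcases mem_writes_nest.1 hmem with h | h
            · exact hap j hjq h
            · omega
  simpa using key q le_rfl 0 (by simp) (dvd_zero _) m₀ (.refl _ _ _)
    (fun j h h' => absurd h (by omega)) h0

end LoopProg

end RAM

/-! ## Correctness of the search -/

namespace ColoringSearch

open RAM.LoopProg (digit)

variable {n k : ℕ} {R : ℕ} {G : SimpleGraph (Fin n)} {H : SimpleGraph (Fin k)}

open scoped Classical in
/-- The weight of the items of `S` among the first `N` items. -/
noncomputable def weight (N : ℕ) (w : ℕ → ℝ) (S : Set ℕ) : ℝ :=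
  ∑ y ∈ Finset.range N, if y ∈ S then w y else 0

open scoped Classical in
-- The parts are disjoint and `x` lies in none of them, so each item of `A` is counted once after
-- exchanging the two sums.
theorem weight_eq_add_sum {N : ℕ} {w : ℕ → ℝ} {A : Set ℕ} {P : Prop} {x : ℕ} {T : ℕ → Set ℕ}
    (hA : ∀ y < N, y ∈ A ↔ (P ∧ y = x) ∨ ∃ p < N, y ∈ T p)
    (hx : P → x < N) (hxT : ∀ p < N, P → x ∉ T p)
    (hT : ∀ p < N, ∀ p' < N, ∀ y, y ∈ T p → y ∈ T p' → p = p') :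
    weight N w A = (if P then w x else 0) + ∑ p ∈ Finset.range N, weight N w (T p) := by
  have h1 : (if P then w x else 0) = ∑ y ∈ Finset.range N, if P ∧ y = x then w y else 0 := by
    by_cases hP : P
    · simp only [hP, true_and, if_true]
      rw [Finset.sum_ite_eq' (Finset.range N) x w, if_pos (Finset.mem_range.2 (hx hP))]
    · simp [hP]
  rw [h1]
  simp only [weight]
  rw [Finset.sum_comm, ← Finset.sum_add_distrib]
  refine Finset.sum_congr rfl fun y hy => ?_
  have hyN := Finset.mem_range.1 hy
  by_cases hyx : P ∧ y = x
  · have : ∑ p ∈ Finset.range N, (if y ∈ T p then w y else 0) = 0 :=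
      Finset.sum_eq_zero fun p hp =>
        if_neg (hyx.2 ▸ hxT p (Finset.mem_range.1 hp) hyx.1)
    rw [this, if_pos ((hA y hyN).2 (Or.inl hyx)), if_pos hyx, add_zero]
  · rw [if_neg hyx, zero_add]
    by_cases hyT : ∃ p < N, y ∈ T p
    · obtain ⟨p, hp, hyp⟩ := hyT
      rw [if_pos ((hA y hyN).2 (Or.inr ⟨p, hp, hyp⟩)),
        Finset.sum_eq_single_of_mem p (Finset.mem_range.2 hp), if_pos hyp]
      intro p' hp' hne
      exact if_neg fun h => hne (hT p' (Finset.mem_range.1 hp') p hp y h hyp)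
    · rw [if_neg fun h => ((hA y hyN).1 h).elim hyx hyT, Finset.sum_eq_zero]
      exact fun p hp => if_neg fun h => hyT ⟨p, Finset.mem_range.1 hp, h⟩

/-- `lab` labels the components of `C`, where items on different sides of the split at `u` are not
considered near. -/
def IsLabelling (k : ℕ) {n : ℕ} (G : SimpleGraph (Fin n)) (C : Set ℕ) (u : ℕ) (lab : ℕ → ℕ) :
    Prop :=
  (∀ y ∈ C, lab y < n * k) ∧ (∀ y ∈ C, ∀ z ∈ C, Joined k G u y z → lab y = lab z) ∧
    ∀ y ∈ C, ∀ z ∈ C, lab y = lab z →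
      Relation.ReflTransGen (fun a b => a ∈ C ∧ b ∈ C ∧ Joined k G u a b) y z

/-- A step between joined items preserves both the label and the side of the split, so a walk
between two items of a class never leaves the class or the side. -/
theorem IsLabelling.connected {C : Set ℕ} {u : ℕ} {lab : ℕ → ℕ} (h : IsLabelling k G C u lab)
    (p : ℕ) : Connected k G {y | y ∈ C ∧ lab y = p} ∧ OneSided k G u {y | y ∈ C ∧ lab y = p} := by
  have key : ∀ y ∈ C, lab y = p → ∀ z, Relation.ReflTransGen
      (fun a b => a ∈ C ∧ b ∈ C ∧ Joined k G u a b) y z →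
      Relation.ReflTransGen (fun a b => a ∈ {y | y ∈ C ∧ lab y = p} ∧
        b ∈ {y | y ∈ C ∧ lab y = p} ∧ Near k G a b) y z ∧ lab z = p ∧
        (Linked k G u y ↔ Linked k G u z) := by
    intro y hy hp z hz
    induction hz with
    | refl => exact ⟨.refl, hp, Iff.rfl⟩
    | tail _ h' ih =>
      obtain ⟨ih₁, ih₂, ih₃⟩ := ih
      have hl := (h.2.1 _ h'.1 _ h'.2.1 h'.2.2).symm.trans ih₂
      exact ⟨ih₁.tail ⟨⟨h'.1, ih₂⟩, ⟨h'.2.1, hl⟩, h'.2.2.1⟩, hl, ih₃.trans h'.2.2.2⟩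
  refine ⟨fun y hy z hz => (key y hy.1 hy.2 z (h.2.2 y hy.1 z hz.1 (hy.2.trans hz.2.symm))).1, ?_⟩
  by_cases hl : ∃ y ∈ {y | y ∈ C ∧ lab y = p}, Linked k G u y
  · obtain ⟨y, hy, hyl⟩ := hl
    exact Or.inl fun z hz =>
      (key y hy.1 hy.2 z (h.2.2 y hy.1 z hz.1 (hy.2.trans hz.2.symm))).2.2.1 hyl
  · exact Or.inr fun y hy hyl => hl ⟨y, hy, hyl⟩

/-- The union of independent sets in the parts of the core, together with the used item, is
independent. -/
theorem independent_union {W : Set ℕ} {dg : ℕ → ℕ} {lab : ℕ → ℕ}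
    (hl : IsLabelling k G (core R G H W dg) (dg 2) lab) {N : ℕ} {T : ℕ → Set ℕ}
    (hT : ∀ p < N, T p ⊆ {y | y ∈ core R G H W dg ∧ lab y = p})
    (hi : ∀ p < N, Independent G H (T p)) {P : Prop} (hP : P → dg 0 ∈ W) :
    Independent G H {y | (P ∧ y = dg 0) ∨ ∃ p < N, y ∈ T p} := by
  have hxy : ∀ p < N, ∀ y ∈ T p, P → ¬ Conflict G H (dg 0) y := fun p hp y hy h hc =>
    (core_subset_paint (hT p hp hy).1).2 ⟨hP h, hc⟩
  rintro y (⟨hPy, rfl⟩ | ⟨p, hp, hyp⟩) z (⟨hPz, rfl⟩ | ⟨p', hp', hzp⟩) hc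
  · rfl
  · exact absurd hc (hxy p' hp' z hzp hPy)
  · exact absurd hc.symm (hxy p hp y hyp hPz)
  · obtain ⟨hyC, hyl⟩ := hT p hp hyp
    obtain ⟨hzC, hzl⟩ := hT p' hp' hzp
    -- Conflicting items on the same side are joined and get the same label; conflicts between
    -- different sides have been removed by the split.
    by_cases hside : Linked k G (dg 2) y ↔ Linked k G (dg 2) z
    · have := hl.2.1 y hyC z hzC ⟨hc.near, hside⟩
      have hpp : p = p' := hyl.symm.trans (this.trans hzl)
      subst hpp
      exact hi p hp y hyp z hzp hc
    · exfalso
      rcases hyC.2 with ⟨hy1, hy2⟩ | ⟨hy1, hy2⟩ <;> rcases hzC.2 with ⟨hz1, hz2⟩ | ⟨hz1, hz2⟩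
      · exact hside (iff_of_true hy1 hz1)
      · exact hz2 (hy2 z hzC.1 hz1 hc)
      · exact hy2 (hz2 y hyC.1 hy1 hc.symm)
      · exact hside (iff_of_false hy1 hz1)

/-- Only the first `R + 3` entries of a guess are read, so an abstract guess may be replaced by the
digits of a number. -/
theorem core_congr {W : Set ℕ} {dg dg' : ℕ → ℕ} (h : ∀ j < R + 3, dg j = dg' j) :
    core R G H W dg = core R G H W dg' := by
  have hM : Marked R G H dg = Marked R G H dg' := by
    funext y
    refine propext ⟨?_, ?_⟩
    · rintro ⟨j, hj, hc⟩
      exact ⟨j, hj, by rwa [← h _ (by omega)]⟩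
    · rintro ⟨j, hj, hc⟩
      exact ⟨j, hj, by rwa [h _ (by omega)]⟩
  simp only [core, hM, h 0 (by omega), h 1 (by omega), h 2 (by omega)]

/-- The machine runs through all numbers `ρ`; therefore it meets every guess. -/
theorem exists_digits {q b : ℕ} (dg : ℕ → ℕ) (h : ∀ j < q, dg j < b) :
    ∃ ρ < b ^ q, ∀ j < q, digit b ρ j = dg j := by
  let f : Fin q → Fin b := fun j => ⟨dg j, h j j.2⟩
  refine ⟨finFunctionFinEquiv f, (finFunctionFinEquiv f).2, fun j hj => ?_⟩
  have := congrArg Fin.val (congrFun (finFunctionFinEquiv.symm_apply_apply f) ⟨j, hj⟩)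
  exact this

/-- The number of children of a node of the search tree, for `N` items. -/
def branching (R N : ℕ) : ℕ := (N + 1) ^ (R + 3) * N

/-- The nodes of the search tree are numbered level by level; this is the child of the node `i` for
the guess number `ρ` and the label `p`. -/
def child (R N i ρ p : ℕ) : ℕ := branching R N * i + 1 + (ρ * N + p)

/-- The number of nodes on the first `j` levels. -/
def levels (R N : ℕ) : ℕ → ℕ
  | 0 => 0
  | j + 1 => branching R N * levels R N j + 1

/-- The sets at the children of node `i` arise from the set at node `i`. -/
def Expanded (R : ℕ) (G : SimpleGraph (Fin n)) (H : SimpleGraph (Fin k)) (W : ℕ → Set ℕ) (i : ℕ) :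
    Prop :=
  ∀ ρ < (n * k + 1) ^ (R + 3), ∃ lab,
    IsLabelling k G (core R G H (W i) (digit (n * k + 1) ρ)) (digit (n * k + 1) ρ 2) lab ∧
    ∀ p < n * k, W (child R (n * k) i ρ p) =
      {y | y ∈ core R G H (W i) (digit (n * k + 1) ρ) ∧ lab y = p}

open scoped Classical in
/-- The value of the guess number `ρ` at the node `i`. -/
noncomputable def guessValue (R N : ℕ) (w : ℕ → ℝ) (W : ℕ → Set ℕ) (v : ℕ → ℝ) (i ρ : ℕ) : ℝ :=
  (if digit (N + 1) ρ 0 < N ∧ digit (N + 1) ρ 0 ∈ W i then w (digit (N + 1) ρ 0) else 0) +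
    ∑ p ∈ Finset.range N, v (child R N i ρ p)

theorem child_lt_levels {R N i ρ p j : ℕ} (hi : i < levels R N j) (hρ : ρ < (N + 1) ^ (R + 3))
    (hp : p < N) : child R N i ρ p < levels R N (j + 1) := by
  have h1 : ρ * N + p < branching R N := by
    have : (ρ + 1) * N ≤ (N + 1) ^ (R + 3) * N := Nat.mul_le_mul_right _ hρ
    rw [branching]
    nlinarith
  have h2 : branching R N * (i + 1) ≤ branching R N * levels R N j := Nat.mul_le_mul_left _ hi
  rw [child, levels]
  nlinarith

theorem levels_mono {R N j j' : ℕ} (h : j ≤ j') : levels R N j ≤ levels R N j' := by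
  have step : ∀ j, levels R N j ≤ levels R N (j + 1) := by
    intro j
    induction j with
    | zero => exact Nat.zero_le _
    | succ j ih => exact Nat.add_le_add_right (Nat.mul_le_mul_left _ ih) 1
  induction h with
  | refl => exact le_rfl
  | step _ ih => exact ih.trans (step _)

/-- The values computed by the search are at least those of all independent sets. -/
theorem weight_le_value {W : ℕ → Set ℕ} {w v : ℕ → ℝ} {d : ℕ}
    (hWn : ∀ i, ∀ y ∈ W i, y < n * k)
    (hexp : ∀ i < levels R (n * k) d, Expanded R G H W i) (hv0 : ∀ i, 0 ≤ v i)
    (hv : ∀ i < levels R (n * k) d, ∀ ρ < (n * k + 1) ^ (R + 3),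
      guessValue R (n * k) w W v i ρ ≤ v i) {e : ℕ} :
    ∀ {Y : Set ℕ}, Solvable R G H e Y → ∀ i j, j + e ≤ d → i < levels R (n * k) (j + 1) →
      W i = Y → ∀ I ⊆ Y, Independent G H I → weight (n * k) w I ≤ v i := by
  classical
  induction e with
  | zero =>
    intro Y hY i j _ _ _ I hI _
    have hI0 : I = ∅ := Set.subset_empty_iff.1 (hI.trans (Set.subset_empty_iff.2 hY))
    rw [hI0]
    simpa [weight] using hv0 i
  | succ e ih =>
    intro Y hY i j hj hi hWi I hI hind
    subst hWi
    obtain ⟨dg, hdg, hx, hcore, hsub⟩ := hY I hI hind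
    obtain ⟨ρ, hρ, hρd⟩ := exists_digits (q := R + 3) (b := n * k + 1) dg
      (fun j _ => Nat.lt_succ_of_le (hdg j))
    have hid : i < levels R (n * k) d := lt_of_lt_of_le hi (levels_mono (by omega))
    obtain ⟨lab, hlab, hchild⟩ := hexp i hid ρ hρ
    rw [core_congr hρd, hρd 2 (by omega)] at hlab
    rw [core_congr hρd] at hchild
    refine le_trans ?_ (hv i hid ρ hρ)
    -- The items of I with label `p` lie in a connected, one-sided part of the core, to which the
    -- induction hypothesis applies one level deeper.
    have hval : ∀ p < n * k, weight (n * k) w {y | y ∈ I ∧ y ≠ dg 0 ∧ lab y = p} ≤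
        v (child R (n * k) i ρ p) := by
      intro p hp
      have hcon := hlab.connected p
      refine ih (hsub _ (fun y hy => hy.1) hcon.1 hcon.2) _ (j + 1) (by omega)
        (child_lt_levels hi hρ hp) (hchild p hp) _ ?_ ?_
      · exact fun y hy => ⟨hcore y hy.1 hy.2.1, hy.2.2⟩
      · exact fun y hy z hz => hind y hy.1 z hz.1
    have hdec := weight_eq_add_sum (N := n * k) (w := w) (A := I) (P := dg 0 ∈ I) (x := dg 0)
      (T := fun p => {y | y ∈ I ∧ y ≠ dg 0 ∧ lab y = p}) ?_ ?_ ?_ ?_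
    · rw [hdec, guessValue, hρd 0 (by omega)]
      refine add_le_add (le_of_eq ?_)
        (Finset.sum_le_sum fun p hp => hval p (Finset.mem_range.1 hp))
      rcases hx with hx | hx
      · have h1 : dg 0 ∉ I := fun h => by have := hWn i _ (hI h); omega
        rw [if_neg h1, if_neg (by omega)]
      · rw [if_pos hx, if_pos ⟨hWn i _ (hI hx), hI hx⟩]
    · intro y _
      constructor
      · intro hy
        by_cases hyx : y = dg 0
        · exact Or.inl ⟨hyx ▸ hy, hyx⟩
        · exact Or.inr ⟨lab y, hlab.1 y (hcore y hy hyx), hy, hyx, rfl⟩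
      · rintro (⟨hy, rfl⟩ | ⟨p, _, hy⟩)
        exacts [hy, hy.1]
    · exact fun hxI => hWn i _ (hI hxI)
    · exact fun p _ _ h => h.2.1 rfl
    · exact fun p _ p' _ y h h' => h.2.2.symm.trans h'.2.2

/-- One guess at a node turns independent sets at the children into one at the node. -/
theorem guess_sound {W S : ℕ → Set ℕ} {w v : ℕ → ℝ} {i ρ : ℕ}
    (hexp : Expanded R G H W i) (hρ : ρ < (n * k + 1) ^ (R + 3))
    (hS : ∀ p < n * k, S (child R (n * k) i ρ p) ⊆ W (child R (n * k) i ρ p) ∧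
      Independent G H (S (child R (n * k) i ρ p)) ∧
      v (child R (n * k) i ρ p) = weight (n * k) w (S (child R (n * k) i ρ p))) {A : Set ℕ}
    (hA : A = {y | ((digit (n * k + 1) ρ 0 < n * k ∧ digit (n * k + 1) ρ 0 ∈ W i) ∧
      y = digit (n * k + 1) ρ 0) ∨ ∃ p < n * k, y ∈ S (child R (n * k) i ρ p)}) :
    A ⊆ W i ∧ Independent G H A ∧ guessValue R (n * k) w W v i ρ = weight (n * k) w A := by
  classical
  obtain ⟨lab, hlab, hchild⟩ := hexp ρ hρ
  have hT : ∀ p < n * k, S (child R (n * k) i ρ p) ⊆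
      {y | y ∈ core R G H (W i) (digit (n * k + 1) ρ) ∧ lab y = p} := fun p hp =>
    (hS p hp).1.trans (hchild p hp).subset
  refine ⟨?_, ?_, ?_⟩
  · rw [hA]
    rintro y (⟨h, rfl⟩ | ⟨p, hp, hy⟩)
    · exact h.2
    · exact core_subset (hT p hp hy).1
  · rw [hA]
    exact independent_union hlab (N := n * k) (T := fun p => S (child R (n * k) i ρ p)) hT
      (fun p hp => (hS p hp).2.1) And.right
  · rw [weight_eq_add_sum (N := n * k) (w := w) (A := A)
      (P := digit (n * k + 1) ρ 0 < n * k ∧ digit (n * k + 1) ρ 0 ∈ W i)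
      (x := digit (n * k + 1) ρ 0) (T := fun p => S (child R (n * k) i ρ p)), guessValue]
    · refine congrArg₂ (· + ·) (by congr) ?_
      exact Finset.sum_congr rfl fun p hp => (hS p (Finset.mem_range.1 hp)).2.2
    · intro y _
      rw [hA]
      rfl
    · exact And.left
    · intro p hp h hx
      exact (core_subset_paint (hT p hp hx).1).2 ⟨h.2, Or.inl rfl⟩
    · exact fun p hp p' hp' y h h' => (hT p hp h).2.symm.trans (hT p' hp' h').2

end ColoringSearch

/-! ### Loops that tabulate the truth values of a test. -/

namespace RAM

namespace LoopProg

/-- A loop that sets consecutive cells of an array to the truth values of a test. -/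
theorem run_fillTest {y v arr base : ℕ} {addr : NExp} {c : Cond} {m : Store} (hy : arr ≠ y)
    (P : ℕ → Prop)
    (haddr : ∀ m', Agree [y, arr] [] m m' → m'.nat y 0 < m.nat v 0 →
      addr.eval m' = base + m'.nat y 0)
    (hc : ∀ m', Agree [y, arr] [] m m' → m'.nat y 0 < m.nat v 0 → (c.Holds m' ↔ P (m'.nat y 0))) :
    (∀ j < m.nat v 0, ((loop y v (setTest arr addr c)).run m).nat arr (base + j) = 1 ↔ P j) ∧
      ∀ a, (∀ j < m.nat v 0, a ≠ base + j) →
        ((loop y v (setTest arr addr c)).run m).nat arr a = m.nat arr a := by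
  refine run_fill hy P fun m' hag hlt _ => ?_
  have hag' : Agree [y, arr] [] m m' :=
    hag.mono (by simp [setTest, writes]) (by simp [setTest, writesReal])
  obtain ⟨h1, h2⟩ := run_setTest (arr := arr) (i := addr) (c := c) (m := m')
  rw [haddr m' hag' hlt] at h1 h2
  exact ⟨h1, h2.trans (hc m' hag' hlt)⟩

open scoped Classical in
/-- A loop that sets consecutive cells of an array to the truth values of a test that depends on
the result of a counting loop. -/
theorem run_fillCount {y v z w cnt arr base : ℕ} {addr : NExp} {c d : Cond} {m : Store}
    (hy : arr ≠ y) (hac : arr ≠ cnt) (haz : arr ≠ z) (hyc : y ≠ cnt) (hyz : y ≠ z) (hzc : z ≠ cnt)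
    (hw : w ∉ [y, cnt, z, arr]) (P : ℕ → Prop) (Q : ℕ → ℕ → Prop)
    (hd : ∀ m', Agree [y, cnt, z, arr] [] m m' → m'.nat y 0 < m.nat v 0 →
      (∀ a, (∀ j < m.nat v 0, a ≠ base + j) → m'.nat arr a = m.nat arr a) →
      m'.nat z 0 < m.nat w 0 → (d.Holds m' ↔ Q (m'.nat y 0) (m'.nat z 0)))
    (haddr : ∀ m', Agree [y, cnt, z, arr] [] m m' → m'.nat y 0 < m.nat v 0 →
      addr.eval m' = base + m'.nat y 0)
    (hc : ∀ m', Agree [y, cnt, z, arr] [] m m' → m'.nat y 0 < m.nat v 0 →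
      m'.nat cnt 0 = ((Finset.range (m.nat w 0)).filter (Q (m'.nat y 0))).card →
      (c.Holds m' ↔ P (m'.nat y 0))) :
    (∀ j < m.nat v 0,
      ((loop y v (.seq (count cnt z w d) (setTest arr addr c))).run m).nat arr (base + j) = 1 ↔
        P j) ∧
      ∀ a, (∀ j < m.nat v 0, a ≠ base + j) →
        ((loop y v (.seq (count cnt z w d) (setTest arr addr c))).run m).nat arr a =
          m.nat arr a := by
  refine run_fill hy P fun m' hag hlt hout => ?_
  have hag' : Agree [y, cnt, z, arr] [] m m' :=
    hag.mono (by simp [setTest, writes, count]) (by simp [setTest, writesReal, count])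
  have hag2 : Agree [cnt, z] [] m' ((count cnt z w d).run m') :=
    (agree_run _ _).mono (by simp [writes, count]) (by simp [writesReal, count])
  have hag3 : Agree [y, cnt, z, arr] [] m ((count cnt z w d).run m') :=
    hag'.trans (hag2.mono (by simp) (by simp))
  have hy2 : ((count cnt z w d).run m').nat y = m'.nat y := hag2.1 y (by simp [hyc, hyz])
  have harr : ((count cnt z w d).run m').nat arr = m'.nat arr := hag2.1 arr (by simp [hac, haz])
  have hcnt := run_count (cnt := cnt) (z := z) (v := w) (c := d) (m := m') hzc
    (by simp at hw; tauto) (Q (m'.nat y 0)) (fun m'' h'' hlt'' => by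
      have h3 : m''.nat y = m'.nat y := h''.1 y (by simp [hyc, hyz])
      rw [hag'.1 w hw] at hlt''
      have := hd m'' (hag'.trans (h''.mono (by simp) (by simp))) (by rwa [h3])
        (fun a ha => by rw [h''.1 arr (by simp [hac, haz])]; exact hout a ha) hlt''
      rwa [h3] at this)
  rw [hag'.1 w hw, ← hy2] at hcnt
  obtain ⟨h1, h2⟩ := run_setTest (arr := arr) (i := addr) (c := c)
    (m := (count cnt z w d).run m')
  have hlt2 : ((count cnt z w d).run m').nat y 0 < m.nat v 0 := by rwa [hy2]
  rw [haddr _ hag3 hlt2, hy2] at h1 h2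
  rw [harr] at h1
  refine ⟨h1, h2.trans ?_⟩
  rw [hc _ hag3 hlt2 hcnt, hy2]

end LoopProg

end RAM

theorem card_filter_range_eq_zero {L : ℕ} {P : ℕ → Prop} {inst : DecidablePred P} :
    ((Finset.range L).filter P).card = 0 ↔ ∀ z < L, ¬ P z := by
  simp [Finset.filter_eq_empty_iff]

/-! ## The program for one guess

The natural arrays: `0` number of vertices, `1` adjacency matrix, `2` output, `3` number `N` of
items, `4` `N + 1`, `5` number of colours, `6` number of vertices plus one, `7` vertex of an item,
`8` colour of an item, `9` offset of a row of the adjacency matrix, `10` `⌊√n⌋ + 1`, `11` its square,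
`12` depth, `13` item sets of the nodes, `14` solutions of the nodes, `15` offset of a node, `16`
next child, `17` current node, `18` end of the level, `19` level, `20` to `33` local variables,
`34` first child of a node, `100`, `101`, … the guess. The real arrays: `0` weights, `1` values of
the nodes, `2` value of the guess. -/

namespace ColoringSearch

open RAM RAM.LoopProg

variable {n k : ℕ} (R : ℕ) (G : SimpleGraph (Fin n)) (H : SimpleGraph (Fin k))

/-- The tables that do not change during the search. -/
structure Static (k : ℕ) {n : ℕ} (G : SimpleGraph (Fin n)) (m : Store) : Prop where
  size : m.nat 0 0 = n
  adj : ∀ u ≤ n, ∀ v < n, m.nat 1 (v + n * u) = 1 ↔ NatAdj G u v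
  items : m.nat 3 0 = n * k
  base : m.nat 4 0 = n * k + 1
  vertex : ∀ x ≤ n * k, m.nat 7 x = x / k
  colour : ∀ x ≤ n * k, m.nat 8 x = x % k
  row : ∀ u ≤ n, m.nat 9 u = n * u

variable {G} in
theorem Static.of_agree {ws rs : List ℕ} {m m' : Store} (h : Static k G m) (hag : Agree ws rs m m')
    (hws : ∀ a ∈ [0, 1, 3, 4, 7, 8, 9], a ∉ ws) : Static k G m' := by
  have e0 := hag.1 0 (hws 0 (by simp))
  have e1 := hag.1 1 (hws 1 (by simp))
  have e3 := hag.1 3 (hws 3 (by simp))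
  have e4 := hag.1 4 (hws 4 (by simp))
  have e7 := hag.1 7 (hws 7 (by simp))
  have e8 := hag.1 8 (hws 8 (by simp))
  have e9 := hag.1 9 (hws 9 (by simp))
  exact ⟨e0 ▸ h.size, e1 ▸ h.adj, e3 ▸ h.items, e4 ▸ h.base, e7 ▸ h.vertex, e8 ▸ h.colour,
    e9 ▸ h.row⟩

/-- The test whether two items are linked. -/
def linkedTest (x y : NExp) : Cond := .eq (.get 1 (.add (.get 7 y) (.get 9 (.get 7 x)))) (.const 1)

/-- The test whether two items belong to the same vertex. -/
def sameTest (x y : NExp) : Cond := .eq (.get 7 x) (.get 7 y)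

open scoped Classical in
/-- The test whether two colours are adjacent. -/
noncomputable def colourTest (a b : NExp) : Cond :=
  .any ((Finset.univ.filter fun p : Fin k × Fin k => H.Adj p.1 p.2).toList.map
    fun p => .and (.eq a (.const p.1)) (.eq b (.const p.2)))

/-- The test whether two items conflict. -/
noncomputable def conflictTest (x y : NExp) : Cond :=
  .or (sameTest x y) (.and (linkedTest x y) (.not (colourTest H (.get 8 x) (.get 8 y))))

/-- The test whether an item conflicts with a marker. -/
noncomputable def markedTest (y : NExp) : Cond :=
  .any ((List.range R).map fun j => conflictTest H (.var (103 + j)) y)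

variable {R G H}

/-- The first item may be the dummy `n * k`, whose vertex number is `n` if `k > 0`. This is why the
tables extend to `n * k` and the adjacency matrix is read up to row `n`, which is zero. -/
theorem Static.holds_linkedTest {m : Store} (h : Static k G m) {x y : NExp}
    (hx : x.eval m ≤ n * k) (hy : y.eval m < n * k) :
    (linkedTest x y).Holds m ↔ Linked k G (x.eval m) (y.eval m) := by
  have hxk : x.eval m / k ≤ n := by
    rcases Nat.eq_zero_or_pos k with hk | hk
    · simp [hk]
    · exact Nat.div_le_of_le_mul (mul_comm n k ▸ hx)
  have hyk : y.eval m / k < n := Nat.div_lt_of_lt_mul (mul_comm n k ▸ hy)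
  simp only [linkedTest, Cond.Holds, NExp.eval]
  rw [h.vertex _ hx, h.vertex _ hy.le, h.row _ hxk, h.adj _ hxk _ hyk, Linked]

theorem Static.holds_sameTest {m : Store} (h : Static k G m) {x y : NExp}
    (hx : x.eval m ≤ n * k) (hy : y.eval m ≤ n * k) :
    (sameTest x y).Holds m ↔ x.eval m / k = y.eval m / k := by
  simp only [sameTest, Cond.Holds, NExp.eval]
  rw [h.vertex _ hx, h.vertex _ hy]

theorem holds_colourTest {m : Store} {a b : NExp} :
    (colourTest H a b).Holds m ↔ NatAdj H (a.eval m) (b.eval m) := by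
  simp only [colourTest, Cond.holds_any, List.mem_map, Finset.mem_toList, Finset.mem_filter,
    Finset.mem_univ, true_and, exists_exists_and_eq_and, Cond.Holds, NExp.eval, NatAdj]
  constructor
  · rintro ⟨⟨a', b'⟩, hadj, ha, hb⟩
    simp only [ha, hb]
    exact ⟨a'.2, b'.2, hadj⟩
  · rintro ⟨ha, hb, hadj⟩
    exact ⟨⟨⟨_, ha⟩, ⟨_, hb⟩⟩, hadj, rfl, rfl⟩

theorem Static.holds_conflictTest {m : Store} (h : Static k G m) {x y : NExp}
    (hx : x.eval m ≤ n * k) (hy : y.eval m < n * k) :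
    (conflictTest H x y).Holds m ↔ Conflict G H (x.eval m) (y.eval m) := by
  rw [conflictTest, Cond.holds_or, h.holds_sameTest hx hy.le]
  simp only [Cond.Holds]
  rw [h.holds_linkedTest hx hy, holds_colourTest]
  simp only [NExp.eval]
  rw [h.colour _ hx, h.colour _ hy.le, Conflict]

theorem Static.holds_markedTest {m : Store} (h : Static k G m) {y : NExp} {dg : ℕ → ℕ}
    (hdg : ∀ j < R + 3, m.nat (100 + j) 0 = dg j ∧ dg j ≤ n * k)
    (hy : y.eval m < n * k) : (markedTest R H y).Holds m ↔ Marked R G H dg (y.eval m) := by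
  simp only [markedTest, Cond.holds_any, List.mem_map, List.mem_range, exists_exists_and_eq_and,
    Marked]
  refine exists_congr fun j => and_congr_right fun hj => ?_
  have hj' := hdg (3 + j) (by omega)
  rw [← add_assoc] at hj'
  have he : (NExp.var (103 + j)).eval m = dg (3 + j) := hj'.1
  rw [h.holds_conflictTest (he ▸ hj'.2) hy, he]

/-- The test whether an item belongs to the set of the current node. -/
def memTest (y : NExp) : Cond := .eq (.get 13 (.add (.get 15 (.var 17)) y)) (.const 1)

/-- The test whether a cell contains `1`. -/
abbrev bitTest (arr : ℕ) (y : NExp) : Cond := .eq (.get arr y) (.const 1)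

variable (H) in
/-- The first step of a guess: remove the items that conflict with the used item. -/
noncomputable def paintProg : LoopProg :=
  .loop 20 3 (setTest 23 (.var 20) (.and (memTest (.var 20))
    (.not (.and (memTest (.var 100)) (conflictTest H (.var 100) (.var 20))))))

variable (H) in
/-- The second step of a guess: remove the items with many conflicts. -/
noncomputable def purgeProg : LoopProg :=
  .loop 20 3 (.seq
    (count 22 21 3 (.and (bitTest 23 (.var 21)) (conflictTest H (.var 20) (.var 21))))
    (setTest 24 (.var 20) (.and (bitTest 23 (.var 20)) (.not (.lt (.var 101) (.var 22))))))

variable (R H) in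
/-- The third step of a guess: remove the conflicts between the two sides of the split. -/
noncomputable def splitProg : LoopProg :=
  .loop 20 3 (.seq
    (count 22 21 3 (.and (bitTest 24 (.var 21)) (.and (.not (linkedTest (.var 102) (.var 21)))
      (.and (conflictTest H (.var 20) (.var 21)) (.not (markedTest R H (.var 21)))))))
    (setTest 25 (.var 20) (.and (bitTest 24 (.var 20))
      (.or (.and (linkedTest (.var 102) (.var 20)) (.eq (.var 22) (.const 0)))
        (.and (.not (linkedTest (.var 102) (.var 20))) (.not (markedTest R H (.var 20))))))))

theorem agree_paintProg (m : Store) : Agree [20, 23] [] m ((paintProg H).run m) :=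
  (agree_run _ m).mono (by simp [paintProg, setTest, writes])
    (by simp [paintProg, setTest, writesReal])

theorem agree_purgeProg (m : Store) : Agree [20, 21, 22, 24] [] m ((purgeProg H).run m) :=
  (agree_run _ m).mono (by simp [purgeProg, setTest, count, writes])
    (by simp [purgeProg, setTest, count, writesReal])

theorem agree_splitProg (m : Store) : Agree [20, 21, 22, 25] [] m ((splitProg R H).run m) :=
  (agree_run _ m).mono (by simp [splitProg, setTest, count, writes])
    (by simp [splitProg, setTest, count, writesReal])

/-- The memory when the guess `dg` is processed at a node with the set `W`. -/
structure AtGuess (R : ℕ) (G : SimpleGraph (Fin n)) (k : ℕ) (W : Set ℕ) (dg : ℕ → ℕ) (m : Store) :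
    Prop where
  static : Static k G m
  digits : ∀ j < R + 3, m.nat (100 + j) 0 = dg j ∧ dg j ≤ n * k
  lt : ∀ y ∈ W, y < n * k
  set : ∀ y < n * k, m.nat 13 (m.nat 15 (m.nat 17 0) + y) = 1 ↔ y ∈ W

theorem AtGuess.of_agree {W : Set ℕ} {dg : ℕ → ℕ} {ws rs : List ℕ} {m m' : Store}
    (h : AtGuess R G k W dg m) (hag : Agree ws rs m m')
    (hws : ∀ a ∈ ws, a < 100 ∧ a ∉ [0, 1, 3, 4, 7, 8, 9, 13, 15, 17]) :
    AtGuess R G k W dg m' := by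
  have key : ∀ a ∈ [0, 1, 3, 4, 7, 8, 9, 13, 15, 17], a ∉ ws := fun a ha h => (hws a h).2 ha
  refine ⟨h.static.of_agree hag fun a ha => key a (by
    simp only [List.mem_cons, List.not_mem_nil, or_false] at ha ⊢; tauto), fun j hj => ?_,
    h.lt, fun y hy => ?_⟩
  · rw [hag.1 (100 + j) fun hm => by have := (hws _ hm).1; omega]
    exact h.digits j hj
  · rw [hag.1 13 (key 13 (by simp)), hag.1 15 (key 15 (by simp)), hag.1 17 (key 17 (by simp))]
    exact h.set y hy

theorem AtGuess.holds_memTest {W : Set ℕ} {dg : ℕ → ℕ} {m : Store} (h : AtGuess R G k W dg m)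
    {y : NExp} (hy : y.eval m < n * k) : (memTest y).Holds m ↔ y.eval m ∈ W := by
  simp only [memTest, Cond.Holds, NExp.eval]
  exact h.set _ hy

theorem AtGuess.run_paintProg {W : Set ℕ} {dg : ℕ → ℕ} {m : Store} (h : AtGuess R G k W dg m)
    {y : ℕ} (hy : y < n * k) :
    ((paintProg H).run m).nat 23 y = 1 ↔ y ∈ paint G H W (dg 0) := by
  have := (run_fillTest (y := 20) (v := 3) (arr := 23) (base := 0) (addr := .var 20)
    (c := .and (memTest (.var 20))
      (.not (.and (memTest (.var 100)) (conflictTest H (.var 100) (.var 20))))) (m := m)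
    (by simp) (fun y => y ∈ paint G H W (dg 0)) ?_ ?_).1 y (by rwa [h.static.items])
  · rwa [zero_add] at this
  · intro m' _ _
    simp [NExp.eval]
  · intro m' hag hlt
    have h' := h.of_agree hag (by decide)
    rw [h.static.items] at hlt
    have hd := h'.digits 0 (by omega)
    have hx : (NExp.var 100).eval m' = dg 0 := hd.1
    simp only [Cond.Holds]
    rw [h'.holds_memTest (y := .var 20) hlt,
      h'.static.holds_conflictTest (x := .var 100) (y := .var 20) (hx ▸ hd.2) hlt, hx]
    -- For the dummy the membership test reads a cell beyond the block of the node and may give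
    -- anything. It does not matter, because the dummy conflicts with no item and the conjunction
    -- fails.
    have hmem : Conflict G H (dg 0) (m'.nat 20 0) →
        ((memTest (NExp.var 100)).Holds m' ↔ dg 0 ∈ W) := by
      intro hc
      rw [h'.holds_memTest, hx]
      rw [hx]
      refine lt_of_le_of_ne hd.2 fun he => ?_
      exact not_conflict_of_le (pos_of_mem_range (Y := {m'.nat 20 0}) (by simpa using hlt) rfl)
        he.ge hlt hc
    refine and_congr_right fun _ => not_congr ⟨fun hh => ⟨(hmem hh.2).1 hh.1, hh.2⟩,
      fun hh => ⟨(hmem hh.2).2 hh.1, hh.2⟩⟩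

theorem AtGuess.run_purgeProg {W W' : Set ℕ} {dg : ℕ → ℕ} {m : Store}
    (h : AtGuess R G k W dg m) (hW' : ∀ y < n * k, m.nat 23 y = 1 ↔ y ∈ W') {y : ℕ}
    (hy : y < n * k) :
    ((purgeProg H).run m).nat 24 y = 1 ↔ y ∈ purge G H W' (dg 1) := by
  classical
  have := (run_fillCount (y := 20) (v := 3) (z := 21) (w := 3) (cnt := 22) (arr := 24) (base := 0)
    (addr := .var 20) (m := m)
    (c := .and (bitTest 23 (.var 20)) (.not (.lt (.var 101) (.var 22))))
    (d := .and (bitTest 23 (.var 21)) (conflictTest H (.var 20) (.var 21)))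
    (by simp) (by simp) (by simp) (by simp) (by simp) (by simp) (by simp)
    (fun y => y ∈ purge G H W' (dg 1)) (fun y z => z ∈ W' ∧ Conflict G H y z)
    ?_ ?_ ?_).1 y (by rwa [h.static.items])
  · rwa [zero_add] at this
  · intro m' hag hlt _ hlt'
    have h' := h.of_agree hag (by decide)
    rw [h.static.items] at hlt hlt'
    simp only [Cond.Holds]
    rw [h'.static.holds_conflictTest (x := .var 20) (y := .var 21) hlt.le hlt']
    simp only [NExp.eval]
    rw [hag.1 23 (by simp), hW' _ hlt']
  · intro m' _ _
    simp [NExp.eval]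
  · intro m' hag hlt hcnt
    have h' := h.of_agree hag (by decide)
    rw [h.static.items] at hlt hcnt
    simp only [Cond.Holds, NExp.eval]
    rw [hcnt, hag.1 23 (by simp), hW' _ hlt, (h'.digits 1 (by omega)).1, not_lt]
    exact and_congr_right fun _ =>
      ⟨fun hh => le_of_eq_of_le (by congr) hh, fun hh => le_of_eq_of_le (by congr) hh⟩

theorem AtGuess.run_splitProg {W W' : Set ℕ} {dg : ℕ → ℕ} {m : Store}
    (h : AtGuess R G k W dg m) (hlt' : ∀ y ∈ W', y < n * k)
    (hW' : ∀ y < n * k, m.nat 24 y = 1 ↔ y ∈ W') {y : ℕ} (hy : y < n * k) :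
    ((splitProg R H).run m).nat 25 y = 1 ↔ y ∈ split G H W' (dg 2) (Marked R G H dg) := by
  classical
  have := (run_fillCount (y := 20) (v := 3) (z := 21) (w := 3) (cnt := 22) (arr := 25) (base := 0)
    (addr := .var 20) (m := m)
    (c := .and (bitTest 24 (.var 20))
      (.or (.and (linkedTest (.var 102) (.var 20)) (.eq (.var 22) (.const 0)))
        (.and (.not (linkedTest (.var 102) (.var 20))) (.not (markedTest R H (.var 20))))))
    (d := .and (bitTest 24 (.var 21)) (.and (.not (linkedTest (.var 102) (.var 21)))
      (.and (conflictTest H (.var 20) (.var 21)) (.not (markedTest R H (.var 21))))))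
    (by simp) (by simp) (by simp) (by simp) (by simp) (by simp) (by simp)
    (fun y => y ∈ split G H W' (dg 2) (Marked R G H dg))
    (fun y z => z ∈ W' ∧ ¬ Linked k G (dg 2) z ∧ Conflict G H y z ∧ ¬ Marked R G H dg z)
    ?_ ?_ ?_).1 y (by rwa [h.static.items])
  · rwa [zero_add] at this
  · intro m' hag hlt _ hltz
    have h' := h.of_agree hag (by decide)
    rw [h.static.items] at hlt hltz
    have hd := h'.digits 2 (by omega)
    have hu : (NExp.var 102).eval m' = dg 2 := hd.1
    simp only [Cond.Holds]
    rw [h'.static.holds_conflictTest (x := .var 20) (y := .var 21) hlt.le hltz,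
      h'.static.holds_linkedTest (x := .var 102) (y := .var 21) (hu ▸ hd.2) hltz,
      h'.static.holds_markedTest h'.digits (y := .var 21) hltz, hu]
    simp only [NExp.eval]
    rw [hag.1 24 (by simp), hW' _ hltz]
  · intro m' _ _
    simp [NExp.eval]
  · intro m' hag hlt hcnt
    have h' := h.of_agree hag (by decide)
    rw [h.static.items] at hlt hcnt
    have hd := h'.digits 2 (by omega)
    have hu : (NExp.var 102).eval m' = dg 2 := hd.1
    simp only [Cond.Holds, Cond.holds_or]
    rw [h'.static.holds_linkedTest (x := .var 102) (y := .var 20) (hu ▸ hd.2) hlt,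
      h'.static.holds_markedTest h'.digits (y := .var 20) hlt, hu]
    simp only [NExp.eval]
    rw [hcnt, hag.1 24 (by simp), hW' _ hlt, card_filter_range_eq_zero]
    -- The counter holds the number of unmarked conflicts on the other side; it vanishes exactly if
    -- all those conflicts are marked.
    refine and_congr_right fun _ => or_congr_left (and_congr_right fun _ => ?_)
    constructor
    · intro hall z hz huz hc
      by_contra hm
      exact hall z (hlt' z hz) ⟨hz, huz, hc, hm⟩
    · rintro hall z - ⟨hz, huz, hc, hm⟩
      exact hm (hall z hz huz hc)

variable (R H) in
/-- The computation of the core of a guess. -/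
noncomputable def coreProg : LoopProg := .seq (paintProg H) (.seq (purgeProg H) (splitProg R H))

theorem agree_coreProg (m : Store) :
    Agree [20, 21, 22, 23, 24, 25] [] m ((coreProg R H).run m) :=
  ((agree_paintProg m).mono (by simp) (by simp)).trans
    (((agree_purgeProg _).mono (by simp) (by simp)).trans
      ((agree_splitProg _).mono (by simp) (by simp)))

theorem AtGuess.run_coreProg {W : Set ℕ} {dg : ℕ → ℕ} {m : Store} (h : AtGuess R G k W dg m)
    {y : ℕ} (hy : y < n * k) :
    ((coreProg R H).run m).nat 25 y = 1 ↔ y ∈ core R G H W dg := by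
  have h₁ := h.of_agree (agree_paintProg (H := H) m) (by decide)
  have h₂ := h₁.of_agree (agree_purgeProg (H := H) _) (by decide)
  refine h₂.run_splitProg (fun y hy => h.lt y hy.1.1) (fun z hz => ?_) hy
  exact h₁.run_purgeProg (fun x hx => h.run_paintProg hx) hz

end ColoringSearch

/-! ### Components of the core by label propagation. -/

namespace ColoringSearch

open RAM RAM.LoopProg

variable {n k : ℕ} {R : ℕ} {G : SimpleGraph (Fin n)} {H : SimpleGraph (Fin k)}

theorem Joined.symm {u x y : ℕ} (h : Joined k G u x y) : Joined k G u y x := ⟨h.1.symm, h.2.symm⟩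

/-- Labels do not change along steps. -/
def StableLabels (k : ℕ) {n : ℕ} (G : SimpleGraph (Fin n)) (C : Set ℕ) (u : ℕ) (L : ℕ → ℕ) : Prop :=
  ∀ y ∈ C, ∀ z ∈ C, Joined k G u y z → L z ≤ L y

/-- Every label of an item is an item that is connected to it. -/
def ReachingLabels (k : ℕ) {n : ℕ} (G : SimpleGraph (Fin n)) (C : Set ℕ) (u : ℕ) (L : ℕ → ℕ) :
    Prop :=
  ∀ y < n * k, L y < n * k ∧ (y ∈ C → L y ∈ C ∧
    Relation.ReflTransGen (fun a b => a ∈ C ∧ b ∈ C ∧ Joined k G u a b) (L y) y)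

/-- Being joined is symmetric, so stability forces equal labels on joined items. Conversely, a label
is itself an item connected to all items that carry it. -/
theorem isLabelling_of_stable {C : Set ℕ} {u : ℕ} {L : ℕ → ℕ} (hC : ∀ y ∈ C, y < n * k)
    (hs : StableLabels k G C u L) (hr : ReachingLabels k G C u L) : IsLabelling k G C u L := by
  refine ⟨fun y hy => (hr y (hC y hy)).1, fun y hy z hz h =>
    le_antisymm (hs z hz y hy h.symm) (hs y hy z hz h), fun y hy z hz h => ?_⟩
  have h1 := ((hr y (hC y hy)).2 hy).2
  have h2 := ((hr z (hC z hz)).2 hz).2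
  have hsymm : Std.Symm fun a b => a ∈ C ∧ b ∈ C ∧ Joined k G u a b :=
    ⟨fun a b h => ⟨h.2.1, h.1, h.2.2.symm⟩⟩
  exact (Relation.ReflTransGen.stdSymm.symm _ _ h1).trans (h ▸ h2)

/-- The state of a round of label propagation that started with the labels `L₀`, when the pairs
with `done` have been processed. -/
structure RoundInv (k : ℕ) {n : ℕ} (G : SimpleGraph (Fin n)) (C : Set ℕ) (u : ℕ) (L₀ : ℕ → ℕ)
    (done : ℕ → ℕ → Prop) (L : ℕ → ℕ) : Prop where
  le : ∀ y < n * k, L y ≤ L₀ y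
  step : ∀ y ∈ C, ∀ z ∈ C, done y z → Joined k G u y z → L z ≤ L₀ y
  stable : StableLabels k G C u L₀ → ∀ y < n * k, L y = L₀ y
  reaching : ReachingLabels k G C u L

theorem RoundInv.mono {C : Set ℕ} {u : ℕ} {L₀ L : ℕ → ℕ} {done done' : ℕ → ℕ → Prop}
    (h : RoundInv k G C u L₀ done L) (hd : ∀ y z, y < n * k → z < n * k → done' y z → done y z)
    (hC : ∀ y ∈ C, y < n * k) : RoundInv k G C u L₀ done' L :=
  ⟨h.le, fun y hy z hz hyz => h.step y hy z hz (hd y z (hC y hy) (hC z hz) hyz), h.stable,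
    h.reaching⟩

/-- Processed pairs are compared with the label `L₀ y` from the start of the round: the current
label of `y` may still drop after the pair has been processed, whereas lowering labels cannot spoil
a bound by `L₀ y`. -/
theorem RoundInv.next {C : Set ℕ} (hC : ∀ y ∈ C, y < n * k) {u : ℕ} {L₀ L : ℕ → ℕ}
    {done : ℕ → ℕ → Prop} (h : RoundInv k G C u L₀ done L) {y z : ℕ} {L' : ℕ → ℕ}
    (hpos : y ∈ C → z ∈ C → Joined k G u y z → L y < L z → L' = Function.update L z (L y))
    (hneg : ¬ (y ∈ C ∧ z ∈ C ∧ Joined k G u y z ∧ L y < L z) → L' = L) :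
    RoundInv k G C u L₀ (fun y' z' => done y' z' ∨ (y' = y ∧ z' = z)) L' := by
  by_cases hc : y ∈ C ∧ z ∈ C ∧ Joined k G u y z ∧ L y < L z
  · obtain ⟨hy, hz, hj, hlt⟩ := hc
    rw [hpos hy hz hj hlt]
    have hle : ∀ x, Function.update L z (L y) x ≤ L x := by
      intro x
      by_cases hx : x = z
      · subst hx
        simpa using hlt.le
      · simp [hx]
    refine ⟨fun x hx => (hle x).trans (h.le x hx), ?_, ?_, ?_⟩
    · rintro y' hy' z' hz' (hd | ⟨rfl, rfl⟩) hj'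
      · exact (hle z').trans (h.step y' hy' z' hz' hd hj')
      · simpa using h.le y' (hC y' hy')
    · intro hs
      have h1 := h.stable hs
      rw [h1 y (hC y hy), h1 z (hC z hz)] at hlt
      exact absurd (hs y hy z hz hj) (not_le.2 hlt)
    · intro x hx
      by_cases hxz : x = z
      · subst hxz
        simp only [Function.update_self]
        obtain ⟨h1, h2⟩ := h.reaching y (hC y hy)
        exact ⟨h1, fun _ => ⟨(h2 hy).1, (h2 hy).2.tail ⟨hy, hz, hj⟩⟩⟩
      · simpa [hxz] using h.reaching x hx
  · rw [hneg hc]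
    refine ⟨h.le, ?_, h.stable, h.reaching⟩
    rintro y' hy' z' hz' (hd | ⟨rfl, rfl⟩) hj'
    · exact h.step y' hy' z' hz' hd hj'
    · have : ¬ L y' < L z' := fun hlt => hc ⟨hy', hz', hj', hlt⟩
      exact (not_lt.1 this).trans (h.le y' (hC y' hy'))

/-- The measure of progress of label propagation. -/
theorem RoundInv.stable_or_sum_lt {C : Set ℕ} (hC : ∀ y ∈ C, y < n * k) {u : ℕ} {L₀ L : ℕ → ℕ}
    (h : RoundInv k G C u L₀ (fun _ _ => True) L) {j M : ℕ}
    (h₀ : StableLabels k G C u L₀ ∨ ∑ y ∈ Finset.range (n * k), L₀ y + j ≤ M) :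
    StableLabels k G C u L ∨ ∑ y ∈ Finset.range (n * k), L y + (j + 1) ≤ M := by
  by_cases hs : StableLabels k G C u L₀
  · left
    intro y hy z hz hj
    rw [h.stable hs y (hC y hy), h.stable hs z (hC z hz)]
    exact hs y hy z hz hj
  · right
    have hsum := h₀.resolve_left hs
    simp only [StableLabels] at hs
    push Not at hs
    obtain ⟨y, hy, z, hz, hj, hlt⟩ := hs
    have : ∑ y ∈ Finset.range (n * k), L y < ∑ y ∈ Finset.range (n * k), L₀ y :=
      Finset.sum_lt_sum (fun x hx => h.le x (Finset.mem_range.1 hx))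
        ⟨z, Finset.mem_range.2 (hC z hz), (h.step y hy z hz trivial hj).trans_lt hlt⟩
    omega

/-- The test whether the label of one item can be passed on to another. -/
def passTest : Cond :=
  .and (bitTest 25 (.var 20)) (.and (bitTest 25 (.var 21))
    (.and (.or (sameTest (.var 20) (.var 21)) (linkedTest (.var 20) (.var 21)))
      (.and (.or (.and (linkedTest (.var 102) (.var 20)) (linkedTest (.var 102) (.var 21)))
          (.and (.not (linkedTest (.var 102) (.var 20))) (.not (linkedTest (.var 102) (.var 21)))))
        (.lt (.get 26 (.var 20)) (.get 26 (.var 21))))))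

/-- One round of label propagation. -/
def roundProg : LoopProg :=
  .loop 20 3 (.loop 21 3 (.ite passTest (.setNat 26 (.var 21) (.get 26 (.var 20))) .skip))

/-- Label propagation. -/
def labelProg : LoopProg :=
  .seq (.loop 20 3 (.setNat 26 (.var 20) (.var 20))) (.loop 27 3 (.loop 31 3 roundProg))

theorem agree_labelProg (m : Store) : Agree [20, 21, 26, 27, 31] [] m (labelProg.run m) :=
  (agree_run _ m).mono (by simp [labelProg, roundProg, writes])
    (by simp [labelProg, roundProg, writesReal])

theorem AtGuess.holds_passTest {W C : Set ℕ} {dg : ℕ → ℕ} {m : Store} (h : AtGuess R G k W dg m)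
    (hC : ∀ y < n * k, m.nat 25 y = 1 ↔ y ∈ C) (hy : m.nat 20 0 < n * k) (hz : m.nat 21 0 < n * k) :
    passTest.Holds m ↔ m.nat 20 0 ∈ C ∧ m.nat 21 0 ∈ C ∧
      Joined k G (dg 2) (m.nat 20 0) (m.nat 21 0) ∧
        m.nat 26 (m.nat 20 0) < m.nat 26 (m.nat 21 0) := by
  have hd := h.digits 2 (by omega)
  have hu : (NExp.var 102).eval m = dg 2 := hd.1
  simp only [passTest, Cond.Holds, Cond.holds_or]
  rw [h.static.holds_sameTest (x := .var 20) (y := .var 21) hy.le hz.le,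
    h.static.holds_linkedTest (x := .var 20) (y := .var 21) hy.le hz,
    h.static.holds_linkedTest (x := .var 102) (y := .var 20) (hu ▸ hd.2) hy,
    h.static.holds_linkedTest (x := .var 102) (y := .var 21) (hu ▸ hd.2) hz, hu]
  simp only [NExp.eval]
  rw [hC _ hy, hC _ hz, Joined, Near]
  tauto

theorem AtGuess.run_roundProg {W C : Set ℕ} {dg : ℕ → ℕ} {m : Store} (h : AtGuess R G k W dg m)
    (hCn : ∀ y ∈ C, y < n * k) (hC : ∀ y < n * k, m.nat 25 y = 1 ↔ y ∈ C)
    (hr : ReachingLabels k G C (dg 2) (m.nat 26)) :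
    RoundInv k G C (dg 2) (m.nat 26) (fun _ _ => True) ((roundProg.run m).nat 26) := by
  have houter := run_loop_induction (x := 20) (v := 3) (m := m)
    (p := .loop 21 3 (.ite passTest (.setNat 26 (.var 21) (.get 26 (.var 20))) .skip))
    (fun i m' => RoundInv k G C (dg 2) (m.nat 26) (fun y _ => y < i) (m'.nat 26)) ?_ ?_
  · rw [h.static.items] at houter
    exact houter.mono (fun y z hy _ _ => hy) hCn
  · rw [Store.writeNat_nat_of_ne _ _ _ (by simp)]
    exact ⟨fun _ _ => le_rfl, fun _ _ _ _ h => absurd h (by omega), fun _ _ _ => rfl, hr⟩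
  · intro i hi m' hag hx hinv
    have hag' : Agree [20, 21, 26] [] m m' := hag.mono (by simp [writes]) (by simp [writesReal])
    have h3 : m'.nat 3 0 = n * k := by rw [hag'.1 3 (by simp), h.static.items]
    rw [h.static.items] at hi
    have hinner := run_loop_induction (x := 21) (v := 3) (m := m')
      (p := .ite passTest (.setNat 26 (.var 21) (.get 26 (.var 20))) .skip)
      (fun j m'' => RoundInv k G C (dg 2) (m.nat 26) (fun y z => y < i ∨ (y = i ∧ z < j))
        (m''.nat 26)) ?_ ?_
    · rw [Store.writeNat_nat_of_ne _ _ _ (by simp)]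
      rw [h3] at hinner
      exact hinner.mono (fun y z _ hz hy => by omega) hCn
    · rw [Store.writeNat_nat_of_ne _ _ _ (by simp)]
      exact hinv.mono (fun y z _ _ hy => by omega) hCn
    · intro j hj m'' hag2 hx2 hinv2
      rw [h3] at hj
      have hag2' : Agree [21, 26] [] m' m'' := hag2.mono (by simp [writes]) (by simp [writesReal])
      have hag3 : Agree [20, 21, 26] [] m m'' := hag'.trans (hag2'.mono (by simp) (by simp))
      have h'' := h.of_agree hag3 (by decide)
      have hy20 : m''.nat 20 0 = i := by rw [hag2'.1 20 (by simp), hx]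
      have hpass := h''.holds_passTest (C := C) (by rwa [hag3.1 25 (by simp)])
        (hy20 ▸ hi) (hx2 ▸ hj)
      rw [hy20, hx2] at hpass
      rw [Store.writeNat_nat_of_ne _ _ _ (by simp)]
      refine (hinv2.next hCn (y := i) (z := j) ?_ ?_).mono (fun y z _ _ hyz => ?_) hCn
      · intro hyC hzC hjn hlt
        rw [run, if_pos (hpass.2 ⟨hyC, hzC, hjn, hlt⟩)]
        simp [run, NExp.eval, hy20, hx2]
      · intro hno
        rw [run, if_neg fun hh => hno (hpass.1 hh)]
        rfl
      · omega

/-- The labels start with a sum of at most N², where N = `n * k`, and every round that starts from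
unstable labels lowers the sum. Hence N² rounds suffice; they are produced by two nested loops of N
rounds each. -/
theorem AtGuess.run_labelProg {W C : Set ℕ} {dg : ℕ → ℕ} {m : Store} (h : AtGuess R G k W dg m)
    (hCn : ∀ y ∈ C, y < n * k) (hC : ∀ y < n * k, m.nat 25 y = 1 ↔ y ∈ C) :
    IsLabelling k G C (dg 2) ((labelProg.run m).nat 26) := by
  set m₁ := (LoopProg.loop 20 3 (.setNat 26 (.var 20) (.var 20))).run m with hm₁
  have hag₁ : Agree [20, 26] [] m m₁ :=
    (agree_run _ m).mono (by simp [writes]) (by simp [writesReal])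
  have h₁ : AtGuess R G k W dg m₁ := h.of_agree hag₁ (by decide)
  have hinit : ∀ y < n * k, m₁.nat 26 y = y := by
    have := run_loop_induction (x := 20) (v := 3) (m := m)
      (p := .setNat 26 (.var 20) (.var 20)) (fun i m' => ∀ y < i, m'.nat 26 y = y)
      (fun y hy => absurd hy (by omega)) ?_
    · rwa [h.static.items] at this
    · intro i _ m' _ hx hinv y hy
      rw [Store.writeNat_nat_of_ne _ _ _ (by simp)]
      simp only [run, NExp.eval, hx, Store.writeNat_nat_self]
      by_cases hyi : y = i
      · simp [hyi]
      · rw [Function.update_of_ne hyi]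
        exact hinv y (by omega)
  have hr₁ : ReachingLabels k G C (dg 2) (m₁.nat 26) := fun y hy => by
    rw [hinit y hy]
    exact ⟨hy, fun hyC => ⟨hyC, .refl⟩⟩
  have hsum₁ : ∑ y ∈ Finset.range (n * k), m₁.nat 26 y ≤ (n * k) * (n * k) := by
    refine (Finset.sum_le_card_nsmul _ _ (n * k) fun y hy => ?_).trans (by simp)
    rw [hinit y (Finset.mem_range.1 hy)]
    exact (Finset.mem_range.1 hy).le
  have hC₁ : ∀ y < n * k, m₁.nat 25 y = 1 ↔ y ∈ C := by rwa [hag₁.1 25 (by simp)]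
  have houter := run_loop_induction (x := 27) (v := 3) (m := m₁) (p := .loop 31 3 roundProg)
    (fun i m' => (StableLabels k G C (dg 2) (m'.nat 26) ∨
      ∑ y ∈ Finset.range (n * k), m'.nat 26 y + i * (n * k) ≤ (n * k) * (n * k)) ∧
      ReachingLabels k G C (dg 2) (m'.nat 26)) ?_ ?_
  · obtain ⟨hs, hr⟩ := houter
    rw [h₁.static.items] at hs
    refine isLabelling_of_stable hCn (hs.elim id fun hle => ?_) hr
    -- If stability was never reported, the N² rounds have used up the whole sum; then all labels
    -- are 0, which is stable as well.
    have h0 : ∑ y ∈ Finset.range (n * k),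
        ((LoopProg.loop 27 3 (.loop 31 3 roundProg)).run m₁).nat 26 y = 0 := by omega
    intro y hy z hz _
    rw [Finset.sum_eq_zero_iff] at h0
    have : (labelProg.run m).nat 26 z = 0 := h0 z (Finset.mem_range.2 (hCn z hz))
    exact this.le.trans (Nat.zero_le _)
  · rw [Store.writeNat_nat_of_ne _ _ _ (by simp)]
    exact ⟨Or.inr (by simpa using hsum₁), hr₁⟩
  · intro i hi m' hag hx hinv
    have hag' : Agree [20, 21, 26, 27, 31] [] m₁ m' :=
      hag.mono (by simp [roundProg, writes]) (by simp [roundProg, writesReal])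
    have h3 : m'.nat 3 0 = n * k := by rw [hag'.1 3 (by simp), h₁.static.items]
    have hinner := run_loop_induction (x := 31) (v := 3) (m := m') (p := roundProg)
      (fun j m'' => (StableLabels k G C (dg 2) (m''.nat 26) ∨
        ∑ y ∈ Finset.range (n * k), m''.nat 26 y + (i * (n * k) + j) ≤ (n * k) * (n * k)) ∧
        ReachingLabels k G C (dg 2) (m''.nat 26)) ?_ ?_
    · rw [Store.writeNat_nat_of_ne _ _ _ (by simp), add_mul, one_mul]
      rwa [h3] at hinner
    · rw [Store.writeNat_nat_of_ne _ _ _ (by simp)]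
      exact hinv
    · intro j _ m'' hag2 _ hinv2
      have hag2' : Agree [20, 21, 26, 27, 31] [] m₁ m'' := hag'.trans
        (hag2.mono (by simp [roundProg, writes]) (by simp [roundProg, writesReal]))
      rw [Store.writeNat_nat_of_ne _ _ _ (by simp)]
      have hround := (h₁.of_agree hag2' (by decide)).run_roundProg hCn
        (by rwa [hag2'.1 25 (by simp)]) hinv2.2
      exact ⟨hround.stable_or_sum_lt hCn hinv2.1, hround.reaching⟩

end ColoringSearch

/-! ## Processing a node -/

namespace ColoringSearch

open RAM RAM.LoopProg

variable {n k : ℕ} {R : ℕ} {G : SimpleGraph (Fin n)} {H : SimpleGraph (Fin k)}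

/-- The set that is stored for the node `j` in the array `arr`. -/
def nodeSet (arr N : ℕ) (m : Store) (j : ℕ) : Set ℕ := {y | y < N ∧ m.nat arr (N * j + y) = 1}

theorem mem_nodeSet {arr N j y : ℕ} {m : Store} :
    y ∈ nodeSet arr N m j ↔ y < N ∧ m.nat arr (N * j + y) = 1 := Iff.rfl

theorem nodeSet_congr {arr N j : ℕ} {m m' : Store}
    (h : ∀ y < N, m'.nat arr (N * j + y) = m.nat arr (N * j + y)) :
    nodeSet arr N m' j = nodeSet arr N m j := by
  ext y
  simp only [mem_nodeSet]
  exact and_congr_right fun hy => by rw [h y hy]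

theorem nodeSet_eq_of_lt {arr N c j : ℕ} {m m' : Store}
    (h : ∀ a < N * c, m'.nat arr a = m.nat arr a) (hj : j < c) :
    nodeSet arr N m' j = nodeSet arr N m j := by
  refine nodeSet_congr fun y hy => h _ ?_
  have : N * (j + 1) ≤ N * c := Nat.mul_le_mul_left _ hj
  rw [mul_add] at this
  omega

/-- The offsets of the nodes below `c` have been computed. -/
def Offsets (N c : ℕ) (m : Store) : Prop := ∀ j < c, m.nat 15 j = N * j

/-- Storing the set of one child. -/
def childProg : LoopProg :=
  .seq (.setNat 15 (.var 16) (.add (.get 15 (.sub (.var 16) (.const 1))) (.var 3)))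
    (.seq (.loop 20 3 (setTest 13 (.add (.get 15 (.var 16)) (.var 20))
        (.and (bitTest 25 (.var 20)) (.eq (.get 26 (.var 20)) (.var 28)))))
      (.setNat 16 (.const 0) (.add (.var 16) (.const 1))))

/-- Storing the sets of the children for one guess. -/
def childrenProg : LoopProg := .loop 28 3 childProg

/-- Without multiplication, the offset `N * c` is obtained by adding `N` to the offset of the
preceding node, whence the assumption `0 < c`. -/
theorem run_childProg {N c : ℕ} {m : Store} (hN : m.nat 3 0 = N) (hc : m.nat 16 0 = c)
    (hpos : 0 < c) (ho : Offsets N c m) :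
    (childProg.run m).nat 16 0 = c + 1 ∧ Offsets N (c + 1) (childProg.run m) ∧
      (∀ a < N * c, (childProg.run m).nat 13 a = m.nat 13 a) ∧
      ∀ y < N, (childProg.run m).nat 13 (N * c + y) = 1 ↔
        m.nat 25 y = 1 ∧ m.nat 26 y = m.nat 28 0 := by
  set m₁ := (LoopProg.setNat 15 (.var 16)
    (.add (.get 15 (.sub (.var 16) (.const 1))) (.var 3))).run m with hm₁
  have hag₁ : Agree [15] [] m m₁ := agree_writeNat m _ _ _
  have h15 : ∀ j < c + 1, m₁.nat 15 j = N * j := by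
    intro j hj
    simp only [hm₁, run, NExp.eval, hc, hN, Store.writeNat_nat_self]
    by_cases hjc : j = c
    · subst hjc
      rw [Function.update_self, ho _ (by omega)]
      obtain ⟨j, rfl⟩ := Nat.exists_eq_succ_of_ne_zero hpos.ne'
      simp only [Nat.succ_eq_add_one, Nat.add_sub_cancel]
      ring
    · rw [Function.update_of_ne hjc]
      exact ho j (by omega)
  set fill := LoopProg.loop 20 3 (setTest 13 (.add (.get 15 (.var 16)) (.var 20))
        (.and (bitTest 25 (.var 20)) (.eq (.get 26 (.var 20)) (.var 28)))) with hfill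
  have hag₂ : Agree [20, 13] [] m₁ (fill.run m₁) :=
    (agree_run _ _).mono (by simp [hfill, setTest, writes]) (by simp [hfill, setTest, writesReal])
  have h := run_fillTest (y := 20) (v := 3) (arr := 13) (base := N * c)
    (addr := .add (.get 15 (.var 16)) (.var 20))
    (c := .and (bitTest 25 (.var 20)) (.eq (.get 26 (.var 20)) (.var 28))) (m := m₁) (by simp)
    (fun y => m.nat 25 y = 1 ∧ m.nat 26 y = m.nat 28 0) ?_ ?_
  · have hN₁ : m₁.nat 3 0 = N := by rw [hag₁.1 3 (by simp), hN]
    rw [hN₁] at h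
    have hrun : childProg.run m = (fill.run m₁).writeNat 16 0 ((fill.run m₁).nat 16 0 + 1) := rfl
    have h16 : (fill.run m₁).nat 16 0 = c := by
      rw [hag₂.1 16 (by simp), hag₁.1 16 (by simp), hc]
    rw [hrun, h16]
    refine ⟨by simp, fun j hj => ?_, fun a ha => ?_, fun y hy => ?_⟩
    · rw [Store.writeNat_nat_of_ne _ _ _ (by simp), hag₂.1 15 (by simp)]
      exact h15 j hj
    · rw [Store.writeNat_nat_of_ne _ _ _ (by simp), h.2 a (fun j _ => by omega),
        hag₁.1 13 (by simp)]
    · rw [Store.writeNat_nat_of_ne _ _ _ (by simp)]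
      exact h.1 y hy
  · intro m' hag _
    simp only [NExp.eval]
    rw [hag.1 15 (by simp), hag.1 16 (by simp), hag₁.1 16 (by simp), hc, h15 c (by omega)]
  · intro m' hag _
    simp only [Cond.Holds, NExp.eval]
    rw [hag.1 25 (by simp), hag.1 26 (by simp), hag.1 28 (by simp), hag₁.1 25 (by simp),
      hag₁.1 26 (by simp), hag₁.1 28 (by simp)]

theorem run_childrenProg {N c : ℕ} {m : Store} (hN : m.nat 3 0 = N) (hc : m.nat 16 0 = c)
    (hpos : 0 < c) (ho : Offsets N c m) :
    (childrenProg.run m).nat 16 0 = c + N ∧ Offsets N (c + N) (childrenProg.run m) ∧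
      (∀ a < N * c, (childrenProg.run m).nat 13 a = m.nat 13 a) ∧
      ∀ p < N, ∀ y < N, (childrenProg.run m).nat 13 (N * (c + p) + y) = 1 ↔
        m.nat 25 y = 1 ∧ m.nat 26 y = p := by
  have h := run_loop_induction (x := 28) (v := 3) (p := childProg) (m := m)
    (fun i m' => m'.nat 16 0 = c + i ∧ Offsets N (c + i) m' ∧
      (∀ a < N * c, m'.nat 13 a = m.nat 13 a) ∧
      ∀ p < i, ∀ y < N, m'.nat 13 (N * (c + p) + y) = 1 ↔ m.nat 25 y = 1 ∧ m.nat 26 y = p) ?_ ?_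
  · rwa [hN] at h
  · exact ⟨by simpa using hc, fun j hj => by simpa using ho j hj, by simp,
      fun p hp => absurd hp (by omega)⟩
  · intro i hi m' hag hx ⟨h1, h2, h3, h4⟩
    have hag' : Agree [13, 15, 16, 20, 28] [] m m' :=
      hag.mono (by simp [childProg, setTest, writes]) (by simp [childProg, setTest, writesReal])
    obtain ⟨g1, g2, g3, g4⟩ := run_childProg (m := m') (by rw [hag'.1 3 (by simp), hN]) h1
      (by omega) h2
    rw [hag'.1 25 (by simp), hag'.1 26 (by simp), hx] at g4
    refine ⟨by simpa [add_assoc] using g1, fun j hj => ?_, fun a ha => ?_, fun p hp y hy => ?_⟩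
    · rw [Store.writeNat_nat_of_ne _ _ _ (by simp)]
      exact g2 j hj
    · rw [Store.writeNat_nat_of_ne _ _ _ (by simp), g3 a (ha.trans_le
        (Nat.mul_le_mul_left _ (by omega))), h3 a ha]
    · rw [Store.writeNat_nat_of_ne _ _ _ (by simp)]
      rcases Nat.lt_succ_iff_lt_or_eq.1 hp with hp | rfl
      · rw [g3 _ ?_]
        · exact h4 p hp y hy
        · have : N * (c + p + 1) ≤ N * (c + i) := Nat.mul_le_mul_left _ (by omega)
          rw [mul_add _ (c + p)] at this
          omega
      · exact g4 y hy

variable (R H) in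
/-- The expansion of a node for one guess. -/
noncomputable def guessProg : LoopProg := .seq (coreProg R H) (.seq labelProg childrenProg)

variable (R H) in
/-- The expansion of a node. -/
noncomputable def expandProg : LoopProg :=
  .seq (.setNat 34 (.var 17) (.var 16)) (nest 100 4 (R + 3) (guessProg R H))

theorem writes_guessProg : (guessProg R H).writes =
    [20, 23, 23, 20, 22, 21, 22, 24, 24, 20, 22, 21, 22, 25, 25, 20, 26, 27, 31, 20, 21, 26, 28,
      15, 20, 13, 13, 16] := rfl

theorem writes_guessProg_subset :
    (guessProg R H).writes ⊆ [13, 15, 16, 20, 21, 22, 23, 24, 25, 26, 27, 28, 31] := by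
  rw [writes_guessProg]
  decide

/-- All children of node `i` have numbers below `branching R (n * k) * (i + 1) + 1`, so sets stored
from there on do not matter. -/
theorem Expanded.congr {W W' : ℕ → Set ℕ} {i c : ℕ} (h : Expanded R G H W i)
    (hc : branching R (n * k) * (i + 1) + 1 ≤ c) (hi : i < c) (hW : ∀ j < c, W' j = W j) :
    Expanded R G H W' i := by
  intro ρ hρ
  obtain ⟨lab, h1, h2⟩ := h ρ hρ
  rw [hW i hi]
  refine ⟨lab, h1, fun p hp => ?_⟩
  rw [hW _ ?_, h2 p hp]
  have : (ρ + 1) * (n * k) ≤ (n * k + 1) ^ (R + 3) * (n * k) := Nat.mul_le_mul_right _ hρ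
  have h3 : ρ * (n * k) + p < branching R (n * k) := by rw [branching]; nlinarith
  rw [child]
  rw [mul_add] at hc
  omega

theorem AtGuess.run_guessProg {i c : ℕ} {dg : ℕ → ℕ} {m : Store}
    (hst : Static k G m) (hdg : ∀ j < R + 3, m.nat (100 + j) 0 = dg j ∧ dg j ≤ n * k)
    (hi : m.nat 17 0 = i) (hic : i < c) (hc : m.nat 16 0 = c) (ho : Offsets (n * k) c m) :
    ((guessProg R H).run m).nat 16 0 = c + n * k ∧
      Offsets (n * k) (c + n * k) ((guessProg R H).run m) ∧
      (∀ a < n * k * c, ((guessProg R H).run m).nat 13 a = m.nat 13 a) ∧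
      ∃ lab, IsLabelling k G (core R G H (nodeSet 13 (n * k) m i) dg) (dg 2) lab ∧
        ∀ p < n * k, nodeSet 13 (n * k) ((guessProg R H).run m) (c + p) =
          {y | y ∈ core R G H (nodeSet 13 (n * k) m i) dg ∧ lab y = p} := by
  have h : AtGuess R G k (nodeSet 13 (n * k) m i) dg m :=
    ⟨hst, hdg, fun y hy => hy.1, fun y hy => by
      rw [hi, ho i hic, mem_nodeSet]
      exact (and_iff_right hy).symm⟩
  set C := core R G H (nodeSet 13 (n * k) m i) dg with hCdef
  have hCn : ∀ y ∈ C, y < n * k := fun y hy => h.lt y (core_subset hy)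
  set m₁ := (coreProg R H).run m with hm₁
  have hag₁ : Agree [20, 21, 22, 23, 24, 25] [] m m₁ := agree_coreProg m
  have h₁ : AtGuess R G k (nodeSet 13 (n * k) m i) dg m₁ := h.of_agree hag₁ (by decide)
  have hC₁ : ∀ y < n * k, m₁.nat 25 y = 1 ↔ y ∈ C := fun y hy => h.run_coreProg hy
  have hlab := h₁.run_labelProg hCn hC₁
  set m₂ := labelProg.run m₁ with hm₂
  have hag₂ : Agree [20, 21, 26, 27, 31] [] m₁ m₂ := agree_labelProg m₁
  have hag : Agree [20, 21, 22, 23, 24, 25, 26, 27, 31] [] m m₂ :=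
    (hag₁.mono (by simp) (by simp)).trans (hag₂.mono (by simp) (by simp))
  obtain ⟨g1, g2, g3, g4⟩ := run_childrenProg (N := n * k) (c := c) (m := m₂)
    (by rw [hag.1 3 (by simp), hst.items]) (by rw [hag.1 16 (by simp), hc]) (by omega)
    (fun j hj => by rw [hag.1 15 (by simp)]; exact ho j hj)
  rw [hag.1 13 (by simp)] at g3
  refine ⟨g1, g2, g3, _, hlab, fun p hp => ?_⟩
  ext y
  rw [mem_nodeSet]
  constructor
  · rintro ⟨hy, h1⟩
    have := (g4 p hp y hy).1 h1
    rw [hag₂.1 25 (by simp), hC₁ y hy] at this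
    exact this
  · rintro ⟨hy, h1⟩
    refine ⟨hCn y hy, (g4 p hp y (hCn y hy)).2 ?_⟩
    rw [hag₂.1 25 (by simp), hC₁ y (hCn y hy)]
    exact ⟨hy, h1⟩

theorem notMem_writes_expandProg {a : ℕ} (ha : a < 100)
    (h : a ∉ [13, 15, 16, 20, 21, 22, 23, 24, 25, 26, 27, 28, 31, 34]) :
    a ∉ (expandProg R H).writes := by
  simp only [expandProg, writes, List.mem_append, mem_writes_nest]
  rintro (h1 | h1 | h1)
  · exact h (by simp at h1; simp [h1])
  · have := writes_guessProg_subset h1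
    refine h ?_
    simp only [List.mem_cons, List.not_mem_nil, or_false] at this ⊢
    tauto
  · omega

/-- Guesses come in the order of `ρ`, and each appends exactly N = `n * k` children, possibly empty
ones. So the pointer to the next child always agrees with the numbering by `child`. -/
theorem run_expandProg {i : ℕ} {m : Store} (hst : Static k G m) (hi : m.nat 17 0 = i)
    (hic : i < branching R (n * k) * i + 1) (hc : m.nat 16 0 = branching R (n * k) * i + 1)
    (ho : Offsets (n * k) (branching R (n * k) * i + 1) m) :
    ((expandProg R H).run m).nat 16 0 = branching R (n * k) * (i + 1) + 1 ∧
      Offsets (n * k) (branching R (n * k) * (i + 1) + 1) ((expandProg R H).run m) ∧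
      (∀ a < n * k * (branching R (n * k) * i + 1),
        ((expandProg R H).run m).nat 13 a = m.nat 13 a) ∧
      (∀ j < i, ((expandProg R H).run m).nat 34 j = m.nat 34 j) ∧
      ((expandProg R H).run m).nat 34 i = branching R (n * k) * i + 1 ∧
      Expanded R G H (nodeSet 13 (n * k) ((expandProg R H).run m)) i := by
  set N := n * k with hN
  set B := branching R N with hB
  set m₁ := (LoopProg.setNat 34 (.var 17) (.var 16)).run m with hm₁
  have hag₁ : Agree [34] [] m m₁ := agree_writeNat m _ _ _
  have h34 : m₁.nat 34 = Function.update (m.nat 34) i (B * i + 1) := by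
    simp [hm₁, run, NExp.eval, hi, hc]
  set F := nest 100 4 (R + 3) (guessProg R H) with hF
  have hrun : (expandProg R H).run m = F.run m₁ := rfl
  have hnot : ∀ a < 100, a ∉ [13, 15, 16, 20, 21, 22, 23, 24, 25, 26, 27, 28, 31] →
      a ∉ F.writes := fun a ha hna h => by
    rcases mem_writes_nest.1 h with h | h
    · exact hna (writes_guessProg_subset h)
    · omega
  have hst₁ : Static k G m₁ := hst.of_agree hag₁ (by decide)
  have main := run_nest_induction (a := 100) (v := 4) (p := guessProg R H)
    (fun ρ m' => m'.nat 16 0 = B * i + 1 + ρ * N ∧ Offsets N (B * i + 1 + ρ * N) m' ∧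
      (∀ a < N * (B * i + 1), m'.nat 13 a = m.nat 13 a) ∧
      ∀ ρ' < ρ, ∃ lab,
        IsLabelling k G (core R G H (nodeSet 13 N m i) (digit (N + 1) ρ'))
          (digit (N + 1) ρ' 2) lab ∧
        ∀ p < N, nodeSet 13 N m' (child R N i ρ' p) =
          {y | y ∈ core R G H (nodeSet 13 N m i) (digit (N + 1) ρ') ∧ lab y = p})
    F.writes F.writesReal (R + 3) (N + 1) (fun x hx => mem_writes_nest.2 (Or.inl hx))
    (fun x hx => by rwa [hF, writesReal_nest]) (fun j hj => mem_writes_nest.2 (Or.inr (by omega)))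
    (fun j hj h => by
      have := writes_guessProg_subset h
      simp at this
      omega)
    (hnot 4 (by simp) (by simp)) (Nat.succ_pos _) ?_ m₁ hst₁.base ?_ ?_
  · obtain ⟨g1, g2, g3, g4⟩ := main
    have hBN : (N + 1) ^ (R + 3) * N = B := rfl
    rw [hBN, show B * i + 1 + B = B * (i + 1) + 1 by ring] at g1 g2
    rw [hrun]
    have h34' : (F.run m₁).nat 34 = m₁.nat 34 := run_nat _ _ (hnot 34 (by simp) (by simp))
    refine ⟨g1, g2, g3, fun j hj => ?_, ?_, ?_⟩
    · rw [h34', h34, Function.update_of_ne hj.ne]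
    · rw [h34', h34, Function.update_self]
    · intro ρ hρ
      rw [nodeSet_eq_of_lt g3 hic]
      exact g4 ρ hρ
  · rintro c m' j x hj ⟨g1, g2, g3, g4⟩
    refine ⟨?_, fun j' hj' => ?_, fun a ha => ?_, fun ρ' hρ' => ?_⟩
    · rw [Store.writeNat_nat_of_ne _ _ _ (by omega)]
      exact g1
    · rw [Store.writeNat_nat_of_ne _ _ _ (by omega)]
      exact g2 j' hj'
    · rw [Store.writeNat_nat_of_ne _ _ _ (by omega)]
      exact g3 a ha
    · obtain ⟨lab, hl, hch⟩ := g4 ρ' hρ'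
      refine ⟨lab, hl, fun p hp => ?_⟩
      rw [← hch p hp]
      exact nodeSet_congr fun y _ => by rw [Store.writeNat_nat_of_ne _ _ _ (by omega)]
  · rintro ρ hρ m' hag hd ⟨g1, g2, g3, g4⟩
    have hst' : Static k G m' := hst₁.of_agree hag fun a ha => hnot a (by
      simp only [List.mem_cons, List.not_mem_nil, or_false] at ha; omega) (by
      simp only [List.mem_cons, List.not_mem_nil, or_false] at ha ⊢; omega)
    have hdle : ∀ j, digit (N + 1) ρ j ≤ N := fun j =>
      Nat.lt_succ_iff.1 (Nat.mod_lt _ (Nat.succ_pos _))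
    obtain ⟨f1, f2, f3, lab, f4, f5⟩ := AtGuess.run_guessProg (R := R) (H := H) (i := i)
      (dg := digit (N + 1) ρ) hst'
      (fun j hj => ⟨hd j hj, hdle j⟩)
      (by rw [hag.1 17 (hnot 17 (by simp) (by simp)), hag₁.1 17 (by simp), hi]) (by omega) g1 g2
    rw [nodeSet_eq_of_lt g3 hic] at f4 f5
    rw [show B * i + 1 + ρ * N + n * k = B * i + 1 + (ρ + 1) * N by rw [← hN]; ring] at f1 f2
    refine ⟨f1, f2, fun a ha => ?_, fun ρ' hρ' => ?_⟩
    · rw [f3 a (ha.trans_le (Nat.mul_le_mul_left _ (by omega))), g3 a ha]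
    · rcases Nat.lt_succ_iff_lt_or_eq.1 hρ' with hlt | rfl
      · obtain ⟨lab', hl', hch'⟩ := g4 ρ' hlt
        refine ⟨lab', hl', fun p hp => ?_⟩
        rw [← hch' p hp]
        refine nodeSet_eq_of_lt f3 ?_
        have : (ρ' + 1) * N ≤ ρ * N := Nat.mul_le_mul_right _ hlt
        rw [child, ← hB]
        nlinarith
      · refine ⟨lab, f4, fun p hp => ?_⟩
        have := f5 p hp
        rw [add_assoc] at this
        exact this
  · refine ⟨?_, fun j hj => ?_, fun a ha => ?_, fun ρ' hρ' => absurd hρ' (by omega)⟩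
    · rw [hag₁.1 16 (by simp), hc, zero_mul, add_zero]
    · rw [hag₁.1 15 (by simp)]
      exact ho j (by simpa using hj)
    · rw [hag₁.1 13 (by simp)]

end ColoringSearch

/-! ## Combining the values of the children -/

namespace ColoringSearch

open RAM RAM.LoopProg

variable {n k : ℕ} {R : ℕ} {G : SimpleGraph (Fin n)} {H : SimpleGraph (Fin k)}

/-- The computation of the value of a guess. -/
def valueProg : LoopProg :=
  .seq (setTest 32 (.const 0) (.and (.lt (.var 100) (.var 3)) (memTest (.var 100))))
    (.seq (.ite (bitTest 32 (.const 0)) (.setReal 2 (.const 0) (.get 0 (.var 100)))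
        (.setReal 2 (.const 0) .zero))
      (.loop 28 3 (.setReal 2 (.const 0)
        (.add (.get 2 (.const 0)) (.get 1 (.add (.var 16) (.var 28)))))))

/-- The computation of the solution for a guess. -/
def solutionProg : LoopProg :=
  .loop 20 3 (.seq
    (count 22 21 3 (bitTest 14 (.add (.get 15 (.add (.var 16) (.var 21))) (.var 20))))
    (setTest 14 (.add (.get 15 (.var 17)) (.var 20))
      (.or (.and (bitTest 32 (.const 0)) (.eq (.var 20) (.var 100)))
        (.not (.eq (.var 22) (.const 0))))))

/-- The processing of one guess at a node whose children have been processed. -/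
def improveProg : LoopProg :=
  .seq valueProg (.seq
    (.ite (.rlt (.get 1 (.var 17)) (.get 2 (.const 0)))
      (.seq (.setReal 1 (.var 17) (.get 2 (.const 0))) solutionProg) .skip)
    (.setNat 16 (.const 0) (.add (.var 16) (.var 3))))

/-- The processing of a node whose children have been processed. -/
def combineProg (R : ℕ) : LoopProg :=
  .seq (.setNat 16 (.const 0) (.get 34 (.var 17))) (nest 100 4 (R + 3) improveProg)

theorem agree_valueProg (m : Store) : Agree [28, 32] [2] m (valueProg.run m) :=
  (agree_run _ m).mono (by simp [valueProg, setTest, writes])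
    (by simp [valueProg, setTest, writesReal])

theorem agree_solutionProg (m : Store) : Agree [14, 20, 21, 22] [] m (solutionProg.run m) :=
  (agree_run _ m).mono (by simp [solutionProg, count, setTest, writes])
    (by simp [solutionProg, count, setTest, writesReal])

theorem writes_improveProg : improveProg.writes =
    [32, 32, 28, 20, 22, 21, 22, 14, 14, 16] := rfl

theorem writesReal_improveProg : improveProg.writesReal = [2, 2, 2, 1] := rfl

open scoped Classical in
theorem run_valueProg {N i c : ℕ} {m : Store} (hN : m.nat 3 0 = N) (hi : m.nat 17 0 = i)
    (hc : m.nat 16 0 = c) (ho : m.nat 15 i = N * i) :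
    ((valueProg.run m).nat 32 0 = 1 ↔ m.nat 100 0 < N ∧ m.nat 100 0 ∈ nodeSet 13 N m i) ∧
      (valueProg.run m).real 2 0 =
        (if m.nat 100 0 < N ∧ m.nat 100 0 ∈ nodeSet 13 N m i then m.real 0 (m.nat 100 0) else 0) +
          ∑ p ∈ Finset.range N, m.real 1 (c + p) := by
  set t := setTest 32 (.const 0) (.and (.lt (.var 100) (.var 3)) (memTest (.var 100))) with ht
  have hagt : Agree [32] [] m (t.run m) :=
    (agree_run _ m).mono (by simp [ht, setTest, writes]) (by simp [ht, setTest, writesReal])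
  have ht1 : (t.run m).nat 32 0 = 1 ↔ m.nat 100 0 < N ∧ m.nat 100 0 ∈ nodeSet 13 N m i := by
    refine (run_setTest (arr := 32) (i := .const 0)).2.trans ?_
    simp only [Cond.Holds, memTest, NExp.eval, hN, hi, ho, mem_nodeSet]
    tauto
  set m₁ := (LoopProg.ite (bitTest 32 (.const 0)) (.setReal 2 (.const 0) (.get 0 (.var 100)))
        (.setReal 2 (.const 0) .zero)).run (t.run m) with hm₁
  have hag₁ : Agree [] [2] (t.run m) m₁ :=
    (agree_run _ _).mono (by simp [writes]) (by simp [writesReal])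
  have hval : m₁.real 2 0 =
      if m.nat 100 0 < N ∧ m.nat 100 0 ∈ nodeSet 13 N m i then m.real 0 (m.nat 100 0) else 0 := by
    rw [hm₁, run]
    by_cases h : (t.run m).nat 32 0 = 1
    · rw [if_pos (show (bitTest 32 (.const 0)).Holds _ from h), if_pos (ht1.1 h)]
      simp only [run, RExp.eval, NExp.eval, Store.writeReal_real_self, Function.update_self]
      rw [hagt.2 0 (by simp), hagt.1 100 (by simp)]
    · rw [if_neg (show ¬ (bitTest 32 (.const 0)).Holds _ from h), if_neg fun h' => h (ht1.2 h')]
      simp [run, RExp.eval, NExp.eval]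
  have hag : Agree [32] [2] m m₁ :=
    (hagt.mono (by simp) (by simp)).trans (hag₁.mono (by simp) (by simp))
  refine ⟨?_, ?_⟩
  · rw [← ht1]
    have h1 : (valueProg.run m).nat 32 = m₁.nat 32 := run_nat (.loop 28 3 _) _ (by simp [writes])
    rw [h1, hag₁.1 32 (by simp)]
  · have h := run_loop_induction (x := 28) (v := 3) (m := m₁)
      (p := .setReal 2 (.const 0) (.add (.get 2 (.const 0)) (.get 1 (.add (.var 16) (.var 28)))))
      (fun j m' => m'.real 2 0 =
        (if m.nat 100 0 < N ∧ m.nat 100 0 ∈ nodeSet 13 N m i then m.real 0 (m.nat 100 0) else 0) +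
          ∑ p ∈ Finset.range j, m.real 1 (c + p)) (by simpa using hval) ?_
    · rw [hag.1 3 (by simp), hN] at h
      exact h
    · intro j _ m' hag' hx ih
      rw [Finset.sum_range_succ, ← add_assoc, ← ih]
      simp only [run, RExp.eval, NExp.eval, Store.writeNat_real, Store.writeReal_real_self,
        Function.update_self, hx]
      rw [hag'.1 16 (by simp [writes]), hag.1 16 (by simp), hc,
        hag'.2 1 (by simp [writesReal]), hag.2 1 (by simp)]

/-- The loop reads and writes the same array safely: it writes only to the block of node `i`, while
the blocks of the children lie behind it. -/
theorem run_solutionProg {N i c : ℕ} {m : Store} (hN : m.nat 3 0 = N) (hi : m.nat 17 0 = i)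
    (hc : m.nat 16 0 = c) (ho : m.nat 15 i = N * i) (hic : i < c)
    (hoc : ∀ p < N, m.nat 15 (c + p) = N * (c + p)) :
    nodeSet 14 N (solutionProg.run m) i =
      {y | y < N ∧ ((m.nat 32 0 = 1 ∧ y = m.nat 100 0) ∨ ∃ p < N, y ∈ nodeSet 14 N m (c + p))} ∧
    ∀ j ≠ i, nodeSet 14 N (solutionProg.run m) j = nodeSet 14 N m j := by
  have h := run_fillCount (y := 20) (v := 3) (z := 21) (w := 3) (cnt := 22) (arr := 14)
    (base := N * i) (addr := .add (.get 15 (.var 17)) (.var 20)) (m := m)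
    (c := .or (.and (bitTest 32 (.const 0)) (.eq (.var 20) (.var 100)))
      (.not (.eq (.var 22) (.const 0))))
    (d := bitTest 14 (.add (.get 15 (.add (.var 16) (.var 21))) (.var 20)))
    (by simp) (by simp) (by simp) (by simp) (by simp) (by simp) (by simp)
    (fun y => (m.nat 32 0 = 1 ∧ y = m.nat 100 0) ∨ ∃ p < N, y ∈ nodeSet 14 N m (c + p))
    (fun y p => y ∈ nodeSet 14 N m (c + p)) ?_ ?_ ?_
  · rw [hN] at h
    refine ⟨?_, fun j hj => nodeSet_congr fun y hy => h.2 _ fun y' hy' he => hj ?_⟩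
    · ext y
      rw [mem_nodeSet]
      exact and_congr_right fun hy => h.1 y hy
    -- Division by `N` recovers the node from the cell, so blocks of different nodes are disjoint.
    · have h1 : (N * j + y) / N = j := by
        rw [Nat.mul_add_div (by omega), Nat.div_eq_of_lt hy, add_zero]
      have h2 : (N * i + y') / N = i := by
        rw [Nat.mul_add_div (by omega), Nat.div_eq_of_lt hy', add_zero]
      rw [← h1, he, h2]
  · intro m' hag hlt hsame hlt'
    rw [hN] at hlt hlt' hsame
    simp only [Cond.Holds, NExp.eval]
    rw [hag.1 15 (by simp), hag.1 16 (by simp), hc, hoc _ hlt', mem_nodeSet, and_iff_right hlt,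
      hsame]
    intro j hj he
    have h1 : N * (i + 1) ≤ N * (c + m'.nat 21 0) := Nat.mul_le_mul_left _ (by omega)
    rw [mul_add] at h1
    omega
  · intro m' hag _
    simp only [NExp.eval]
    rw [hag.1 15 (by simp), hag.1 17 (by simp), hi, ho]
  · intro m' hag hlt hcnt
    rw [hN] at hlt hcnt
    simp only [Cond.holds_or, Cond.Holds, NExp.eval]
    rw [hcnt, hag.1 32 (by simp), hag.1 100 (by simp), card_filter_range_eq_zero]
    refine or_congr_right ?_
    push Not
    rfl

/-- The solutions that are stored at the nodes are independent, and their values are correct. -/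
def Sound (G : SimpleGraph (Fin n)) (H : SimpleGraph (Fin k)) (w : ℕ → ℝ) (W : ℕ → Set ℕ)
    (m : Store) : Prop :=
  ∀ j, nodeSet 14 (n * k) m j ⊆ W j ∧ Independent G H (nodeSet 14 (n * k) m j) ∧
    m.real 1 j = weight (n * k) w (nodeSet 14 (n * k) m j) ∧ 0 ≤ m.real 1 j

theorem Sound.congr {w : ℕ → ℝ} {W : ℕ → Set ℕ} {m m' : Store} (h : Sound G H w W m)
    (hset : ∀ j, nodeSet 14 (n * k) m' j = nodeSet 14 (n * k) m j) (hr : m'.real 1 = m.real 1) :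
    Sound G H w W m' := by
  intro j
  rw [hset, hr]
  exact h j

/-- Children have larger numbers than their parent, so updating the value of a node does not affect
the values of its own guesses. -/
theorem guessValue_congr {N i ρ : ℕ} {w : ℕ → ℝ} {W : ℕ → Set ℕ} {v v' : ℕ → ℝ}
    (hi : i < branching R N * i + 1) (h : ∀ j, i < j → v j = v' j) :
    guessValue R N w W v i ρ = guessValue R N w W v' i ρ := by
  rw [guessValue, guessValue]
  refine congrArg₂ _ rfl (Finset.sum_congr rfl fun p _ => h _ ?_)
  rw [child]
  omega

/-- The solution is replaced only by a strictly better one; stored values therefore never decrease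
and stay nonnegative. -/
theorem run_improveProg {i ρ : ℕ} {W : ℕ → Set ℕ} {w : ℕ → ℝ} {m : Store}
    (hN : m.nat 3 0 = n * k)
    (hi : m.nat 17 0 = i) (hic : i < branching R (n * k) * i + 1)
    (hc : m.nat 16 0 = branching R (n * k) * i + 1 + ρ * (n * k))
    (ho : Offsets (n * k) (branching R (n * k) * (i + 1) + 1) m)
    (hd : m.nat 100 0 = digit (n * k + 1) ρ 0) (hρ : ρ < (n * k + 1) ^ (R + 3))
    (hexp : Expanded R G H W i) (hW : nodeSet 13 (n * k) m i = W i)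
    (hw : m.real 0 = w) (hs : Sound G H w W m) :
    (improveProg.run m).nat 16 0 = branching R (n * k) * i + 1 + (ρ + 1) * (n * k) ∧
      Sound G H w W (improveProg.run m) ∧
      (∀ j ≠ i, (improveProg.run m).real 1 j = m.real 1 j) ∧
      m.real 1 i ≤ (improveProg.run m).real 1 i ∧
      guessValue R (n * k) w W (m.real 1) i ρ ≤ (improveProg.run m).real 1 i := by
  classical
  set N := n * k with hNdef
  set B := branching R N with hB
  have hρB : ρ * N + N ≤ B := by
    have : (ρ + 1) * N ≤ (N + 1) ^ (R + 3) * N := Nat.mul_le_mul_right _ hρ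
    rw [hB, branching]
    linarith
  have hmulB : B * (i + 1) = B * i + B := by ring
  have hoi : m.nat 15 i = N * i := ho i (by omega)
  obtain ⟨hv1, hv2⟩ := run_valueProg hN hi hc hoi
  have hag₁ : Agree [28, 32] [2] m (valueProg.run m) := agree_valueProg m
  set m₁ := valueProg.run m with hm₁
  rw [hd, hW] at hv1 hv2
  have hval : m₁.real 2 0 = guessValue R N w W (m.real 1) i ρ := by
    rw [hv2, guessValue, hw]
    refine congrArg₂ _ rfl (Finset.sum_congr rfl fun p _ => ?_)
    rw [child, add_assoc]
  set m₂ := (LoopProg.ite (.rlt (.get 1 (.var 17)) (.get 2 (.const 0)))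
      (.seq (.setReal 1 (.var 17) (.get 2 (.const 0))) solutionProg) .skip).run m₁ with hm₂
  have hag₂ : Agree [14, 20, 21, 22] [1] m₁ m₂ :=
    (agree_run _ _).mono (by simp [solutionProg, count, setTest, writes])
      (by simp [solutionProg, count, setTest, writesReal])
  have hag : Agree [28, 32, 14, 20, 21, 22] [2, 1] m m₂ :=
    (hag₁.mono (by simp) (by simp)).trans (hag₂.mono (by simp) (by simp))
  have hrun : improveProg.run m = m₂.writeNat 16 0 (m₂.nat 16 0 + m₂.nat 3 0) := rfl
  have hset : ∀ j, nodeSet 14 N (improveProg.run m) j = nodeSet 14 N m₂ j := fun j =>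
    nodeSet_congr fun y _ => by rw [hrun, Store.writeNat_nat_of_ne _ _ _ (by simp)]
  have hreal : (improveProg.run m).real = m₂.real := by rw [hrun, Store.writeNat_real]
  have hset₁ : ∀ j, nodeSet 14 N m₁ j = nodeSet 14 N m j := fun j =>
    nodeSet_congr fun y _ => by rw [hag₁.1 14 (by simp)]
  have hv₁ : m₁.real 1 = m.real 1 := hag₁.2 1 (by simp)
  have hi₁ : m₁.nat 17 0 = i := by rw [hag₁.1 17 (by simp), hi]
  refine ⟨?_, ?_⟩
  · rw [hrun, Store.writeNat_nat_self, Function.update_self, hag.1 16 (by simp),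
      hag.1 3 (by simp), hc, hN]
    ring
  rw [hreal]
  suffices hmain : Sound G H w W m₂ ∧ (∀ j ≠ i, m₂.real 1 j = m.real 1 j) ∧
      m.real 1 i ≤ m₂.real 1 i ∧ guessValue R N w W (m.real 1) i ρ ≤ m₂.real 1 i from
    ⟨hmain.1.congr hset (by rw [hreal]), hmain.2⟩
  by_cases hlt : m.real 1 i < guessValue R N w W (m.real 1) i ρ
  · have hm₂' : m₂ = solutionProg.run (m₁.writeReal 1 i (m₁.real 2 0)) := by
      rw [hm₂, run, if_pos, run]
      · simp only [run, NExp.eval, RExp.eval, hi₁]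
      · simp only [Cond.Holds, RExp.eval, NExp.eval, hi₁, hv₁, hval]
        exact hlt
    set m₃ := m₁.writeReal 1 i (m₁.real 2 0) with hm₃
    have hnat₃ : m₃.nat = m₁.nat := rfl
    have hreal₂ : m₂.real 1 = Function.update (m.real 1) i
        (guessValue R N w W (m.real 1) i ρ) := by
      rw [hm₂', (agree_solutionProg m₃).2 1 (by simp), hm₃, Store.writeReal_real_self, hv₁, hval]
    obtain ⟨hs1, hs2⟩ := run_solutionProg (N := N) (i := i) (c := B * i + 1 + ρ * N) (m := m₃)
      (by rw [hnat₃, hag₁.1 3 (by simp), hN]) (by rw [hnat₃, hi₁])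
      (by rw [hnat₃, hag₁.1 16 (by simp), hc]) (by rw [hnat₃, hag₁.1 15 (by simp), hoi])
      (by omega) (fun p hp => by
        rw [hnat₃, hag₁.1 15 (by simp)]
        exact ho _ (by omega))
    rw [← hm₂'] at hs1 hs2
    have hset₃ : ∀ j, nodeSet 14 N m₃ j = nodeSet 14 N m j := hset₁
    simp only [hset₃] at hs1 hs2
    rw [hnat₃, hv1, hag₁.1 100 (by simp), hd] at hs1
    have hchild : ∀ p, child R (n * k) i ρ p = B * i + 1 + ρ * N + p := fun p =>
      (add_assoc _ _ _).symm
    obtain ⟨g1, g2, g3⟩ := guess_sound (S := nodeSet 14 N m) (w := w) (v := m.real 1) hexp hρ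
      (fun p _ => ⟨(hs _).1, (hs _).2.1, (hs _).2.2.1⟩) (A := nodeSet 14 N m₂ i) (by
        rw [hs1]
        ext y
        constructor
        · rintro ⟨_, h⟩
          simpa only [Set.mem_ofPred_eq, hchild] using h
        · intro h
          refine ⟨?_, by simpa only [Set.mem_ofPred_eq, hchild] using h⟩
          rcases h with ⟨h1, rfl⟩ | ⟨p, _, hp⟩
          exacts [h1.1, hp.1])
    refine ⟨fun j => ?_, fun j hj => ?_, ?_, ?_⟩
    · by_cases hj : j = i
      · subst hj
        rw [hreal₂, Function.update_self]
        exact ⟨g1, g2, g3, ((hs j).2.2.2.trans_lt hlt).le⟩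
      · have hset₂ : nodeSet 14 (n * k) m₂ j = nodeSet 14 (n * k) m j := hs2 j hj
        rw [hset₂, hreal₂, Function.update_of_ne hj]
        exact hs j
    · rw [hreal₂, Function.update_of_ne hj]
    · rw [hreal₂, Function.update_self]
      exact hlt.le
    · rw [hreal₂, Function.update_self]
  · have hm₂' : m₂ = m₁ := by
      rw [hm₂, run, if_neg, run]
      simp only [Cond.Holds, RExp.eval, NExp.eval, hi₁, hv₁, hval]
      exact hlt
    rw [hm₂', hv₁]
    exact ⟨hs.congr hset₁ hv₁, fun _ _ => rfl, le_rfl, not_lt.1 hlt⟩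

theorem notMem_writes_combineProg {a : ℕ} (ha : a < 100)
    (h : a ∉ [14, 16, 20, 21, 22, 28, 32]) : a ∉ (combineProg R).writes := by
  simp only [combineProg, writes, List.mem_append, mem_writes_nest, writes_improveProg]
  simp only [List.mem_cons, List.not_mem_nil, or_false] at h ⊢
  omega

theorem writesReal_combineProg : (combineProg R).writesReal = [2, 2, 2, 1] := by
  simp [combineProg, writesReal, writesReal_improveProg]

/-- The value of the node is a running maximum: once it dominates a guess it continues to do so, as
the value of that guess depends only on the children. -/
theorem run_combineProg {i : ℕ} {W : ℕ → Set ℕ} {w : ℕ → ℝ} {m : Store}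
    (hst : Static k G m) (hi : m.nat 17 0 = i) (hic : i < branching R (n * k) * i + 1)
    (hc : m.nat 34 i = branching R (n * k) * i + 1)
    (ho : Offsets (n * k) (branching R (n * k) * (i + 1) + 1) m)
    (hexp : Expanded R G H W i) (hW : nodeSet 13 (n * k) m i = W i)
    (hw : m.real 0 = w) (hs : Sound G H w W m) :
    Sound G H w W ((combineProg R).run m) ∧
      (∀ j ≠ i, ((combineProg R).run m).real 1 j = m.real 1 j) ∧
      ∀ ρ < (n * k + 1) ^ (R + 3), guessValue R (n * k) w W (((combineProg R).run m).real 1) i ρ ≤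
        ((combineProg R).run m).real 1 i := by
  set N := n * k with hN
  set B := branching R N with hB
  set m₁ := (LoopProg.setNat 16 (.const 0) (.get 34 (.var 17))).run m with hm₁
  have hag₁ : Agree [16] [] m m₁ := agree_writeNat m _ _ _
  set F := nest 100 4 (R + 3) improveProg with hF
  have hrun : (combineProg R).run m = F.run m₁ := rfl
  have hnot : ∀ a < 100, a ∉ [14, 16, 20, 21, 22, 28, 32] → a ∉ F.writes := fun a ha hna h => by
    rcases mem_writes_nest.1 h with h | h
    · rw [writes_improveProg] at h
      simp only [List.mem_cons, List.not_mem_nil, or_false] at h hna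
      omega
    · omega
  have hnotR : 0 ∉ F.writesReal := by simp [hF, writesReal_improveProg]
  have hset₁ : ∀ j, nodeSet 14 N m₁ j = nodeSet 14 N m j := fun j =>
    nodeSet_congr fun y _ => by rw [hag₁.1 14 (by simp)]
  have main := run_nest_induction (a := 100) (v := 4) (p := improveProg)
    (fun ρ m' => m'.nat 16 0 = B * i + 1 + ρ * N ∧ Sound G H w W m' ∧
      (∀ j ≠ i, m'.real 1 j = m.real 1 j) ∧
      ∀ ρ' < ρ, guessValue R N w W (m'.real 1) i ρ' ≤ m'.real 1 i)
    F.writes F.writesReal (R + 3) (N + 1) (fun x hx => mem_writes_nest.2 (Or.inl hx))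
    (fun x hx => by rwa [hF, writesReal_nest]) (fun j hj => mem_writes_nest.2 (Or.inr (by omega)))
    (fun j hj h => by
      rw [writes_improveProg] at h
      simp at h
      omega)
    (hnot 4 (by simp) (by simp)) (Nat.succ_pos _) ?_ m₁ (by rw [hag₁.1 4 (by simp), hst.base]) ?_ ?_
  · exact main.2
  · rintro c m' j x hj ⟨g1, g2, g3⟩
    refine ⟨?_, fun j' => ?_, g3⟩
    · rw [Store.writeNat_nat_of_ne _ _ _ (by omega)]
      exact g1
    · rw [Store.writeNat_real, nodeSet_congr (m := m') fun y _ => by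
        rw [Store.writeNat_nat_of_ne _ _ _ (by omega)]]
      exact g2 j'
  · rintro ρ hρ m' hag hd ⟨g1, g2, g3, g4⟩
    have keep : ∀ a < 100, a ∉ [14, 16, 20, 21, 22, 28, 32] → m'.nat a = m.nat a :=
      fun a ha hna => by
        rw [hag.1 a (hnot a ha hna), hag₁.1 a]
        simp only [List.mem_cons, List.not_mem_nil, or_false] at hna ⊢
        omega
    obtain ⟨f1, f2, f3, f4, f5⟩ := run_improveProg (R := R) (i := i) (ρ := ρ) (W := W) (w := w)
      (m := m') (by rw [keep 3 (by simp) (by simp), hst.items])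
      (by rw [keep 17 (by simp) (by simp), hi]) hic g1
      (fun j hj => by rw [keep 15 (by simp) (by simp)]; exact ho j hj)
      (by simpa using hd 0 (by omega)) hρ hexp (by
        rw [← hW]
        exact nodeSet_congr fun y _ => by rw [keep 13 (by simp) (by simp)])
      (by rw [hag.2 0 hnotR, hag₁.2 0 (by simp), hw]) g2
    refine ⟨f1, f2, fun j hj => by rw [f3 j hj, g3 j hj], fun ρ' hρ' => ?_⟩
    rw [guessValue_congr hic fun j hj => f3 j hj.ne']
    rcases Nat.lt_succ_iff_lt_or_eq.1 hρ' with hlt | rfl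
    · exact (g4 ρ' hlt).trans f4
    · exact f5
  · refine ⟨?_, ?_, fun j _ => ?_, fun ρ' hρ' => absurd hρ' (by omega)⟩
    · rw [hm₁, zero_mul, add_zero, ← hc]
      simp [run, NExp.eval, hi]
    · intro j
      rw [hset₁, hag₁.2 1 (by simp)]
      exact hs j
    · rw [hag₁.2 1 (by simp)]

end ColoringSearch

/-! ### Unbounded loops whose number of rounds is known from an invariant. -/

namespace RAM

/-- The invariant rule for loops with a known number of rounds. -/
theorem exec_loop_induction {c : Cond} {p : Prog} (I : ℕ → Store → Prop) {b T : ℕ}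
    (hs : ∀ i < b, ∀ m, I i m → c.Holds m ∧ ∃ t ≤ T, ∃ m', Exec p m t m' ∧ I (i + 1) m')
    (hdone : ∀ m, I b m → ¬ c.Holds m) {a : ℕ} (hab : a ≤ b) {m : Store} (h : I a m) :
    ∃ t ≤ (b - a) * (T + c.cost + 1) + (c.cost + 1), ∃ m', Exec (.loop c p) m t m' ∧ I b m' := by
  obtain ⟨j, hj⟩ := Nat.exists_eq_add_of_le hab
  induction j generalizing a m with
  | zero =>
    obtain rfl : b = a := by omega
    exact ⟨_, Nat.le_add_left _ _, m, .loopDone (hdone m h), h⟩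
  | succ j ih =>
    obtain ⟨hc, t₁, ht₁, m₁, h₁, hI₁⟩ := hs a (by omega) m h
    obtain ⟨t₂, ht₂, m₂, h₂, hI₂⟩ := ih (a := a + 1) (by omega) hI₁ (by omega)
    refine ⟨_, ?_, m₂, .loopStep hc h₁ h₂, hI₂⟩
    obtain ⟨l, hl⟩ : ∃ l, b - a = l + 1 := ⟨j, by omega⟩
    rw [show b - (a + 1) = l by omega] at ht₂
    rw [hl, add_mul, one_mul]
    omega

end RAM

/-! ## Processing the search tree -/

namespace ColoringSearch

open RAM RAM.LoopProg

variable {n k : ℕ} {R : ℕ} {G : SimpleGraph (Fin n)} {H : SimpleGraph (Fin k)}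

/-- If there are no items, the branching number is 0 and the tree is only the root; otherwise the
children of `i` come after `i`. -/
theorem lt_of_lt_levels {R N j i : ℕ} (h : i < levels R N j) : i < branching R N * i + 1 := by
  rcases Nat.eq_zero_or_pos (branching R N) with h0 | h0
  · cases j with
    | zero => exact absurd h (Nat.not_lt_zero _)
    | succ j => rw [levels, h0] at h; omega
  · exact Nat.lt_succ_of_le (Nat.le_mul_of_pos_left _ h0)

/-- The state when the nodes below `i` have been expanded. -/
structure Forward (R : ℕ) (G : SimpleGraph (Fin n)) (H : SimpleGraph (Fin k)) (i : ℕ) (m : Store) :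
    Prop where
  static : Static k G m
  node : m.nat 17 0 = i
  next : m.nat 16 0 = branching R (n * k) * i + 1
  offsets : Offsets (n * k) (branching R (n * k) * i + 1) m
  first : ∀ j < i, m.nat 34 j = branching R (n * k) * j + 1
  expanded : ∀ j < i, Expanded R G H (nodeSet 13 (n * k) m) j
  root : nodeSet 13 (n * k) m 0 = {y | y < n * k}

theorem Forward.expand {i : ℕ} {m : Store} (h : Forward R G H i m)
    (hi : i < branching R (n * k) * i + 1) :
    Forward R G H (i + 1) (((expandProg R H).run m).writeNat 17 0 (i + 1)) := by
  obtain ⟨g1, g2, g3, g4, g5, g6⟩ := run_expandProg (R := R) (H := H) h.static h.node hi h.next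
    h.offsets
  set m' := (expandProg R H).run m
  have hset : nodeSet 13 (n * k) (m'.writeNat 17 0 (i + 1)) = nodeSet 13 (n * k) m' := by
    funext j
    exact nodeSet_congr fun y _ => by rw [Store.writeNat_nat_of_ne _ _ _ (by simp)]
  refine ⟨?_, by simp, by simpa using g1, fun j hj => ?_, fun j hj => ?_, fun j hj => ?_, ?_⟩
  · refine (h.static.of_agree (agree_run _ _) fun a ha => notMem_writes_expandProg ?_ ?_).of_agree
      (agree_writeNat _ _ _ _) (by decide)
    · simp only [List.mem_cons, List.not_mem_nil, or_false] at ha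
      omega
    · simp only [List.mem_cons, List.not_mem_nil, or_false] at ha ⊢
      omega
  · rw [Store.writeNat_nat_of_ne _ _ _ (by simp)]
    exact g2 j hj
  · rw [Store.writeNat_nat_of_ne _ _ _ (by simp)]
    rcases Nat.lt_succ_iff_lt_or_eq.1 hj with hj | rfl
    · rw [g4 j hj, h.first j hj]
    · exact g5
  · rw [hset]
    rcases Nat.lt_succ_iff_lt_or_eq.1 hj with hj | rfl
    · refine (h.expanded j hj).congr (c := branching R (n * k) * i + 1) ?_ (by omega)
        fun j' hj' => nodeSet_eq_of_lt g3 hj'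
      exact Nat.add_le_add_right (Nat.mul_le_mul_left _ hj) 1
    · exact g6
  · rw [hset, nodeSet_eq_of_lt g3 (Nat.succ_pos _), h.root]

theorem wellFormed_guessProg : (guessProg R H).WellFormed := by
  simp [guessProg, coreProg, paintProg, purgeProg, splitProg, labelProg, roundProg, childrenProg,
    childProg, count, setTest, WellFormed, writes]

theorem bounds_guessProg : (guessProg R H).bounds = [3, 3, 3, 3, 3, 3, 3, 3, 3, 3, 3, 3] := rfl

theorem wellFormed_expandProg : (expandProg R H).WellFormed :=
  ⟨trivial, wellFormed_nest wellFormed_guessProg fun j _ h => by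
    have := writes_guessProg_subset h
    simp at this
    omega⟩

theorem bounds_expandProg {v : ℕ} (h : v ∈ (expandProg R H).bounds) : v = 3 ∨ v = 4 := by
  simp only [expandProg, bounds, List.nil_append] at h
  rcases mem_bounds_nest h with h | h
  · exact Or.inr h
  · rw [bounds_guessProg] at h
    simp at h
    exact Or.inl h

theorem exec_expandProg {L : ℕ} {m : Store} (hst : Static k G m) (hL : n * k + 1 ≤ L) :
    ∃ t ≤ (expandProg R H).cost L, Exec (expandProg R H).toProg m t ((expandProg R H).run m) := by
  refine exec_toProg (ws := (expandProg R H).writes) _ wellFormed_expandProg (fun _ h => h)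
    (fun v hv => ?_) m fun v hv => ?_
  · rcases bounds_expandProg hv with rfl | rfl <;>
      exact notMem_writes_expandProg (by simp) (by simp)
  · rcases bounds_expandProg hv with rfl | rfl
    · rw [hst.items]
      omega
    · rwa [hst.base]

/-- Advancing a scalar. -/
def Prog.incr (a : ℕ) : Prog := .setNat a (.const 0) (.add (.var a) (.const 1))

variable (R H) in
/-- The expansion of the nodes of one level. -/
noncomputable def levelProg : Prog :=
  .seq (.setNat 18 (.const 0) (.var 16))
    (.seq (.loop (.lt (.var 17) (.var 18)) (.seq (expandProg R H).toProg (Prog.incr 17)))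
      (Prog.incr 19))

variable (R H) in
/-- The expansion of all nodes. -/
noncomputable def forwardProg : Prog := .loop (.lt (.var 19) (.var 12)) (levelProg R H)

/-- The arrays that are not changed by the expansion of nodes. -/
def Kept (m m' : Store) : Prop :=
  m'.nat 2 = m.nat 2 ∧ m'.nat 5 = m.nat 5 ∧ m'.nat 12 = m.nat 12 ∧ m'.nat 14 = m.nat 14 ∧
    m'.real = m.real

/-- At the start of level `e` the pointer to the next child is `branching * levels e + 1`, which is
`levels (e + 1)`. So the end of the level is found without computing it. -/
theorem exec_levelProg {L e : ℕ} {m : Store} (hL : n * k + 1 ≤ L)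
    (h : Forward R G H (levels R (n * k) e) m) (he : m.nat 19 0 = e) :
    ∃ t ≤ levels R (n * k) (e + 1) * ((expandProg R H).cost L + 12) + 16, ∃ m',
      Exec (levelProg R H) m t m' ∧ Forward R G H (levels R (n * k) (e + 1)) m' ∧
        m'.nat 19 0 = e + 1 ∧ Kept m m' := by
  set M := levels R (n * k) (e + 1) with hM
  have h18 : m.nat 16 0 = M := h.next
  set m₁ := m.writeNat 18 0 M with hm₁
  have hag₁ : Agree [18] [] m m₁ := agree_writeNat _ _ _ _
  have hset₁ : nodeSet 13 (n * k) m₁ = nodeSet 13 (n * k) m := by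
    funext j
    exact nodeSet_congr fun y _ => by rw [hag₁.1 13 (by simp)]
  have h₁ : Forward R G H (levels R (n * k) e) m₁ := by
    refine ⟨h.static.of_agree hag₁ (by decide), ?_, ?_, fun j hj => ?_, fun j hj => ?_,
      fun j hj => ?_, ?_⟩
    · rw [hag₁.1 17 (by simp), h.node]
    · rw [hag₁.1 16 (by simp), h.next]
    · rw [hag₁.1 15 (by simp), h.offsets j hj]
    · rw [hag₁.1 34 (by simp), h.first j hj]
    · rw [hset₁]
      exact h.expanded j hj
    · rw [hset₁, h.root]
  have hnot : ∀ a ∈ [2, 5, 12, 14, 18, 19], a ∉ (expandProg R H).writes := fun a ha =>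
    notMem_writes_expandProg (by simp at ha; omega) (by simp at ha ⊢; omega)
  have hloop := exec_loop_induction (c := .lt (.var 17) (.var 18))
    (p := .seq (expandProg R H).toProg (Prog.incr 17))
    (fun i m' => Forward R G H i m' ∧ m'.nat 18 = m₁.nat 18 ∧ m'.nat 19 = m₁.nat 19 ∧ Kept m₁ m')
    (b := M) (T := (expandProg R H).cost L + 6) ?_ ?_ (a := levels R (n * k) e)
    (levels_mono (Nat.le_succ e)) (m := m₁) ⟨h₁, rfl, rfl, rfl, rfl, rfl, rfl, rfl⟩
  · obtain ⟨t, ht, m₂, hex, hF, g18, g19, gk⟩ := hloop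
    refine ⟨4 + (t + 6), ?_, m₂.writeNat 19 0 (e + 1), ?_, ?_, by simp, ?_⟩
    · have := Nat.mul_le_mul_right ((expandProg R H).cost L + 12)
        (Nat.sub_le M (levels R (n * k) e))
      simp only [Cond.cost, NExp.cost] at ht
      rw [show (expandProg R H).cost L + 6 + (1 + 1 + (1 + 1) + 1) + 1 =
        (expandProg R H).cost L + 12 by ring] at ht
      omega
    · refine .seq ?_ (.seq hex ?_)
      · have := Exec.setNat 18 (.const 0) (.var 16) m
        simp only [NExp.eval, h18] at this
        exact this
      · have := Exec.setNat 19 (.const 0) (.add (.var 19) (.const 1)) m₂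
        simp only [NExp.eval, g19, hag₁.1 19 (by simp), he] at this
        exact this
    · have hag₂ : Agree [19] [] m₂ (m₂.writeNat 19 0 (e + 1)) := agree_writeNat _ _ _ _
      have hset₂ : nodeSet 13 (n * k) (m₂.writeNat 19 0 (e + 1)) = nodeSet 13 (n * k) m₂ := by
        funext j
        exact nodeSet_congr fun y _ => by rw [hag₂.1 13 (by simp)]
      refine ⟨hF.static.of_agree hag₂ (by decide), ?_, ?_, fun j hj => ?_, fun j hj => ?_,
        fun j hj => ?_, ?_⟩
      · rw [hag₂.1 17 (by simp), hF.node]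
      · rw [hag₂.1 16 (by simp), hF.next]
      · rw [hag₂.1 15 (by simp), hF.offsets j hj]
      · rw [hag₂.1 34 (by simp), hF.first j hj]
      · rw [hset₂]
        exact hF.expanded j hj
      · rw [hset₂, hF.root]
    · obtain ⟨k1, k2, k3, k4, k5⟩ := gk
      simp only [Kept, Store.writeNat_real]
      refine ⟨?_, ?_, ?_, ?_, k5⟩ <;> rw [Store.writeNat_nat_of_ne _ _ _ (by simp)] <;>
        [rw [k1]; rw [k2]; rw [k3]; rw [k4]] <;> exact hag₁.1 _ (by simp)
  · rintro i hi m' ⟨hF, g18, g19, k1, k2, k3, k4, k5⟩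
    obtain ⟨t, ht, hex⟩ := exec_expandProg (R := R) (H := H) hF.static hL
    have hag : Agree (expandProg R H).writes (expandProg R H).writesReal m'
      ((expandProg R H).run m') := agree_run _ _
    have h17 : ((expandProg R H).run m').nat 17 0 = i := by
      rw [hag.1 17 (notMem_writes_expandProg (by simp) (by simp)), hF.node]
    have hR0 : (expandProg R H).writesReal = [] := by
      simp [expandProg, writesReal, guessProg, coreProg, paintProg, purgeProg, splitProg,
        labelProg, roundProg, childrenProg, childProg, count, setTest]
    refine ⟨?_, t + 6, by omega, _, .seq hex (.setNat _ _ _ _), ?_⟩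
    · simp only [Cond.Holds, NExp.eval]
      rw [hF.node, g18]
      simpa [hm₁] using hi
    · simp only [NExp.eval, h17]
      refine ⟨hF.expand (lt_of_lt_levels hi), ?_, ?_, ?_, ?_, ?_, ?_, ?_⟩
      · rw [Store.writeNat_nat_of_ne _ _ _ (by simp), hag.1 _ (hnot _ (by simp)), g18]
      · rw [Store.writeNat_nat_of_ne _ _ _ (by simp), hag.1 _ (hnot _ (by simp)), g19]
      · rw [Store.writeNat_nat_of_ne _ _ _ (by simp), hag.1 _ (hnot _ (by simp)), k1]
      · rw [Store.writeNat_nat_of_ne _ _ _ (by simp), hag.1 _ (hnot _ (by simp)), k2]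
      · rw [Store.writeNat_nat_of_ne _ _ _ (by simp), hag.1 _ (hnot _ (by simp)), k3]
      · rw [Store.writeNat_nat_of_ne _ _ _ (by simp), hag.1 _ (hnot _ (by simp)), k4]
      · rw [Store.writeNat_real, ← k5]
        funext a
        exact hag.2 a (by simp [hR0])
  · rintro m' ⟨hF, g18, -⟩
    simp only [Cond.Holds, NExp.eval]
    rw [hF.node, g18]
    simp [hm₁]

theorem Kept.trans {m m' m'' : Store} (h : Kept m m') (h' : Kept m' m'') : Kept m m'' :=
  ⟨h'.1.trans h.1, h'.2.1.trans h.2.1, h'.2.2.1.trans h.2.2.1, h'.2.2.2.1.trans h.2.2.2.1,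
    h'.2.2.2.2.trans h.2.2.2.2⟩

theorem exec_forwardProg {L d : ℕ} {m : Store} (hL : n * k + 1 ≤ L) (h : Forward R G H 0 m)
    (h0 : m.nat 19 0 = 0) (hd : m.nat 12 0 = d) :
    ∃ t ≤ d * (levels R (n * k) d * ((expandProg R H).cost L + 12) + 22) + 6, ∃ m',
      Exec (forwardProg R H) m t m' ∧ Forward R G H (levels R (n * k) d) m' ∧ Kept m m' := by
  have hloop := exec_loop_induction (c := .lt (.var 19) (.var 12)) (p := levelProg R H)
    (fun e m' => Forward R G H (levels R (n * k) e) m' ∧ m'.nat 19 0 = e ∧ Kept m m') (b := d)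
    (T := levels R (n * k) d * ((expandProg R H).cost L + 12) + 16) ?_ ?_ (a := 0)
    (Nat.zero_le d) (m := m) ⟨h, h0, rfl, rfl, rfl, rfl, rfl⟩
  · obtain ⟨t, ht, m', hex, hF, -, hk⟩ := hloop
    refine ⟨t, ht.trans (le_of_eq ?_), m', hex, hF, hk⟩
    simp only [Cond.cost, NExp.cost, Nat.sub_zero]
  · rintro e he m' ⟨hF, g19, gk⟩
    obtain ⟨t, ht, m'', hex, hF', g19', gk'⟩ := exec_levelProg hL hF g19
    refine ⟨?_, t, ht.trans ?_, m'', hex, hF', g19', gk.trans gk'⟩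
    · simp only [Cond.Holds, NExp.eval]
      rw [g19, gk.2.2.1, hd]
      exact he
    · have := Nat.mul_le_mul_right ((expandProg R H).cost L + 12)
        (levels_mono (R := R) (N := n * k) (show e + 1 ≤ d from he))
      omega
  · rintro m' ⟨-, g19, gk⟩
    simp only [Cond.Holds, NExp.eval]
    rw [g19, gk.2.2.1, hd]
    exact lt_irrefl d

/-- The combination of all nodes. -/
def backwardProg (R : ℕ) : Prog :=
  .loop (.lt (.const 0) (.var 17))
    (.seq (.setNat 17 (.const 0) (.sub (.var 17) (.const 1))) (combineProg R).toProg)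

theorem wellFormed_combineProg : (combineProg R).WellFormed := by
  refine ⟨trivial, wellFormed_nest ?_ fun j _ h => ?_⟩
  · simp [improveProg, valueProg, solutionProg, count, setTest, WellFormed, writes]
  · rw [writes_improveProg] at h
    simp at h
    omega

theorem bounds_combineProg {v : ℕ} (h : v ∈ (combineProg R).bounds) : v = 3 ∨ v = 4 := by
  simp only [combineProg, bounds, List.nil_append] at h
  rcases mem_bounds_nest h with h | h
  · exact Or.inr h
  · have h3 : improveProg.bounds = [3, 3, 3] := rfl
    rw [h3] at h
    simp at h
    exact Or.inl h

theorem exec_combineProg {L : ℕ} {m : Store} (hst : Static k G m) (hL : n * k + 1 ≤ L) :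
    ∃ t ≤ (combineProg R).cost L, Exec (combineProg R).toProg m t ((combineProg R).run m) := by
  refine exec_toProg (ws := (combineProg R).writes) _ wellFormed_combineProg (fun _ h => h)
    (fun v hv => ?_) m fun v hv => ?_
  · rcases bounds_combineProg hv with rfl | rfl <;>
      exact notMem_writes_combineProg (by simp) (by simp)
  · rcases bounds_combineProg hv with rfl | rfl
    · rw [hst.items]
      omega
    · rwa [hst.base]

/-- Nodes are combined in descending order, hence after their children. Nodes on the last,
unexpanded level are never combined and keep their initial solution. -/
theorem exec_backwardProg {L d : ℕ} {m : Store} {w : ℕ → ℝ} (hL : n * k + 1 ≤ L)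
    (h : Forward R G H (levels R (n * k) d) m) (hw : m.real 0 = w)
    (hs : Sound G H w (nodeSet 13 (n * k) m) m) :
    ∃ t ≤ levels R (n * k) d * ((combineProg R).cost L + 11) + 5, ∃ m',
      Exec (backwardProg R) m t m' ∧ Static k G m' ∧ m'.nat 5 = m.nat 5 ∧ m'.nat 2 = m.nat 2 ∧
        Sound G H w (nodeSet 13 (n * k) m) m' ∧
        ∀ j < levels R (n * k) d, ∀ ρ < (n * k + 1) ^ (R + 3),
          guessValue R (n * k) w (nodeSet 13 (n * k) m) (m'.real 1) j ρ ≤ m'.real 1 j := by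
  set M := levels R (n * k) d with hM
  set W := nodeSet 13 (n * k) m with hWdef
  set ws := 17 :: (combineProg R).writes with hws
  have hnot : ∀ a < 100, a ∉ [14, 16, 17, 20, 21, 22, 28, 32] → a ∉ ws := fun a ha hna hmem => by
    rcases List.mem_cons.1 hmem with rfl | hmem
    · exact hna (by simp)
    · exact notMem_writes_combineProg ha (fun h => hna (by simp at h ⊢; omega)) hmem
  have hloop := exec_loop_induction (c := .lt (.const 0) (.var 17))
    (p := .seq (.setNat 17 (.const 0) (.sub (.var 17) (.const 1))) (combineProg R).toProg)
    -- After `l` rounds exactly the nodes from `M - l` to `M - 1` have been combined.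
    (fun l m' => m'.nat 17 0 = M - l ∧ Agree ws [1, 2] m m' ∧ Sound G H w W m' ∧
      ∀ j, M - l ≤ j → j < M → ∀ ρ < (n * k + 1) ^ (R + 3),
        guessValue R (n * k) w W (m'.real 1) j ρ ≤ m'.real 1 j) (b := M)
    (T := (combineProg R).cost L + 6) ?_ ?_ (a := 0)
    (Nat.zero_le M) (m := m) ⟨h.node, .refl _ _ _, hs, fun j hj hj' => absurd hj' (by omega)⟩
  · obtain ⟨t, ht, m', hex, -, hag, hs', hv⟩ := hloop
    refine ⟨t, ht.trans (le_of_eq ?_), m', hex, ?_, ?_, ?_, hs', fun j hj => hv j (by omega) hj⟩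
    · simp only [Cond.cost, NExp.cost, Nat.sub_zero]
    · exact h.static.of_agree hag fun a ha => hnot a (by simp at ha; omega) (by simp at ha ⊢; omega)
    · exact hag.1 5 (hnot 5 (by simp) (by simp))
    · exact hag.1 2 (hnot 2 (by simp) (by simp))
  · rintro l hl m' ⟨h17, hag, hs', hv⟩
    set i := M - (l + 1) with hi
    have hi1 : M - l = i + 1 := by omega
    have hiM : i < M := by omega
    set m₁ := m'.writeNat 17 0 i with hm₁
    have hag₁ : Agree [17] [] m' m₁ := agree_writeNat _ _ _ _
    have hagm : Agree ws [1, 2] m m₁ := hag.trans (hag₁.mono (by simp [hws]) (by simp))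
    have hst₁ : Static k G m₁ := h.static.of_agree hagm fun a ha =>
      hnot a (by simp at ha; omega) (by simp at ha ⊢; omega)
    obtain ⟨t, ht, hex⟩ := exec_combineProg (R := R) hst₁ hL
    obtain ⟨g1, g2, g3⟩ := run_combineProg (R := R) (H := H) (i := i) (W := W) (w := w) hst₁
      (by simp [hm₁]) (lt_of_lt_levels hiM)
      (by rw [hagm.1 34 (hnot 34 (by simp) (by simp)), h.first i hiM])
      (fun j hj => by
        rw [hagm.1 15 (hnot 15 (by simp) (by simp))]
        refine h.offsets j (hj.trans_le (Nat.add_le_add_right (Nat.mul_le_mul_left _ hiM) 1)))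
      (h.expanded i hiM) (nodeSet_congr fun y _ => by
        rw [hagm.1 13 (hnot 13 (by simp) (by simp))])
      (by rw [hagm.2 0 (by simp), hw])
      (hs'.congr (fun j => nodeSet_congr fun y _ => by rw [hag₁.1 14 (by simp)]) rfl)
    refine ⟨?_, 6 + t, by omega, (combineProg R).run m₁, .seq ?_ hex, ?_, ?_, g1, ?_⟩
    · simp only [Cond.Holds, NExp.eval]
      omega
    · have := Exec.setNat 17 (.const 0) (.sub (.var 17) (.const 1)) m'
      simp only [NExp.eval, h17, hi1, Nat.add_sub_cancel] at this
      exact this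
    · rw [run_nat _ _ (notMem_writes_combineProg (by simp) (by simp)), hm₁]
      simp
    · refine hagm.trans ((agree_run _ _).mono (by simp [hws]) ?_)
      rw [writesReal_combineProg]
      simp
    · intro j hj hjM ρ hρ
      by_cases hji : j = i
      · subst hji
        exact g3 ρ hρ
      · rw [g2 j hji, guessValue_congr (lt_of_lt_levels hjM) fun j' hj' => g2 j' (by omega)]
        exact hv j (by omega) hjM ρ hρ
  · rintro m' ⟨h17, -⟩
    simp only [Cond.Holds, NExp.eval]
    omega

end ColoringSearch

/-! ## The whole program -/

namespace ColoringSearch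

open RAM RAM.LoopProg

variable {n k : ℕ} {R : ℕ} {G : SimpleGraph (Fin n)} {H : SimpleGraph (Fin k)}

/-- The computation of the numbers of items, of colours and of vertices. -/
def sizesProg (k : ℕ) : LoopProg :=
  .seq (.setNat 3 (.const 0) (.smul k (.var 0)))
    (.seq (.setNat 4 (.const 0) (.add (.var 3) (.const 1)))
      (.seq (.setNat 5 (.const 0) (.const k))
        (.seq (.setNat 6 (.const 0) (.add (.var 0) (.const 1)))
          (.setNat 16 (.const 0) (.const 1)))))

/-- The computation of the offsets of the rows of the adjacency matrix. -/
def rowsProg : LoopProg :=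
  .loop 29 6 (.seq (.setNat 9 (.var 29) (.var 33))
    (.setNat 33 (.const 0) (.add (.var 33) (.var 0))))

/-- The computation of the vertices and the colours of the items. -/
def itemsProg (k : ℕ) : LoopProg :=
  .loop 29 6 (.loop 30 5 (.seq (.setNat 7 (.add (.var 30) (.smul k (.var 29))) (.var 29))
    (.setNat 8 (.add (.var 30) (.smul k (.var 29))) (.var 30))))

/-- The computation of a square root. -/
def sqrtProg : LoopProg :=
  .loop 29 6 (.ite (.lt (.var 0) (.var 11)) .skip
    (.seq (.setNat 11 (.const 0) (.add (.add (.var 11) (.smul 2 (.var 10))) (.const 1)))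
      (.setNat 10 (.const 0) (.add (.var 10) (.const 1)))))

/-- The computation of the set of all items. -/
def rootProg : LoopProg := .loop 20 3 (.setNat 13 (.var 20) (.const 1))

/-- The depth of the search tree. -/
def depth (n k : ℕ) : ℕ := 4 * k * (Nat.sqrt n + 1) + 1

/-- The computations before the search. -/
def setupProg (k : ℕ) : LoopProg :=
  .seq rowsProg (.seq (itemsProg k) (.seq sqrtProg
    (.seq (.setNat 12 (.const 0) (.add (.smul (4 * k) (.var 10)) (.const 1))) rootProg)))

theorem run_rowsProg {m : Store} (h : m.nat 33 0 = 0) :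
    ∀ u < m.nat 6 0, (rowsProg.run m).nat 9 u = m.nat 0 0 * u := by
  have := run_loop_induction (x := 29) (v := 6) (m := m)
    (p := .seq (.setNat 9 (.var 29) (.var 33)) (.setNat 33 (.const 0) (.add (.var 33) (.var 0))))
    (fun i m' => m'.nat 33 0 = m.nat 0 0 * i ∧ ∀ u < i, m'.nat 9 u = m.nat 0 0 * u) ?_ ?_
  · exact this.2
  · exact ⟨by simpa using h, fun u hu => absurd hu (by omega)⟩
  · rintro i _ m' hag hx ⟨h1, h2⟩
    have h0 : m'.nat 0 = m.nat 0 := hag.1 0 (by simp [writes])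
    simp only [run, NExp.eval, hx, Store.writeNat_nat_self, ne_eq, not_false_eq_true,
      Store.writeNat_nat_of_ne, Function.update_self, Nat.reduceEqDiff,
      OfNat.zero_ne_ofNat]
    refine ⟨by rw [h1, h0]; ring, fun u hu => ?_⟩
    by_cases hui : u = i
    · rw [hui, Function.update_self, h1]
    · rw [Function.update_of_ne hui]
      exact h2 u (by omega)

theorem run_itemsProg {m : Store} (h5 : m.nat 5 0 = k) :
    (k = 0 → ((itemsProg k).run m).nat 7 = m.nat 7 ∧ ((itemsProg k).run m).nat 8 = m.nat 8) ∧
    ∀ u < m.nat 6 0, ∀ a < k, ((itemsProg k).run m).nat 7 (a + k * u) = u ∧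
      ((itemsProg k).run m).nat 8 (a + k * u) = a := by
  have key := run_loop_induction (x := 29) (v := 6) (m := m)
    (p := .loop 30 5 (.seq (.setNat 7 (.add (.var 30) (.smul k (.var 29))) (.var 29))
      (.setNat 8 (.add (.var 30) (.smul k (.var 29))) (.var 30))))
    (fun i m' => (k = 0 → m'.nat 7 = m.nat 7 ∧ m'.nat 8 = m.nat 8) ∧
      ∀ u a, a < k → k * u + a < k * i → m'.nat 7 (a + k * u) = u ∧ m'.nat 8 (a + k * u) = a) ?_ ?_
  · refine ⟨key.1, fun u hu a ha => key.2 u a ha ?_⟩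
    have : k * (u + 1) ≤ k * m.nat 6 0 := Nat.mul_le_mul_left _ hu
    rw [mul_add] at this
    omega
  · exact ⟨fun _ => ⟨by simp, by simp⟩, fun u a _ hu => absurd hu (by omega)⟩
  · rintro i _ m' hag hx ih
    have h5' : m'.nat 5 0 = k := by rw [hag.1 5 (by simp [writes]), h5]
    have := run_loop_induction (x := 30) (v := 5) (m := m')
      (p := .seq (.setNat 7 (.add (.var 30) (.smul k (.var 29))) (.var 29))
        (.setNat 8 (.add (.var 30) (.smul k (.var 29))) (.var 30)))
      (fun j m'' => (k = 0 → m''.nat 7 = m.nat 7 ∧ m''.nat 8 = m.nat 8) ∧ ∀ u a, a < k →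
        k * u + a < k * i + j → m''.nat 7 (a + k * u) = u ∧ m''.nat 8 (a + k * u) = a) ?_ ?_
    · rw [h5'] at this
      simp only [ne_eq, not_false_eq_true, Store.writeNat_nat_of_ne,
        Nat.reduceEqDiff]
      exact this
    · simpa using ih
    · rintro j hj m'' hag2 hx2 ih2
      have h29 : m''.nat 29 0 = i := by rw [hag2.1 29 (by simp [writes]), hx]
      rw [h5'] at hj
      refine ⟨fun h => by omega, fun u a ha hlt => ?_⟩
      simp only [run, NExp.eval, NExp.eval_smul, hx2, h29, Store.writeNat_nat_self, ne_eq,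
        not_false_eq_true, Store.writeNat_nat_of_ne, Nat.reduceEqDiff]
      by_cases he : a + k * u = j + k * i
      · have h1 : (a + k * u) / k = u := by
          rw [Nat.add_mul_div_left _ _ (by omega), Nat.div_eq_of_lt ha, zero_add]
        have h2 : (j + k * i) / k = i := by
          rw [Nat.add_mul_div_left _ _ (by omega), Nat.div_eq_of_lt hj, zero_add]
        obtain rfl : u = i := by rw [← h1, he, h2]
        obtain rfl : a = j := by omega
        simp
      · rw [Function.update_of_ne he, Function.update_of_ne he]
        exact ih2.2 u a ha (by omega)

/-- The candidate r increases by one until r² exceeds `n`, and its square is updated by adding 2r +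
1. As r = n + 1 is certainly large enough, `n + 1` rounds suffice. -/
theorem run_sqrtProg {m : Store} (h0 : m.nat 0 0 = n) (h6 : m.nat 6 0 = n + 1)
    (h10 : m.nat 10 0 = 0) (h11 : m.nat 11 0 = 0) :
    (sqrtProg.run m).nat 10 0 = Nat.sqrt n + 1 := by
  have key := run_loop_induction (x := 29) (v := 6) (m := m)
    (p := .ite (.lt (.var 0) (.var 11)) .skip
    (.seq (.setNat 11 (.const 0) (.add (.add (.var 11) (.smul 2 (.var 10))) (.const 1)))
      (.setNat 10 (.const 0) (.add (.var 10) (.const 1)))))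
    (fun i m' => m'.nat 11 0 = m'.nat 10 0 * m'.nat 10 0 ∧
      (m'.nat 10 0 - 1) * (m'.nat 10 0 - 1) ≤ n ∧
      (n < m'.nat 10 0 * m'.nat 10 0 ∨ i ≤ m'.nat 10 0)) ?_ ?_
  · rw [h6] at key
    change _ ∧ ((sqrtProg.run m).nat 10 0 - 1) * ((sqrtProg.run m).nat 10 0 - 1) ≤ n ∧
      (n < (sqrtProg.run m).nat 10 0 * (sqrtProg.run m).nat 10 0 ∨
        n + 1 ≤ (sqrtProg.run m).nat 10 0) at key
    generalize (sqrtProg.run m).nat 10 0 = r at key ⊢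
    obtain ⟨-, h1, h2⟩ := key
    have h3 : n < r * r := h2.elim id fun h => by nlinarith
    obtain ⟨q, rfl⟩ : ∃ q, r = q + 1 := Nat.exists_eq_succ_of_ne_zero (by rintro rfl; omega)
    rw [Nat.add_sub_cancel] at h1
    rw [Nat.eq_sqrt.2 ⟨h1, h3⟩]
  · simp [h10, h11]
  · rintro i _ m' hag _ ⟨h1, h2, h3⟩
    have h0' : m'.nat 0 0 = n := by rw [hag.1 0 (by simp [writes]), h0]
    simp only [ne_eq, not_false_eq_true, Store.writeNat_nat_of_ne,
      Nat.reduceEqDiff]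
    rw [run]
    split_ifs with hc
    · simp only [Cond.Holds, NExp.eval, h0', h1] at hc
      simp only [run]
      exact ⟨h1, h2, Or.inl hc⟩
    · simp only [Cond.Holds, NExp.eval, h0', h1, not_lt] at hc
      simp only [run, NExp.eval, NExp.eval_smul, Store.writeNat_nat_self, ne_eq,
        not_false_eq_true, Store.writeNat_nat_of_ne, Nat.reduceEqDiff,
        Function.update_self, h1]
      refine ⟨by ring, by simpa using hc, Or.inr ?_⟩
      rcases h3 with h3 | h3 <;> omega

theorem run_rootProg {m : Store} (h3 : m.nat 3 0 = n * k) :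
    nodeSet 13 (n * k) (rootProg.run m) 0 = {y | y < n * k} := by
  have key := run_loop_induction (x := 20) (v := 3) (m := m) (p := .setNat 13 (.var 20) (.const 1))
    (fun i m' => ∀ y < i, m'.nat 13 y = 1) (fun y hy => absurd hy (by omega)) ?_
  · rw [h3] at key
    ext y
    rw [mem_nodeSet, mul_zero, zero_add]
    exact ⟨And.left, fun hy => ⟨hy, key y hy⟩⟩
  · rintro i _ m' _ hx ih y hy
    simp only [run, NExp.eval, hx, ne_eq, not_false_eq_true,
      Store.writeNat_nat_of_ne, Store.writeNat_nat_self, Nat.reduceEqDiff]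
    by_cases hyi : y = i
    · simp [hyi]
    · rw [Function.update_of_ne hyi]
      exact ih y (by omega)

/-- The memory at the start holds the instance, and the other cells hold `0`. -/
structure Initial (G : SimpleGraph (Fin n)) (w : ℕ → ℝ) (m : Store) : Prop where
  size : m.nat 0 0 = n
  adj : ∀ u ≤ n, ∀ v < n, m.nat 1 (v + n * u) = 1 ↔ NatAdj G u v
  zero : ∀ a, 2 ≤ a → ∀ i, m.nat a i = 0
  weights : m.real 0 = w
  values : ∀ i, m.real 1 i = 0

theorem agree_setupProg (m : Store) : Agree [7, 8, 9, 10, 11, 12, 13, 20, 29, 30, 33] [] m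
    ((setupProg k).run m) :=
  (agree_run _ m).mono (by simp [setupProg, rowsProg, itemsProg, sqrtProg, rootProg, writes])
    (by simp [setupProg, rowsProg, itemsProg, sqrtProg, rootProg, writesReal])

/-- Cells that start at 0 already provide the root as current node and its offset; only the pointer
to the next child has to be set, to 1. -/
theorem Initial.forward {w : ℕ → ℝ} {m : Store} (h : Initial G w m) :
    Forward R G H 0 ((setupProg k).run ((sizesProg k).run m)) ∧
      ((setupProg k).run ((sizesProg k).run m)).nat 12 0 = depth n k := by
  set m₁ := (sizesProg k).run m with hm₁
  have hag₁ : Agree [3, 4, 5, 6, 16] [] m m₁ :=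
    (agree_run _ m).mono (by simp [sizesProg, writes]) (by simp [sizesProg, writesReal])
  have h3 : m₁.nat 3 0 = n * k := by
    simp [hm₁, sizesProg, run, NExp.eval, h.size, mul_comm]
  have h4 : m₁.nat 4 0 = n * k + 1 := by
    simp [hm₁, sizesProg, run, NExp.eval, h.size, mul_comm]
  have h5 : m₁.nat 5 0 = k := by simp [hm₁, sizesProg, run, NExp.eval]
  have h6 : m₁.nat 6 0 = n + 1 := by simp [hm₁, sizesProg, run, NExp.eval, h.size]
  have h16 : m₁.nat 16 0 = 1 := by simp [hm₁, sizesProg, run, NExp.eval]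
  have h0 : m₁.nat 0 0 = n := by rw [hag₁.1 0 (by simp), h.size]
  set m₂ := rowsProg.run m₁ with hm₂
  have hag₂ : Agree [29, 9, 33] [] m₁ m₂ := agree_run rowsProg m₁
  have hrow := run_rowsProg (m := m₁) (by rw [hag₁.1 33 (by simp), h.zero 33 (by simp)])
  rw [h6, h0, ← hm₂] at hrow
  set m₃ := (itemsProg k).run m₂ with hm₃
  have hag₃ : Agree [29, 30, 7, 8] [] m₂ m₃ := agree_run (itemsProg k) m₂
  obtain ⟨hitem, hitem'⟩ := run_itemsProg (m := m₂) (by rw [hag₂.1 5 (by simp), h5])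
  rw [hag₂.1 6 (by simp), h6, ← hm₃] at hitem'
  rw [← hm₃] at hitem
  have hag13 : Agree [3, 4, 5, 6, 16, 29, 9, 33, 30, 7, 8] [] m m₃ :=
    (hag₁.mono (by simp) (by simp)).trans
      ((hag₂.mono (by simp) (by simp)).trans (hag₃.mono (by simp) (by simp)))
  set m₄ := sqrtProg.run m₃ with hm₄
  have hag₄ : Agree [29, 11, 10] [] m₃ m₄ := agree_run sqrtProg m₃
  have hsqrt := run_sqrtProg (n := n) (m := m₃) (by rw [hag13.1 0 (by simp), h.size])
    (by rw [hag₃.1 6 (by simp), hag₂.1 6 (by simp), h6])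
    (by rw [hag13.1 10 (by simp), h.zero 10 (by simp)])
    (by rw [hag13.1 11 (by simp), h.zero 11 (by simp)])
  rw [← hm₄] at hsqrt
  set m₅ := (LoopProg.setNat 12 (.const 0) (.add (.smul (4 * k) (.var 10)) (.const 1))).run m₄
    with hm₅
  have hag₅ : Agree [12] [] m₄ m₅ := agree_writeNat _ _ _ _
  have hdepth : m₅.nat 12 0 = depth n k := by
    simp [hm₅, run, NExp.eval, hsqrt, depth]
  have hag35 : Agree [29, 11, 10, 12] [] m₃ m₅ :=
    (hag₄.mono (by simp) (by simp)).trans (hag₅.mono (by simp) (by simp))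
  have hag15 : Agree [29, 9, 33, 30, 7, 8, 11, 10, 12] [] m₁ m₅ :=
    (hag₂.mono (by simp) (by simp)).trans ((hag₃.mono (by simp) (by simp)).trans
      (hag35.mono (by simp) (by simp)))
  have hag05 : Agree [3, 4, 5, 6, 16, 29, 9, 33, 30, 7, 8, 11, 10, 12] [] m m₅ :=
    (hag₁.mono (by simp) (by simp)).trans (hag15.mono (by simp) (by simp))
  have hag₆ : Agree [20, 13] [] m₅ (rootProg.run m₅) := agree_run rootProg m₅
  have hrun : (setupProg k).run m₁ = rootProg.run m₅ := rfl
  have hst : Static k G m₅ := by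
    refine ⟨?_, ?_, ?_, ?_, ?_, ?_, ?_⟩
    · rw [hag05.1 0 (by simp), h.size]
    · rw [hag05.1 1 (by simp)]
      exact h.adj
    · rw [hag15.1 3 (by simp), h3]
    · rw [hag15.1 4 (by simp), h4]
    · intro x hx
      rw [hag35.1 7 (by simp)]
      rcases Nat.eq_zero_or_pos k with hk | hk
      · rw [(hitem hk).1, hag₂.1 7 (by simp), hag₁.1 7 (by simp), h.zero 7 (by simp), hk,
          Nat.div_zero]
      · have := (hitem' (x / k) (Nat.lt_succ_of_le (Nat.div_le_of_le_mul (mul_comm n k ▸ hx)))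
          (x % k) (Nat.mod_lt _ hk)).1
        rwa [Nat.mod_add_div] at this
    · intro x hx
      rw [hag35.1 8 (by simp)]
      rcases Nat.eq_zero_or_pos k with hk | hk
      · subst hk
        rw [(hitem rfl).2, hag₂.1 8 (by simp), hag₁.1 8 (by simp), h.zero 8 (by simp)]
        simp at hx
        simp [hx]
      · have := (hitem' (x / k) (Nat.lt_succ_of_le (Nat.div_le_of_le_mul (mul_comm n k ▸ hx)))
          (x % k) (Nat.mod_lt _ hk)).2
        rwa [Nat.mod_add_div] at this
    · intro u hu
      rw [hag35.1 9 (by simp), hag₃.1 9 (by simp)]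
      exact hrow u (Nat.lt_succ_of_le hu)
  rw [hrun]
  refine ⟨⟨hst.of_agree hag₆ (by decide), ?_, ?_, fun j hj => ?_, fun j hj => absurd hj (by omega),
    fun j hj => absurd hj (by omega), run_rootProg hst.items⟩, ?_⟩
  · rw [hag₆.1 17 (by simp), hag05.1 17 (by simp), h.zero 17 (by simp)]
  · rw [hag₆.1 16 (by simp), hag15.1 16 (by simp), h16, mul_zero]
  · obtain rfl : j = 0 := by simpa using hj
    rw [hag₆.1 15 (by simp), hag05.1 15 (by simp), h.zero 15 (by simp)]
    simp
  · rw [hag₆.1 12 (by simp), hdepth]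

/-- The output of the solution at the root. -/
def outputProg (k : ℕ) : LoopProg :=
  .loop 29 0 (.loop 30 5 (.ite (bitTest 14 (.add (.var 30) (.smul k (.var 29))))
    (.setNat 2 (.var 29) (.add (.var 30) (.const 1))) .skip))

/-- If several colours of `u` were stored, the last one would win. Independence of the solution,
used later, makes the colour unique. -/
theorem run_outputProg {m : Store} (h0 : m.nat 0 0 = n) (h5 : m.nat 5 0 = k)
    (h2 : ∀ u, m.nat 2 u = 0) :
    ∀ u < n, (((outputProg k).run m).nat 2 u = 0 ∧ ∀ a < k, m.nat 14 (a + k * u) ≠ 1) ∨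
      ∃ a < k, m.nat 14 (a + k * u) = 1 ∧ ((outputProg k).run m).nat 2 u = a + 1 := by
  have key := run_loop_induction (x := 29) (v := 0) (m := m)
    (p := .loop 30 5 (.ite (bitTest 14 (.add (.var 30) (.smul k (.var 29))))
      (.setNat 2 (.var 29) (.add (.var 30) (.const 1))) .skip))
    (fun i m' => (∀ u, i ≤ u → m'.nat 2 u = 0) ∧
      ∀ u < i, (m'.nat 2 u = 0 ∧ ∀ a < k, m.nat 14 (a + k * u) ≠ 1) ∨
        ∃ a < k, m.nat 14 (a + k * u) = 1 ∧ m'.nat 2 u = a + 1) ?_ ?_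
  · rw [h0] at key
    exact key.2
  · exact ⟨fun u _ => by simpa using h2 u, fun u hu => absurd hu (by omega)⟩
  · rintro i _ m' hag hx ih
    have h5' : m'.nat 5 0 = k := by rw [hag.1 5 (by simp [writes]), h5]
    have h14' : m'.nat 14 = m.nat 14 := hag.1 14 (by simp [writes])
    have := run_loop_induction (x := 30) (v := 5) (m := m')
      (p := .ite (bitTest 14 (.add (.var 30) (.smul k (.var 29))))
        (.setNat 2 (.var 29) (.add (.var 30) (.const 1))) .skip)
      (fun j m'' => (∀ u ≠ i, m''.nat 2 u = m'.nat 2 u) ∧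
        ((m''.nat 2 i = 0 ∧ ∀ a < j, m.nat 14 (a + k * i) ≠ 1) ∨
          ∃ a < j, m.nat 14 (a + k * i) = 1 ∧ m''.nat 2 i = a + 1)) ?_ ?_
    · rw [h5'] at this
      simp only [ne_eq, not_false_eq_true, Store.writeNat_nat_of_ne,
        Nat.reduceEqDiff] at this ⊢
      refine ⟨fun u hu => ?_, fun u hu => ?_⟩
      · rw [this.1 u (by omega), ih.1 u (by omega)]
      · rcases Nat.lt_succ_iff_lt_or_eq.1 hu with hu | rfl
        · rw [this.1 u (by omega)]
          exact ih.2 u hu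
        · exact this.2
    · exact ⟨fun u _ => by simp, Or.inl ⟨by simpa using ih.1 i le_rfl, fun a ha =>
        absurd ha (by omega)⟩⟩
    · rintro j _ m'' hag2 hx2 ⟨ih1, ih2⟩
      have h29 : m''.nat 29 0 = i := by rw [hag2.1 29 (by simp [writes]), hx]
      have h14 : m''.nat 14 = m.nat 14 := by rw [hag2.1 14 (by simp [writes]), h14']
      have hc : (bitTest 14 (.add (.var 30) (.smul k (.var 29)))).Holds m'' ↔
          m.nat 14 (j + k * i) = 1 := by
        simp [Cond.Holds, NExp.eval, h14, h29, hx2]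
      rw [Store.writeNat_nat_of_ne _ _ _ (by simp), run]
      by_cases hj : m.nat 14 (j + k * i) = 1
      · rw [if_pos (hc.2 hj)]
        simp only [run, NExp.eval, h29, hx2, Store.writeNat_nat_self]
        refine ⟨fun u hu => by rw [Function.update_of_ne hu, ih1 u hu], Or.inr ⟨j, by omega, hj, ?_⟩⟩
        simp
      · rw [if_neg fun h => hj (hc.1 h)]
        refine ⟨ih1, ih2.imp (fun h => ⟨h.1, fun a ha => ?_⟩) ?_⟩
        · rcases Nat.lt_succ_iff_lt_or_eq.1 ha with ha | rfl
          exacts [h.2 a ha, hj]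
        · rintro ⟨a, ha, h⟩
          exact ⟨a, by omega, h⟩

variable (R H) in
/-- The program for Max Partial `H`-Coloring. -/
noncomputable def mainProg : Prog :=
  .seq (sizesProg k).toProg (.seq (setupProg k).toProg
    (.seq (forwardProg R H) (.seq (backwardProg R) (outputProg k).toProg)))

variable (R H) in
/-- A bound for the running time on graphs with `n` vertices. -/
noncomputable def searchTime (n : ℕ) : ℕ :=
  (sizesProg k).cost 0 + ((setupProg k).cost ((n + 1) * (k + 1)) +
    ((depth n k * (levels R (n * k) (depth n k) *
        ((expandProg R H).cost ((n + 1) * (k + 1)) + 12) + 22) + 6) +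
      ((levels R (n * k) (depth n k) * ((combineProg R).cost ((n + 1) * (k + 1)) + 11) + 5) +
        (outputProg k).cost ((n + 1) * (k + 1)))))

/-- At the root both halves meet: the stored value is the weight of an independent set (soundness),
and it is at least the weight of every independent set (completeness). -/
theorem exec_mainProg {w : ℕ → ℝ} {m : Store} (h : Initial G w m)
    (hS : Solvable R G H (depth n k) {y | y < n * k}) :
    ∃ t ≤ searchTime R H n, ∃ m', Exec (mainProg R H) m t m' ∧ ∃ S : Set ℕ,
      S ⊆ {y | y < n * k} ∧ Independent G H S ∧
      (∀ I ⊆ {y | y < n * k}, Independent G H I → weight (n * k) w I ≤ weight (n * k) w S) ∧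
      ∀ u < n, (m'.nat 2 u = 0 ∧ ∀ a < k, a + k * u ∉ S) ∨
        ∃ a < k, a + k * u ∈ S ∧ m'.nat 2 u = a + 1 := by
  -- A common bound for all loop lengths that occur: `n`, `n + 1`, `k`, `n * k` and `n * k + 1`.
  obtain ⟨L, hL⟩ : ∃ L, L = (n + 1) * (k + 1) := ⟨_, rfl⟩
  have hLN : n * k + 1 ≤ L := by rw [hL]; nlinarith
  have hLn : n + 1 ≤ L := by rw [hL]; nlinarith
  have hLk : k ≤ L := by rw [hL]; nlinarith
  obtain ⟨hF, hd⟩ := h.forward (k := k) (R := R) (H := H)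
  set m₁ := (sizesProg k).run m with hm₁
  have hag₁ : Agree [3, 4, 5, 6, 16] [] m m₁ :=
    (agree_run _ m).mono (by simp [sizesProg, writes]) (by simp [sizesProg, writesReal])
  obtain ⟨t₁, ht₁, h₁⟩ := exec_toProg (L := 0) (ws := (sizesProg k).writes) (sizesProg k)
    (by simp [sizesProg, WellFormed]) (fun _ h => h) (by simp [sizesProg, bounds]) m
    (by simp [sizesProg, bounds])
  have h3 : m₁.nat 3 0 = n * k := by
    simp [hm₁, sizesProg, run, NExp.eval, h.size, mul_comm]
  have h5 : m₁.nat 5 0 = k := by simp [hm₁, sizesProg, run, NExp.eval]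
  have h6 : m₁.nat 6 0 = n + 1 := by simp [hm₁, sizesProg, run, NExp.eval, h.size]
  have hb : ∀ v ∈ (setupProg k).bounds, v ∈ [3, 5, 6] := by
    simp [setupProg, rowsProg, itemsProg, sqrtProg, rootProg, bounds]
  set m₂ := (setupProg k).run m₁ with hm₂
  have hag₂ : Agree [7, 8, 9, 10, 11, 12, 13, 20, 29, 30, 33] [] m₁ m₂ := agree_setupProg m₁
  obtain ⟨t₂, ht₂, h₂⟩ := exec_toProg (L := L) (ws := (setupProg k).writes) (setupProg k)
    (by simp [setupProg, rowsProg, itemsProg, sqrtProg, rootProg, WellFormed, writes])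
    (fun _ h => h) (fun v hv hw => by
      have := hb v hv
      simp only [List.mem_cons, List.not_mem_nil, or_false] at this
      rcases this with rfl | rfl | rfl <;>
        simp [setupProg, rowsProg, itemsProg, sqrtProg, rootProg, writes] at hw) m₁
    (fun v hv => by
      have := hb v hv
      simp only [List.mem_cons, List.not_mem_nil, or_false] at this
      rcases this with rfl | rfl | rfl <;> omega)
  have hag₁₂ : Agree [3, 4, 5, 6, 16, 7, 8, 9, 10, 11, 12, 13, 20, 29, 30, 33] [] m m₂ :=
    (hag₁.mono (by simp) (by simp)).trans (hag₂.mono (by simp) (by simp))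
  have h19 : m₂.nat 19 0 = 0 := by rw [hag₁₂.1 19 (by simp), h.zero 19 (by simp)]
  obtain ⟨t₃, ht₃, m₃, h₃, hF₃, k2, k5, -, k14, kr⟩ := exec_forwardProg hLN hF h19 hd
  have hW0 : nodeSet 13 (n * k) m₃ 0 = {y | y < n * k} := hF₃.root
  have hw₃ : m₃.real 0 = w := by rw [kr, hag₁₂.2 0 (by simp), h.weights]
  have hempty : ∀ j, nodeSet 14 (n * k) m₃ j = ∅ := fun j => by
    ext y
    rw [mem_nodeSet, k14, hag₁₂.1 14 (by simp), h.zero 14 (by simp)]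
    simp
  obtain ⟨t₄, ht₄, m₄, h₄, hst₄, b5, b2, hs, hv⟩ := exec_backwardProg (w := w) hLN hF₃ hw₃
    (fun j => by
      rw [hempty, kr, hag₁₂.2 1 (by simp), h.values]
      refine ⟨Set.empty_subset _, fun x hx => absurd hx (Set.notMem_empty x), ?_, le_rfl⟩
      simp [weight])
  have h5₄ : m₄.nat 5 0 = k := by rw [b5, k5, hag₂.1 5 (by simp), h5]
  obtain ⟨t₅, ht₅, h₅⟩ := exec_toProg (L := L) (ws := (outputProg k).writes) (outputProg k)
    (by simp [outputProg, WellFormed, writes])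
    (fun _ h => h) (by simp [outputProg, bounds, writes]) m₄ (by
      simp [outputProg, bounds, h5₄, hst₄.size, hLk]
      omega)
  refine ⟨t₁ + (t₂ + (t₃ + (t₄ + t₅))), ?_, _, .seq h₁ (.seq h₂ (.seq h₃ (.seq h₄ h₅))),
    nodeSet 14 (n * k) m₄ 0, ?_, (hs 0).2.1, ?_, ?_⟩
  · rw [searchTime, ← hL]
    exact add_le_add ht₁ (add_le_add ht₂ (add_le_add ht₃ (add_le_add ht₄ ht₅)))
  · exact hW0 ▸ (hs 0).1
  · intro I hI hind
    rw [← (hs 0).2.2.1]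
    exact weight_le_value (R := R) (H := H) (d := depth n k) (fun i y hy => hy.1) hF₃.expanded
      (fun i => (hs i).2.2.2) hv hS 0 0 (by omega) (by rw [levels]; omega) hW0 I hI hind
  · have hlt : ∀ u < n, ∀ a < k, a + k * u < n * k := fun u hu a ha => by
      have : k * (u + 1) ≤ k * n := Nat.mul_le_mul_left _ hu
      rw [mul_add, mul_comm k n] at this
      omega
    intro u hu
    have hmem : ∀ a < k, a + k * u ∈ nodeSet 14 (n * k) m₄ 0 ↔ m₄.nat 14 (a + k * u) = 1 := by
      intro a ha
      rw [mem_nodeSet, mul_zero, zero_add]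
      exact and_iff_right (hlt u hu a ha)
    rcases run_outputProg hst₄.size h5₄
      (fun u => by rw [b2, k2, hag₁₂.1 2 (by simp), h.zero 2 le_rfl]) u hu with ⟨h1, h2⟩ | h1
    · exact Or.inl ⟨h1, fun a ha hmem' => h2 a ha ((hmem a ha).1 hmem')⟩
    · obtain ⟨a, ha, h1, h2⟩ := h1
      exact Or.inr ⟨a, ha, (hmem a ha).2 h1, h2⟩

end ColoringSearch

namespace ColoringSearch

open RAM RAM.LoopProg

variable {n k : ℕ} {R : ℕ} {G : SimpleGraph (Fin n)} {H : SimpleGraph (Fin k)}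

/-! ## Independent item sets and partial colorings -/

theorem inputStore_real (rev : Fin n → Fin k → ℝ) (u : Fin n) (a : Fin k) :
    (inputStore G rev).real 0 (a + k * u) = rev u a := by
  have hlt : (a + k * u : ℕ) < n * k := (finProdFinEquiv (u, a)).2
  have he : (⟨a + k * u, hlt⟩ : Fin (n * k)) = finProdFinEquiv (u, a) := rfl
  refine (dif_pos ⟨rfl, hlt⟩).trans ?_
  rw [he, Equiv.symm_apply_apply]

open scoped Classical in
theorem initial_inputStore (rev : Fin n → Fin k → ℝ) :
    Initial G ((inputStore G rev).real 0) (inputStore G rev) := by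
  refine ⟨by simp [inputStore], fun u hu v hv => ?_, fun a ha i => ?_, rfl, fun i => ?_⟩
  · rcases hu.lt_or_eq with hu | rfl
    · have hlt : v + n * u < n * n := (finProdFinEquiv ((⟨u, hu⟩, ⟨v, hv⟩) : Fin n × Fin n)).2
      have he : (⟨v + n * u, hlt⟩ : Fin (n * n)) = finProdFinEquiv (⟨u, hu⟩, ⟨v, hv⟩) := rfl
      have hval : (inputStore G rev).nat 1 (v + n * u) =
          if G.Adj ⟨u, hu⟩ ⟨v, hv⟩ then 1 else 0 := by
        simp only [inputStore]
        rw [if_neg (by simp), dif_pos ⟨trivial, hlt⟩, he, Equiv.symm_apply_apply]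
      rw [hval]
      simp [NatAdj, hu, hv]
    -- Row `n` lies behind the end of the matrix, where all cells are 0.
    · simp [inputStore, NatAdj]
  · simp only [inputStore]
    rw [if_neg (by omega), dif_neg (by omega)]
  · simp [inputStore]

/-- The item set `S` describes the partial function `φ`. -/
def Describes (S : Set ℕ) (φ : Fin n → Option (Fin k)) : Prop :=
  ∀ (u : Fin n) (a : Fin k), (a : ℕ) + k * (u : ℕ) ∈ S ↔ φ u = some a

theorem div_mod_of_item (u a : ℕ) (ha : a < k) : (a + k * u) / k = u ∧ (a + k * u) % k = a := by
  rw [Nat.add_mul_div_left _ _ (by omega), Nat.div_eq_of_lt ha, zero_add, Nat.add_mul_mod_self_left,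
    Nat.mod_eq_of_lt ha]
  exact ⟨rfl, rfl⟩

theorem Describes.weight_eq {S : Set ℕ} {φ : Fin n → Option (Fin k)} (h : Describes S φ)
    (rev : Fin n → Fin k → ℝ) :
    weight (n * k) ((inputStore G rev).real 0) S = revenue rev φ := by
  classical
  rw [weight, Finset.sum_range, ← finProdFinEquiv.sum_comp, Fintype.sum_prod_type, revenue]
  refine Finset.sum_congr rfl fun u _ => ?_
  have hval : ∀ a : Fin k, (finProdFinEquiv (u, a) : ℕ) = a + k * u := fun _ => rfl
  simp only [hval, inputStore_real, h u]
  cases φ u with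
  | none => simp
  | some b => simp

theorem exists_item {y : ℕ} (hy : y < n * k) : ∃ (u : Fin n) (a : Fin k), y = a + k * u := by
  refine ⟨(finProdFinEquiv.symm ⟨y, hy⟩).1, (finProdFinEquiv.symm ⟨y, hy⟩).2, ?_⟩
  have := congrArg Fin.val (finProdFinEquiv.apply_symm_apply (⟨y, hy⟩ : Fin (n * k)))
  exact this.symm

theorem Describes.independent {S : Set ℕ} (hS : S ⊆ {y | y < n * k})
    {φ : Fin n → Option (Fin k)} (h : Describes S φ) (hφ : IsPartialColoring G H φ) :
    Independent G H S := by
  intro x hx y hy hc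
  obtain ⟨u, a, rfl⟩ := exists_item (hS hx)
  obtain ⟨v, b, rfl⟩ := exists_item (hS hy)
  rw [h] at hx hy
  have hu := div_mod_of_item (k := k) u a a.2
  have hv := div_mod_of_item (k := k) v b b.2
  simp only [Conflict, Linked, hu, hv] at hc
  rcases hc with hc | ⟨⟨_, _, hadj⟩, hn⟩
  · obtain rfl : u = v := Fin.ext hc
    rw [hx] at hy
    rw [Option.some.inj hy]
  · exact absurd ⟨a.2, b.2, hφ hadj hx hy⟩ hn

theorem Describes.isPartialColoring {S : Set ℕ}
    {φ : Fin n → Option (Fin k)} (h : Describes S φ) (hS : Independent G H S) :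
    IsPartialColoring G H φ := by
  intro u v a b hadj hu hv
  by_contra hn
  have hu' := div_mod_of_item (k := k) u a a.2
  have hv' := div_mod_of_item (k := k) v b b.2
  have := hS _ ((h u a).2 hu) _ ((h v b).2 hv) (by
    simp only [Conflict, Linked, hu', hv']
    exact Or.inr ⟨⟨u.2, v.2, hadj⟩, fun hh => hn hh.2.2⟩)
  have huv : u = v := Fin.ext (by rw [← hu'.1, this, hv'.1])
  exact hadj.ne huv

/-- The output is described by the optimum item set, and every competing coloring describes an
independent item set whose weight is its revenue. -/
theorem solves_of_solvable (rev : Fin n → Fin k → ℝ)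
    (hS : Solvable R G H (depth n k) {y | y < n * k}) :
    ∃ (t : ℕ) (m : Store) (φ : Fin n → Option (Fin k)),
      Exec (mainProg R H) (inputStore G rev) t m ∧ t ≤ searchTime R H n ∧ HoldsOutput m φ ∧
        IsOptimum G H rev φ := by
  obtain ⟨t, ht, m, hex, S, hSn, hind, hopt, hout⟩ :=
    exec_mainProg (initial_inputStore (G := G) rev) hS
  have hex' : ∀ u : Fin n, ∃ o : Option (Fin k),
      m.nat 2 u = o.elim 0 (fun a => (a : ℕ) + 1) ∧
        ∀ a : Fin k, (a : ℕ) + k * (u : ℕ) ∈ S ↔ o = some a := by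
    intro u
    rcases hout u u.2 with ⟨h0, hno⟩ | ⟨a, ha, haS, h1⟩
    · exact ⟨none, h0, fun a => iff_of_false (hno a a.2) (by simp)⟩
    · refine ⟨some ⟨a, ha⟩, h1, fun b => ⟨fun hb => ?_, fun hb => ?_⟩⟩
      · have ha' := div_mod_of_item (k := k) u a ha
        have hb' := div_mod_of_item (k := k) u b b.2
        have := hind _ haS _ hb (Or.inl (by rw [ha'.1, hb'.1]))
        exact congrArg some (Fin.ext (by simpa using this))
      · obtain rfl := Option.some.inj hb
        exact haS
  choose φ hφ hdes using hex'
  have hD : Describes S φ := hdes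
  refine ⟨t, m, φ, hex, ht, hφ, hD.isPartialColoring hind, fun ψ hψ => ?_⟩
  set I : Set ℕ := {y | ∃ (u : Fin n) (a : Fin k), y = a + k * u ∧ ψ u = some a} with hI
  have hIn : I ⊆ {y | y < n * k} := by
    rintro _ ⟨u, a, rfl, -⟩
    exact (finProdFinEquiv (u, a)).2
  have hDI : Describes I ψ := by
    refine fun (u : Fin n) (a : Fin k) => ⟨?_, fun h => ⟨u, a, rfl, h⟩⟩
    rintro ⟨v, b, he, h⟩
    have ha' := div_mod_of_item (k := k) u a a.2
    have hb' := div_mod_of_item (k := k) v b b.2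
    obtain rfl : u = v := Fin.ext (by rw [← ha'.1, he, hb'.1])
    obtain rfl : a = b := Fin.ext (by rw [← ha'.2, he, hb'.2])
    exact h
  rw [← hD.weight_eq (G := G) rev, ← hDI.weight_eq (G := G) rev]
  exact hopt I hIn (hDI.independent hIn hψ)

/-! ## The running time -/

/-- `f(n)` is at most `n` to the power `O(s(n))`. -/
def PowBounded (s f : ℕ → ℕ) : Prop := ∃ A, ∀ n, 2 ≤ n → f n ≤ n ^ (A * s n)

variable {s f g : ℕ → ℕ}

theorem PowBounded.mul (hf : PowBounded s f) (hg : PowBounded s g) :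
    PowBounded s fun n => f n * g n := by
  obtain ⟨A, hA⟩ := hf
  obtain ⟨B, hB⟩ := hg
  refine ⟨A + B, fun n hn => ?_⟩
  rw [add_mul, pow_add]
  exact Nat.mul_le_mul (hA n hn) (hB n hn)

/-- The factor 2 from adding two powers is absorbed by one additional factor `n ^ s n ≥ 2`. -/
theorem PowBounded.add (hs : ∀ n, 1 ≤ s n) (hf : PowBounded s f) (hg : PowBounded s g) :
    PowBounded s fun n => f n + g n := by
  obtain ⟨A, hA⟩ := hf
  obtain ⟨B, hB⟩ := hg
  refine ⟨A + B + 1, fun n hn => ?_⟩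
  have h1 : n ^ (A * s n) ≤ n ^ ((A + B) * s n) :=
    Nat.pow_le_pow_right (by omega) (Nat.mul_le_mul_right _ (by omega))
  have h2 : n ^ (B * s n) ≤ n ^ ((A + B) * s n) :=
    Nat.pow_le_pow_right (by omega) (Nat.mul_le_mul_right _ (by omega))
  have h3 : 2 ≤ n ^ s n := hn.trans (Nat.le_self_pow (by have := hs n; omega) n)
  rw [add_mul _ 1, one_mul, pow_add]
  have := hA n hn
  have := hB n hn
  nlinarith

theorem PowBounded.const (hs : ∀ n, 1 ≤ s n) (c : ℕ) : PowBounded s fun _ => c := by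
  refine ⟨c, fun n hn => ?_⟩
  calc c ≤ 2 ^ c := Nat.lt_two_pow_self.le
    _ ≤ n ^ c := Nat.pow_le_pow_left hn c
    _ ≤ n ^ (c * s n) := Nat.pow_le_pow_right (by omega) (Nat.le_mul_of_pos_right c (hs n))

theorem PowBounded.id (hs : ∀ n, 1 ≤ s n) : PowBounded s fun n => n :=
  ⟨1, fun n _ => Nat.le_self_pow (by have := hs n; omega) n⟩

theorem PowBounded.pow (hf : PowBounded s f) (j : ℕ) : PowBounded s fun n => f n ^ j := by
  obtain ⟨A, hA⟩ := hf
  refine ⟨A * j, fun n hn => ?_⟩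
  rw [show A * j * s n = A * s n * j by ring, pow_mul]
  exact Nat.pow_le_pow_left (hA n hn) j

theorem PowBounded.mono (hg : PowBounded s g) (h : ∀ n, f n ≤ g n) : PowBounded s f :=
  hg.imp fun _ hA n hn => (h n).trans (hA n hn)

/-- With constant exponent function, `f` is polynomially bounded; a polynomial to the power O(s) is
n to the power O(s). -/
theorem PowBounded.pow_exponent (hf : PowBounded (fun _ => 1) f) (j : ℕ) :
    PowBounded s fun n => f n ^ (j * s n) := by
  obtain ⟨A, hA⟩ := hf
  refine ⟨A * j, fun n hn => ?_⟩
  rw [mul_assoc, pow_mul n A]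
  have := hA n hn
  rw [mul_one] at this
  exact Nat.pow_le_pow_left this _

theorem PowBounded.cost (hs : ∀ n, 1 ≤ s n) (p : LoopProg) (k : ℕ) :
    PowBounded s fun n => p.cost ((n + 1) * (k + 1)) := by
  obtain ⟨c, j, h⟩ := p.exists_cost_le
  refine PowBounded.mono ?_ fun n => h _
  exact (PowBounded.const hs c).mul (((((PowBounded.id hs).add hs (.const hs 1)).mul
    (.const hs (k + 1))).add hs (.const hs 1)).pow j)

theorem levels_le (R N j : ℕ) : levels R N j ≤ (branching R N + 1) ^ j := by
  induction j with
  | zero => exact Nat.zero_le _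
  | succ j ih =>
    rw [levels, pow_succ, mul_add, mul_one, mul_comm _ (branching R N)]
    exact add_le_add (Nat.mul_le_mul_left _ ih) (Nat.one_le_pow _ _ (by omega))

/-- The number of nodes is a polynomial raised to the depth, hence the dominant factor; depth and
cost per node are polynomial in `n`. -/
theorem powBounded_searchTime (R : ℕ) (H : SimpleGraph (Fin k)) :
    PowBounded (fun n => Nat.sqrt n + 1) (searchTime R H) := by
  have hs : ∀ n, 1 ≤ Nat.sqrt n + 1 := fun n => Nat.le_add_left _ _
  have hc := fun p => PowBounded.cost (s := fun n => Nat.sqrt n + 1) hs p k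
  have ht : ∀ c, PowBounded (fun n => Nat.sqrt n + 1) fun _ => c := PowBounded.const hs
  have hlev : PowBounded (fun n => Nat.sqrt n + 1) fun n => levels R (n * k) (depth n k) := by
    have h1 : ∀ n, 1 ≤ (fun _ : ℕ => 1) n := fun _ => le_rfl
    have hB : PowBounded (fun _ => 1) fun n => branching R (n * k) + 1 :=
      (((((PowBounded.id h1).mul (.const h1 k)).add h1 (.const h1 1)).pow (R + 3)).mul
        ((PowBounded.id h1).mul (.const h1 k))).add h1 (.const h1 1)
    -- The factor `4 * k + 1` absorbs the final summand 1 of the depth, since ⌊√n⌋ + 1 ≥ 1.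
    refine (hB.pow_exponent (4 * k + 1)).mono fun n => (levels_le _ _ _).trans ?_
    refine Nat.pow_le_pow_right (Nat.succ_pos _) ?_
    rw [depth, add_mul]
    omega
  have hdepth : PowBounded (fun n => Nat.sqrt n + 1) fun n => depth n k := by
    refine PowBounded.mono (g := fun n => 4 * k * (n + 1) + 1)
      (((ht (4 * k)).mul ((PowBounded.id hs).add hs (ht 1))).add hs (ht 1)) fun n => ?_
    have := Nat.mul_le_mul_left (4 * k) (Nat.add_le_add_right (Nat.sqrt_le_self n) 1)
    rw [depth]
    omega
  exact (ht _).add hs ((hc _).add hs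
    (((hdepth.mul ((hlev.mul ((hc _).add hs (ht _))).add hs (ht _))).add hs (ht _)).add hs
      (((hlev.mul ((hc _).add hs (ht _))).add hs (ht _)).add hs (hc _))))

theorem isPowSqrt_of_powBounded {T : ℕ → ℕ} (h : PowBounded (fun n => Nat.sqrt n + 1) T) :
    IsPowSqrt T := by
  obtain ⟨A, hA⟩ := h
  -- ⌊√n⌋ + 1 ≤ 2√n for `n ≥ 1`.
  refine ⟨2 * A, fun n hn => ?_⟩
  have hn1 : (1 : ℝ) ≤ n := by exact_mod_cast (by omega : 1 ≤ n)
  calc (T n : ℝ) ≤ ((n ^ (A * (Nat.sqrt n + 1)) : ℕ) : ℝ) := by exact_mod_cast hA n hn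
    _ = (n : ℝ) ^ ((A * (Nat.sqrt n + 1) : ℕ) : ℝ) := by rw [Real.rpow_natCast]; push_cast; rfl
    _ ≤ (n : ℝ) ^ (2 * A * √(n : ℝ)) := by
      refine Real.rpow_le_rpow_of_exponent_le hn1 ?_
      have h1 : ((Nat.sqrt n : ℕ) : ℝ) ≤ √(n : ℝ) := Real.nat_sqrt_le_real_sqrt
      have h2 : (1 : ℝ) ≤ √(n : ℝ) := Real.one_le_sqrt.2 hn1
      push_cast
      nlinarith [(Nat.cast_nonneg A : (0 : ℝ) ≤ A)]

end ColoringSearch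

/-! ### The main theorem. -/

open ColoringSearch in
theorem solvableInTime_of_free {k : ℕ} (H : SimpleGraph (Fin k)) (s t : ℕ) :
    ∃ T : ℕ → ℕ, IsPowSqrt T ∧
      SolvableInTime H
        (fun _ G => InducedFree (SimpleGraph.pathGraph 6) G ∧ InducedFree (graphL s) G ∧
          InducedFree (graphS t) G) T := by
  obtain ⟨R, hR⟩ := exists_markers s t k
  refine ⟨_, isPowSqrt_of_powBounded (powBounded_searchTime R H), mainProg R H, ?_⟩
  rintro n G rev ⟨hP, hL, hS⟩
  exact solves_of_solvable rev
    -- The machine works with r = ⌊√n⌋ + 1, for which `n ≤ r * r`.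
    (solvable_range hP (hR G H hL hS) (Nat.sqrt_lt'.1 (Nat.lt_succ_self _) |>.le.trans_eq (sq _)))

open ColoringSearch in
theorem mainTheorem5 {k : ℕ} (H : SimpleGraph (Fin k)) :
    (∀ s t : ℕ, ∃ T : ℕ → ℕ, IsPowSqrt T ∧
      SolvableInTime H
        (fun _ G => InducedFree (SimpleGraph.pathGraph 6) G ∧ InducedFree (graphL s) G ∧
          InducedFree (graphS t) G) T) ∧
    (∃ T : ℕ → ℕ, IsPowSqrt T ∧
      SolvableInTime H (fun _ G => InducedFree (SimpleGraph.pathGraph 5) G) T) := by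
  refine ⟨solvableInTime_of_free H, ?_⟩
  -- `S_2` is the path on five vertices, and `L_3` contains it, whereas `L_2` is a 5-cycle and would
  -- not do.
  obtain ⟨T, hT, p, hp⟩ := solvableInTime_of_free H 3 2
  exact ⟨T, hT, p, fun n G rev h => hp n G rev
    ⟨h.of_isIndContained pathGraph_five_isIndContained_pathGraph_six,
      h.of_isIndContained pathGraph_five_isIndContained_graphL,
      h.of_isIndContained pathGraph_five_isIndContained_graphS⟩⟩
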